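/- **Setting.** Let $X$ be a random vector in $\mathbb{R}^d$ with law $\mu$ and joint Lebesgue density $p$, let $\mu_i,p_i,P_i$ be the law, density and distribution function of its $i$-th coordinate (so the marginals are continuous; they are regarded as known), and write $P(x)=(P_1(x_1),\dots,P_d(x_d))$. The copula of $X$ is the law of $P(X)$ on $[0,1]^d$, and $c$ denotes its Lebesgue density. Let $\Phi$ be the standard normal distribution function, acting coordinatewise, let $\tilde p$ be the density of $\Phi^{-1}(P(X))$, and let $\tilde q$ be the density of $\mathcal N(0,I_d)$. Fix $\nu>0$, a parameter set $\Theta\subseteq\mathbb{R}^m$ and measurable functions $c^{\rm ratio}(\cdot;\theta):\mathbb{R}^d\to[0,\infty)$, $\theta\in\Theta$. Assume the model is well specified: for some $\theta\in\Theta$, $c^{\rm ratio}(z;\theta)=c(\Phi(z))$ for almost every $z$. The logistic loss is $$L(\theta)=-\mathbb{E}_{\mu}\ln\frac{c^{\rm ratio}(\Phi^{-1}\circ P(x);\theta)}{\nu+c^{\rm ratio}(\Phi^{-1}\circ P(x);\theta)}-\nu\,\mathbb{E}_{\mu_1\otimes\cdots\otimes\mu_d}\ln\frac{\nu}{\nu+c^{\rm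 ratio}(\Phi^{-1}\circ P(x);\theta)}\in[0,\infty].$$ **1 (Uniqueness).** The copula is absolutely continuous, $L$ has a minimiser over $\Theta$, and $\theta^*\in\Theta$ is a minimiser if and only if $c^{\rm ratio}(\Phi^{-1}\circ P(x);\theta^*)=c(P(x))$ for $\mu_1\otimes\cdots\otimes\mu_d$-almost every $x$. Moreover $c(P(x))=p(x)/\prod_i p_i(x_i)$ for $\mu_1\otimes\cdots\otimes\mu_d$-almost every $x$, and $c(\Phi(z))=\tilde p(z)/\tilde q(z)$ for almost every $z$. Hence the minimising function $c^{\rm ratio}(\cdot;\theta^*)$ is unique up to null sets. **Sampling.** Let $\theta^*$ be a minimiser of $L$ over $\Theta$. Let $X_1,X_2,\dots$ with law $\mu$ and $Y_1,Y_2,\dots$ with law $\mu_1\otimes\cdots\otimes\mu_d$ be all independent, and let $T_p\to\infty$ and $T_q$ be sample sizes with $T_q/T_p\to\nu$. The empirical loss $\hat L$ is $L$ with the two expectations replaced by the averages over $X_1,\dots,X_{T_p}$ and over $Y_1,\dots,Y_{T_q}$. The estimator $\hat\theta$ is a random vector which minimises $\hat L$ over $\Theta$ with probability tending to one. Assume *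 (uniform convergence) $\sup_{\theta\in\Theta}|\hat L(\theta)-L(\theta)|\to0$ in probability; * (identifiability) if $\theta_n\in\Theta$ and $c^{\rm ratio}(\cdot;\theta_n)\to c^{\rm ratio}(\cdot;\theta^*)$ in $\mathcal N(0,I_d)$-probability, then $\theta_n\to\theta^*$. **2 (Consistency).** $\hat\theta\to\theta^*$ in probability. **3 (Asymptotic normality).** Assume in addition * (smoothness) there are an open set $U$ with $\theta^*\in U\subseteq\Theta$ and a function $B$, integrable with respect to both $\tilde p$ and $\tilde q$, such that for almost every $z$, on all of $U$: $c^{\rm ratio}(z;\theta)>0$, the function $\theta\mapsto\ln c^{\rm ratio}(z;\theta)$ is $C^2$, the squared norm of its gradient is at most $B(z)$, and the norm of its second derivative is at most $B(z)$; * (full rank) the $m\times m$ matrix $\mathcal I_\nu=\int g\,g^T F_\nu\,\tilde p\,dz$ has rank $m$, where $g(z)=\nabla_\theta\ln c^{\rm ratio}(z;\theta)|_{\theta^*}$ and $F_\nu=\nu\tilde q/(\tilde p+\nu\tilde q)$. Then $\sqrt{T_p}\,(\hat\theta-\theta^*)$ converges in distribution to $\mathcal N(0,\Sigma)$, where the matrix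 $$\Sigma=\mathcal I_\nu^{-1}-\Big(1+\frac1\nu\Big)\mathcal I_\nu^{-1}\,E(F_\nu g)\,E(F_\nu g)^T\,\mathcal I_\nu^{-1},\qquad E(F_\nu g)=\int F_\nu\, g\,\tilde p\,dz,$$ is positive semidefinite. -/

import Mathlib

open MeasureTheory ProbabilityTheory Filter
open scoped Topology ENNReal NNReal

noncomputable section

namespace RatioCopula

variable {d m : ℕ}

/-- The `i`-th marginal law of a law `μ` on `ℝ^d`. -/
def marginal (μ : Measure (Fin d → ℝ)) (i : Fin d) : Measure ℝ :=
  μ.map (fun x => x i)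

/-- The product of the marginals of `μ`, i.e. the independent version of `μ`. -/
def independentLaw (μ : Measure (Fin d → ℝ)) : Measure (Fin d → ℝ) :=
  Measure.pi (marginal μ)

/-- The vector of marginal distribution functions, `x ↦ (P₁(x₁), …, P_d(x_d))`. -/
def marginalCDF (μ : Measure (Fin d → ℝ)) (x : Fin d → ℝ) : Fin d → ℝ :=
  fun i => cdf (marginal μ i) (x i)

/-- The copula of `μ`, as a law on `[0,1]^d`: the law of `(P₁(X₁), …, P_d(X_d))`. -/
def copula (μ : Measure (Fin d → ℝ)) : Measure (Fin d → ℝ) :=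
  μ.map (marginalCDF μ)

/-- The copula density: the Lebesgue density of the copula. -/
def copulaDensity (μ : Measure (Fin d → ℝ)) (u : Fin d → ℝ) : ℝ≥0 :=
  ((copula μ).rnDeriv volume u).toNNReal

/-- The distribution function `Φ` of the standard normal law. -/
def gaussianCDF (t : ℝ) : ℝ := cdf (gaussianReal 0 1) t

/-- The quantile function `Φ⁻¹` of the standard normal law. -/
def gaussianQuantile (u : ℝ) : ℝ := sInf {t : ℝ | u ≤ gaussianCDF t}

/-- The transformation `Φ⁻¹ ∘ P`, applied coordinatewise. -/
def transform (μ : Measure (Fin d → ℝ)) (x : Fin d → ℝ) : Fin d → ℝ :=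
  fun i => gaussianQuantile (marginalCDF μ x i)

/-- The standard normal law on `ℝ^d`. -/
def gaussianLaw (d : ℕ) : Measure (Fin d → ℝ) :=
  Measure.pi (fun _ => gaussianReal 0 1)

/-- The law of `Φ⁻¹ ∘ P (X)` for `X ∼ μ`. -/
def latentLaw (μ : Measure (Fin d → ℝ)) : Measure (Fin d → ℝ) :=
  μ.map (transform μ)

/-- The density `p̃` of `Φ⁻¹ ∘ P (X)` for `X ∼ μ`. -/
def latentDensity (μ : Measure (Fin d → ℝ)) (z : Fin d → ℝ) : ℝ :=
  ((latentLaw μ).rnDeriv volume z).toReal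

/-- The density `q̃` of the standard normal law on `ℝ^d`. -/
def gaussianDensity (z : Fin d → ℝ) : ℝ := ∏ i, gaussianPDFReal 0 1 (z i)

/-- `-ln u` for `u ∈ [0,1]`, with the value `∞` at `0`. -/
def negLog (u : ℝ) : ℝ≥0∞ :=
  if u ≤ 0 then ∞ else ENNReal.ofReal (-Real.log u)

/-- The loss of the value `r` of the ratio on an observation with label `1`. -/
def lossPos (ν : ℝ) (r : ℝ≥0) : ℝ≥0∞ := negLog (r / (ν + r))

/-- The loss of the value `r` of the ratio on an observation with label `0`. -/
def lossNeg (ν : ℝ) (r : ℝ≥0) : ℝ≥0∞ := negLog (ν / (ν + r))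

/-- The logistic loss `L` of a ratio function `r`, evaluated on the transformed data. Both terms
are expectations of nonnegative functions, and the loss may be infinite. -/
def logisticLoss (μ : Measure (Fin d → ℝ)) (ν : ℝ) (r : (Fin d → ℝ) → ℝ≥0) : ℝ≥0∞ :=
  ∫⁻ x, lossPos ν (r (transform μ x)) ∂μ +
    ENNReal.ofReal ν * ∫⁻ y, lossNeg ν (r (transform μ y)) ∂(independentLaw μ)

/-- The empirical logistic loss of a ratio function `r` on the observations `x₀, …, x_{N-1}` with
label `1` and `y₀, …, y_{M-1}` with label `0`. -/
def empiricalLoss (μ : Measure (Fin d → ℝ)) (ν : ℝ) (N M : ℕ) (x y : ℕ → Fin d → ℝ)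
    (r : (Fin d → ℝ) → ℝ≥0) : ℝ≥0∞ :=
  (N : ℝ≥0∞)⁻¹ * ∑ k ∈ Finset.range N, lossPos ν (r (transform μ (x k))) +
    ENNReal.ofReal ν *
      ((M : ℝ≥0∞)⁻¹ * ∑ k ∈ Finset.range M, lossNeg ν (r (transform μ (y k))))

/-- The supremum over `Θ` of the absolute difference of two `[0,∞]`-valued functions (truncated
subtraction: where both are infinite the difference counts as `0`). -/
def supDist {E : Type*} (Θ : Set E) (f g : E → ℝ≥0∞) : ℝ≥0∞ :=
  ⨆ θ ∈ Θ, max (f θ - g θ) (g θ - f θ)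

/-- The parameter `θs` is identified by its ratio function: if the ratio functions at parameters
`θ n` in `Θ` converge in probability (under the standard normal law) to the one at `θs`, then
`θ n` tends to `θs`. -/
def IdentifiedAt (Θ : Set (EuclideanSpace ℝ (Fin m)))
    (c : EuclideanSpace ℝ (Fin m) → (Fin d → ℝ) → ℝ≥0) (θs : EuclideanSpace ℝ (Fin m)) : Prop :=
  ∀ θ : ℕ → EuclideanSpace ℝ (Fin m), (∀ n, θ n ∈ Θ) →
    TendstoInMeasure (gaussianLaw d) (fun n => c (θ n)) atTop (c θs) →
    Tendsto θ atTop (𝓝 θs)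

/-- The log-ratio is twice continuously differentiable in the parameter near the interior point
`θs` of `Θ`, with derivatives dominated by an integrable function. -/
def SmoothAt (μ : Measure (Fin d → ℝ)) (Θ : Set (EuclideanSpace ℝ (Fin m)))
    (c : EuclideanSpace ℝ (Fin m) → (Fin d → ℝ) → ℝ≥0) (θs : EuclideanSpace ℝ (Fin m)) : Prop :=
  ∃ U : Set (EuclideanSpace ℝ (Fin m)), IsOpen U ∧ θs ∈ U ∧ U ⊆ Θ ∧
    ∃ B : (Fin d → ℝ) → ℝ, Integrable B (latentLaw μ) ∧ Integrable B (gaussianLaw d) ∧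
      ∀ᵐ z : Fin d → ℝ,
        (∀ θ ∈ U, 0 < c θ z) ∧
        ContDiffOn ℝ 2 (fun θ => Real.log (c θ z)) U ∧
        ∀ θ ∈ U, ‖gradient (fun θ' => Real.log (c θ' z)) θ‖ ^ 2 ≤ B z ∧
          ‖iteratedFDeriv ℝ 2 (fun θ' => Real.log (c θ' z)) θ‖ ≤ B z

/-- The score `g(z)`, the gradient of `θ ↦ ln c(z; θ)` at `θs`. It is also the gradient of
`θ ↦ ln (c(z; θ) q̃(z))`, the log of the model for `p̃`. -/
def score (c : EuclideanSpace ℝ (Fin m) → (Fin d → ℝ) → ℝ≥0) (θs : EuclideanSpace ℝ (Fin m))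
    (z : Fin d → ℝ) : EuclideanSpace ℝ (Fin m) :=
  gradient (fun θ => Real.log (c θ z)) θs

/-- The weight `F_ν = ν q̃ / (p̃ + ν q̃)`. -/
def noiseWeight (μ : Measure (Fin d → ℝ)) (ν : ℝ) (z : Fin d → ℝ) : ℝ :=
  ν * gaussianDensity z / (latentDensity μ z + ν * gaussianDensity z)

/-- The matrix `I_ν = ∫ g gᵀ F_ν p̃`. -/
def infoMatrix (μ : Measure (Fin d → ℝ)) (ν : ℝ)
    (c : EuclideanSpace ℝ (Fin m) → (Fin d → ℝ) → ℝ≥0) (θs : EuclideanSpace ℝ (Fin m)) :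
    Matrix (Fin m) (Fin m) ℝ :=
  Matrix.of fun i j =>
    ∫ z, score c θs z i * score c θs z j * noiseWeight μ ν z * latentDensity μ z

/-- The vector `E(F_ν g) = ∫ F_ν g p̃`. -/
def meanScore (μ : Measure (Fin d → ℝ)) (ν : ℝ)
    (c : EuclideanSpace ℝ (Fin m) → (Fin d → ℝ) → ℝ≥0) (θs : EuclideanSpace ℝ (Fin m)) :
    Fin m → ℝ :=
  fun i => ∫ z, noiseWeight μ ν z * score c θs z i * latentDensity μ z

/-- The asymptotic covariance
`Σ = I_ν⁻¹ - (1 + 1/ν) I_ν⁻¹ E(F_ν g) E(F_ν g)ᵀ I_ν⁻¹`. -/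
def asymptoticCov (μ : Measure (Fin d → ℝ)) (ν : ℝ)
    (c : EuclideanSpace ℝ (Fin m) → (Fin d → ℝ) → ℝ≥0) (θs : EuclideanSpace ℝ (Fin m)) :
    Matrix (Fin m) (Fin m) ℝ :=
  (infoMatrix μ ν c θs)⁻¹ -
    (1 + 1 / ν) • ((infoMatrix μ ν c θs)⁻¹ *
      Matrix.vecMulVec (meanScore μ ν c θs) (meanScore μ ν c θs) * (infoMatrix μ ν c θs)⁻¹)

end RatioCopula

end

/-! The problem is moved to the latent space. Under the product of the marginals, `transform μ` is
exactly standard normal; under `μ` it has density `r₀ = copulaDensity μ ∘ gaussianCDFs` with respect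
to the normal law (`map_transform_independentLaw`, `copula_of_density`, `latentLaw_of_copula`). All
that follows concerns `gaussianLaw d` and its reweighting by `r₀`.

Uniqueness. The loss is the normal integral of a conditional risk. The excess of this risk over its
value at the truth is `ν + a` times a Kullback-Leibler divergence of two Bernoulli laws, hence at
least a squared distance (`pointRisk_self_add_le`). The minimal loss is finite, so equal losses
force equal ratios almost everywhere.

Consistency. The same quadratic gap shows that nearly minimal loss means a ratio close in
probability to the true one. Identifiability thus makes the minimiser well separated
(`exists_gap_of_identifiedAt`), and uniform convergence of the loss concludes
(`tendstoInMeasure_of_gap`).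

Normality. With probability tending to one the estimator is an interior minimiser and solves the
score equation (`empirical_score_eq_zero`). The score is linearised at `θs` with an error small
relative to `‖θhat - θs‖` (`tendsto_measure_linearization_error`); an integrable Lipschitz constant
replaces third derivatives, and no prior rate for the estimator is needed. At the truth `r *
noiseProb = ν * dataProb = infoWeight`. Therefore the score is centred, the second derivatives of
the log-ratio cancel from the mean Hessian, which becomes `infoMatrix` (`integral_hessian_add`), and
the second moments of the two score terms add up to the same matrix. The sample sizes are
deterministic, so each sample contributes a variance, not a second moment; the subtracted squared
means give the rank one term of `Σ` (`variance_score_add`). A two-sample central limit theorem and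
the inverse of the mean Hessian yield the limit. `Σ` is positive semidefinite because its quadratic
form is a nonnegative combination of variances. -/

namespace RatioCopula

/-! ### Distribution and quantile functions on the line; the probability integral transform. -/

section Cdf

variable {ρ : Measure ℝ}

variable (ρ) in
/-- The quantile function of a law on the real line. -/
noncomputable def quantile (u : ℝ) : ℝ := sInf {t | u ≤ cdf ρ t}

lemma quantile_cdf {x : ℝ} (hx : ∀ y < x, cdf ρ y < cdf ρ x) : quantile ρ (cdf ρ x) = x := by
  have : {t | cdf ρ x ≤ cdf ρ t} = Set.Ici x := by
    ext t
    simp only [Set.mem_ofPred_eq, Set.mem_Ici]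
    refine ⟨fun h => ?_, fun h => monotone_cdf ρ h⟩
    by_contra hlt
    push Not at hlt
    exact absurd h (not_le.2 (hx t hlt))
  rw [quantile, this, csInf_Ici]

lemma bddBelow_le_cdf {u : ℝ} (hu : 0 < u) : BddBelow {t | u ≤ cdf ρ t} := by
  obtain ⟨b, hb⟩ := ((tendsto_cdf_atBot ρ).eventually (gt_mem_nhds hu)).exists
  refine ⟨b, fun x hx => ?_⟩
  by_contra hlt
  push Not at hlt
  exact absurd (hx.trans (monotone_cdf ρ hlt.le)) (not_le.2 hb)

lemma nonempty_le_cdf {u : ℝ} (hu : u < 1) : {t | u ≤ cdf ρ t}.Nonempty := by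
  obtain ⟨b, hb⟩ := ((tendsto_cdf_atTop ρ).eventually (lt_mem_nhds hu)).exists
  exact ⟨b, hb.le⟩

variable [IsProbabilityMeasure ρ]

/-- The jump at a point is the mass of that point. -/
lemma continuous_cdf [NullSingletonClass ρ] : Continuous (cdf ρ) := by
  refine continuous_iff_continuousAt.2 fun x => ?_
  rw [(monotone_cdf ρ).continuousAt_iff_leftLim_eq_rightLim, StieltjesFunction.rightLim_eq]
  refine le_antisymm ((monotone_cdf ρ).leftLim_le le_rfl) ?_
  have h := (cdf ρ).measure_singleton x
  rw [measure_cdf, measure_singleton] at h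
  have := ENNReal.ofReal_eq_zero.1 h.symm
  linarith

lemma measure_Ioc_eq_zero_of_cdf_eq {a b : ℝ} (h : cdf ρ b = cdf ρ a) :
    ρ (Set.Ioc a b) = 0 := by
  have := (cdf ρ).measure_Ioc a b
  rw [measure_cdf, h] at this
  simpa using this

/-- The set is the part right of `a` of a plateau of the distribution function, and half-open
intervals inside a plateau are null. Local nullity avoids locating the right end: near a point that
is not the largest one the set lies in some `Ioc a y`, and a largest point `x` puts it all in `Ioc a
x`. -/
lemma measure_cdf_level (a : ℝ) : ρ {x | a < x ∧ cdf ρ x = cdf ρ a} = 0 := by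
  set S : Set ℝ := {x | a < x ∧ cdf ρ x = cdf ρ a} with hS
  refine measure_null_of_locally_null S fun x hx => ?_
  by_cases h : ∃ y ∈ S, x < y
  · obtain ⟨y, hy, hxy⟩ := h
    refine ⟨Set.Iio y ∩ S, inter_mem (mem_nhdsWithin_of_mem_nhds (Iio_mem_nhds hxy))
      self_mem_nhdsWithin, ?_⟩
    exact measure_mono_null (t := Set.Ioc a y) (fun z hz => ⟨hz.2.1, le_of_lt hz.1⟩)
      (measure_Ioc_eq_zero_of_cdf_eq hy.2)
  · push Not at h
    exact ⟨S, self_mem_nhdsWithin, measure_mono_null (t := Set.Ioc a x) (fun z hz => ⟨hz.1, h z hz⟩)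
      (measure_Ioc_eq_zero_of_cdf_eq hx.2)⟩

/-- Almost every point is the smallest one with its value of the distribution function. -/
lemma ae_cdf_lt : ∀ᵐ x ∂ρ, ∀ y < x, cdf ρ y < cdf ρ x := by
  -- A plateau ending at `x` contains a rational below `x`, so countably many null sets suffice.
  have h : ∀ᵐ x ∂ρ, ∀ q : ℚ, ¬ ((q : ℝ) < x ∧ cdf ρ x = cdf ρ q) :=
    ae_all_iff.2 fun q => by
      rw [ae_iff]
      simpa using measure_cdf_level (ρ := ρ) (q : ℝ)
  filter_upwards [h] with x hx y hy
  refine lt_of_le_of_ne (monotone_cdf ρ hy.le) fun heq => ?_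
  obtain ⟨q, hyq, hqx⟩ := exists_rat_btwn hy
  refine hx q ⟨hqx, le_antisymm ?_ (monotone_cdf ρ hqx.le)⟩
  rw [← heq]
  exact monotone_cdf ρ hyq.le

lemma le_cdf_quantile [NullSingletonClass ρ] {u : ℝ} (hu : u ∈ Set.Ioo (0 : ℝ) 1) :
    u ≤ cdf ρ (quantile ρ u) :=
  (isClosed_le continuous_const continuous_cdf).csInf_mem (nonempty_le_cdf hu.2)
    (bddBelow_le_cdf hu.1)

lemma quantile_le_iff [NullSingletonClass ρ] {u t : ℝ} (hu : u ∈ Set.Ioo (0 : ℝ) 1) :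
    quantile ρ u ≤ t ↔ u ≤ cdf ρ t :=
  ⟨fun h => (le_cdf_quantile hu).trans (monotone_cdf ρ h), fun h =>
    csInf_le (bddBelow_le_cdf hu.1) h⟩

lemma cdf_quantile [NullSingletonClass ρ] {u : ℝ} (hu : u ∈ Set.Ioo (0 : ℝ) 1) :
    cdf ρ (quantile ρ u) = u := by
  refine le_antisymm ?_ (le_cdf_quantile hu)
  have hlt : ∀ t < quantile ρ u, cdf ρ t ≤ u := fun t ht => by
    by_contra h
    push Not at h
    exact absurd ((quantile_le_iff hu).2 h.le) (not_le.2 ht)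
  exact le_of_tendsto ((continuous_cdf (ρ := ρ)).continuousAt.tendsto.mono_left
    (nhdsWithin_le_nhds (s := Set.Iio (quantile ρ u)))) (eventually_mem_nhdsWithin.mono hlt)

lemma measurable_quantile [NullSingletonClass ρ] : Measurable (quantile ρ) := by
  -- Outside `(0, 1]` the infimum is over all of `ℝ` or over the empty set, and `sInf` returns its
  -- default value `0`. The point `1` can be of either kind and is split off as a singleton.
  refine measurable_of_Iic fun t => ?_
  have h0 : ∀ u ≤ 0, quantile ρ u = 0 := fun u hu => by
    have : {t | u ≤ cdf ρ t} = Set.univ := by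
      ext t; simpa using hu.trans (cdf_nonneg ρ t)
    rw [quantile, this, Real.sInf_univ]
  have h1 : ∀ u, 1 < u → quantile ρ u = 0 := fun u hu => by
    have : {t | u ≤ cdf ρ t} = ∅ := by
      ext t; simpa using (cdf_le_one ρ t).trans_lt hu
    rw [quantile, this, Real.sInf_empty]
  have : quantile ρ ⁻¹' Set.Iic t = (Set.Ioo 0 1 ∩ Set.Iic (cdf ρ t)) ∪
      (({1} ∩ {_u | quantile ρ 1 ≤ t}) ∪ ((Set.Iic 0 ∪ Set.Ioi 1) ∩ {_u | 0 ≤ t})) := by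
    ext u
    simp only [Set.mem_preimage, Set.mem_Iic, Set.mem_union, Set.mem_inter_iff,
      Set.mem_singleton_iff, Set.mem_ofPred_eq, Set.mem_Ioi]
    rcases le_or_gt u 0 with hu | hu
    · have h2 : ¬ u = 1 := by linarith
      have h3 : ¬ u ∈ Set.Ioo (0 : ℝ) 1 := fun h => absurd h.1 (not_lt.2 hu)
      simp [h0 u hu, hu, h2, h3]
    rcases lt_trichotomy u 1 with hu1 | rfl | hu1
    · simp [quantile_le_iff ⟨hu, hu1⟩, hu, hu1, hu1.ne, hu.not_ge, hu1.not_gt]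
    · simp
    · simp [h1 u hu1, hu1, hu.not_ge, hu1.ne', hu1.not_gt]
  rw [this]
  exact (measurableSet_Ioo.inter measurableSet_Iic).union
    (((measurableSet_singleton _).inter (MeasurableSet.const _)).union
      ((measurableSet_Iic.union measurableSet_Ioi).inter (MeasurableSet.const _)))

instance : IsProbabilityMeasure (volume.restrict (Set.Ioo (0 : ℝ) 1)) :=
  ⟨by simp⟩

/-- A law without atoms is the image of the uniform law under its quantile function. -/
lemma map_quantile_uniform [NullSingletonClass ρ] :
    (volume.restrict (Set.Ioo (0 : ℝ) 1)).map (quantile ρ) = ρ := by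
  have := Measure.isProbabilityMeasure_map (μ := volume.restrict (Set.Ioo (0 : ℝ) 1))
    (measurable_quantile (ρ := ρ)).aemeasurable
  refine Measure.ext_of_Iic _ _ fun t => ?_
  rw [Measure.map_apply measurable_quantile measurableSet_Iic,
    Measure.restrict_apply (measurable_quantile measurableSet_Iic), ← ofReal_cdf]
  have h : quantile ρ ⁻¹' Set.Iic t ∩ Set.Ioo 0 1 = Set.Iic (cdf ρ t) ∩ Set.Ioo 0 1 := by
    ext u
    simp only [Set.mem_inter_iff, Set.mem_preimage, Set.mem_Iic]
    exact and_congr_left fun hu => quantile_le_iff hu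
  rw [h]
  -- The two sets can differ only at `1`, when `cdf ρ t = 1`.
  have h2 : volume (Set.Iic (cdf ρ t) ∩ Set.Ioo 0 1) = volume (Set.Ioc 0 (cdf ρ t)) := by
    refine measure_congr ?_
    have h1 : ∀ᵐ u : ℝ, u ≠ 1 := by simp [ae_iff]
    filter_upwards [h1] with u hu
    refine propext ?_
    change (u ≤ cdf ρ t ∧ 0 < u ∧ u < 1) ↔ (0 < u ∧ u ≤ cdf ρ t)
    refine ⟨fun h => ⟨h.2.1, h.1⟩, fun h => ⟨h.2, h.1, lt_of_le_of_ne (h.2.trans (cdf_le_one ρ t)) hu⟩⟩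
  rw [h2, Real.volume_Ioc, sub_zero]

/-- The probability integral transform. -/
lemma map_cdf_eq_uniform [NullSingletonClass ρ] :
    ρ.map (cdf ρ) = volume.restrict (Set.Ioo (0 : ℝ) 1) := by
  -- With `ρ` written as the image of the uniform law under its quantile function, the claim reduces
  -- to `cdf_quantile` on `(0, 1)`.
  conv_lhs => enter [2]; rw [← map_quantile_uniform (ρ := ρ)]
  rw [Measure.map_map (monotone_cdf ρ).measurable measurable_quantile]
  conv_rhs => rw [← Measure.map_id (μ := volume.restrict (Set.Ioo (0 : ℝ) 1))]
  refine Measure.map_congr ?_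
  filter_upwards [ae_restrict_mem measurableSet_Ioo] with u hu
  exact cdf_quantile hu

end Cdf

/-! ### Densities under almost surely injective maps and under products. -/

section WithDensity

variable {α β : Type*} [MeasurableSpace α] [MeasurableSpace β]

/-- The image of a law with a density under an almost surely injective map. -/
lemma map_withDensity_of_leftInverse {ρ : Measure α} {f : α → ℝ≥0∞} (hf : Measurable f)
    {T : α → β} (hT : Measurable T) {S : β → α} (hS : Measurable S)
    (hST : ∀ᵐ x ∂ρ, S (T x) = x) :
    (ρ.withDensity f).map T = (ρ.map T).withDensity (f ∘ S) := by
  ext s hs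
  rw [Measure.map_apply hT hs, withDensity_apply _ (hT hs), withDensity_apply _ hs,
    setLIntegral_map hs (hf.comp hS) hT]
  refine setLIntegral_congr_fun_ae (hT hs) ?_
  filter_upwards [hST] with x hx _
  simp [hx]

lemma pi_withDensity_ofReal {ι : Type*} [Fintype ι] {X : ι → Type*}
    [∀ i, MeasureSpace (X i)] [∀ i, SigmaFinite (volume : Measure (X i))]
    {g : ∀ i, X i → ℝ} (hg : ∀ i, Integrable (g i)) (h0 : ∀ i x, 0 ≤ g i x) :
    Measure.pi (fun i => volume.withDensity (fun x => ENNReal.ofReal (g i x))) =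
      volume.withDensity (fun x : ∀ i, X i => ENNReal.ofReal (∏ i, g i (x i))) := by
  have hfin : ∀ i, IsFiniteMeasure (volume.withDensity (fun x => ENNReal.ofReal (g i x))) :=
    fun i => isFiniteMeasure_withDensity_ofReal (hg i).2
  refine Measure.pi_eq fun s hs => ?_
  -- On a box the truncated product density factorises over coordinates, so Fubini applies.
  have hind : ∀ x : ∀ i, X i, (Set.univ.pi s).indicator
      (fun x => ENNReal.ofReal (∏ i, g i (x i))) x =
      ENNReal.ofReal (∏ i, (s i).indicator (g i) (x i)) := fun x => by
    by_cases hx : x ∈ Set.univ.pi s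
    · rw [Set.indicator_of_mem hx]
      congr 1
      exact Finset.prod_congr rfl fun i _ => (Set.indicator_of_mem (hx i trivial) _).symm
    · rw [Set.indicator_of_notMem hx]
      simp only [Set.mem_pi, Set.mem_univ, true_implies, not_forall] at hx
      obtain ⟨i, hi⟩ := hx
      rw [Finset.prod_eq_zero (Finset.mem_univ i) (Set.indicator_of_notMem hi _), ENNReal.ofReal_zero]
  have hint : ∀ i, Integrable ((s i).indicator (g i)) := fun i => (hg i).indicator (hs i)
  have hnn : ∀ i x, 0 ≤ (s i).indicator (g i) x := fun i x => Set.indicator_nonneg (fun x _ => h0 i x) x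
  rw [withDensity_apply _ (MeasurableSet.univ_pi hs), ← lintegral_indicator (MeasurableSet.univ_pi hs)]
  simp_rw [hind]
  rw [← ofReal_integral_eq_lintegral_ofReal (μ := volume) (Integrable.fintype_prod_dep hint)
    (Eventually.of_forall fun x => Finset.prod_nonneg fun i _ => hnn i _),
    integral_fintype_prod_volume_eq_prod, ENNReal.ofReal_prod_of_nonneg
      (fun i _ => integral_nonneg (hnn i))]
  refine Finset.prod_congr rfl fun i _ => ?_
  rw [ofReal_integral_eq_lintegral_ofReal (hint i) (Eventually.of_forall (hnn i)),
    withDensity_apply _ (hs i), ← lintegral_indicator (hs i)]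
  congr with x
  by_cases hx : x ∈ s i <;> simp [hx]

end WithDensity

/-! ### From the data to the copula and to the Gaussian latent space. -/

section Transform

variable {d : ℕ} {μ : Measure (Fin d → ℝ)}

instance [IsProbabilityMeasure μ] (i : Fin d) : IsProbabilityMeasure (marginal μ i) :=
  Measure.isProbabilityMeasure_map (measurable_pi_apply i).aemeasurable

instance [IsProbabilityMeasure μ] : IsProbabilityMeasure (independentLaw μ) := by
  unfold independentLaw; infer_instance

instance : IsProbabilityMeasure (gaussianLaw d) := by
  unfold gaussianLaw; infer_instance

instance : NullSingletonClass (gaussianReal 0 1) :=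
  nullSingletonClass_gaussianReal (by simp)

/-- The distribution functions of the standard normal law, applied coordinatewise. -/
noncomputable def gaussianCDFs (z : Fin d → ℝ) : Fin d → ℝ := fun i => gaussianCDF (z i)

lemma measurable_gaussianCDFs : Measurable (gaussianCDFs (d := d)) :=
  measurable_pi_lambda _ fun i => (monotone_cdf _).measurable.comp (measurable_pi_apply i)

/-- The quantile functions of the standard normal law, applied coordinatewise. -/
noncomputable def gaussianQuantiles (u : Fin d → ℝ) : Fin d → ℝ := fun i => gaussianQuantile (u i)

lemma measurable_gaussianQuantile : Measurable gaussianQuantile :=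
  measurable_quantile (ρ := gaussianReal 0 1)

lemma measurable_gaussianQuantiles : Measurable (gaussianQuantiles (d := d)) :=
  measurable_pi_lambda _ fun i => measurable_gaussianQuantile.comp (measurable_pi_apply i)

lemma measurable_marginalCDF : Measurable (marginalCDF μ) :=
  measurable_pi_lambda _ fun i => (monotone_cdf _).measurable.comp (measurable_pi_apply i)

lemma transform_eq : transform μ = gaussianQuantiles ∘ marginalCDF μ := rfl

lemma measurable_transform : Measurable (transform μ) :=
  measurable_gaussianQuantiles.comp measurable_marginalCDF

variable [IsProbabilityMeasure μ]

lemma ae_independentLaw_of_marginal {q : ∀ _ : Fin d, ℝ → Prop}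
    (h : ∀ i, ∀ᵐ t ∂(marginal μ i), q i t) :
    ∀ᵐ x ∂(independentLaw μ), ∀ i, q i (x i) :=
  ae_all_iff.2 fun i => (Measure.quasiMeasurePreserving_eval (μ := marginal μ) i).ae (h i)

/-- The uniform law on the unit cube. -/
noncomputable def cubeLaw (d : ℕ) : Measure (Fin d → ℝ) :=
  volume.restrict (Set.univ.pi fun _ => Set.Ioo 0 1)

lemma cubeLaw_eq_pi : cubeLaw d = Measure.pi fun _ => volume.restrict (Set.Ioo (0 : ℝ) 1) := by
  rw [cubeLaw, volume_pi, Measure.restrict_pi_pi]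

lemma measurableSet_cube : MeasurableSet (Set.univ.pi fun _ : Fin d => Set.Ioo (0 : ℝ) 1) :=
  MeasurableSet.univ_pi fun _ => measurableSet_Ioo

lemma map_gaussianQuantiles_cubeLaw : (cubeLaw d).map gaussianQuantiles = gaussianLaw d := by
  have h : (volume.restrict (Set.Ioo (0 : ℝ) 1)).map gaussianQuantile = gaussianReal 0 1 :=
    map_quantile_uniform (ρ := gaussianReal 0 1)
  have := Measure.isProbabilityMeasure_map (μ := volume.restrict (Set.Ioo (0 : ℝ) 1))
    measurable_gaussianQuantile.aemeasurable
  rw [cubeLaw_eq_pi]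
  refine (Measure.pi_map_pi (f := fun _ => gaussianQuantile)
    fun i => measurable_gaussianQuantile.aemeasurable).trans ?_
  simp_rw [h]
  rfl

lemma ae_cubeLaw_gaussianCDFs : ∀ᵐ u ∂(cubeLaw d), gaussianCDFs (gaussianQuantiles u) = u := by
  filter_upwards [ae_restrict_mem measurableSet_cube] with u hu
  funext i
  exact cdf_quantile (ρ := gaussianReal 0 1) (hu i trivial)

lemma gaussianLaw_eq_withDensity :
    gaussianLaw d = volume.withDensity fun z => ENNReal.ofReal (gaussianDensity z) := by
  have h : gaussianReal 0 1 = volume.withDensity fun x => ENNReal.ofReal (gaussianPDFReal 0 1 x) :=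
    gaussianReal_of_var_ne_zero _ (by simp)
  have h2 := pi_withDensity_ofReal (ι := Fin d) (X := fun _ => ℝ)
    (g := fun _ => gaussianPDFReal 0 1) (fun _ => integrable_gaussianPDFReal _ _)
    (fun _ x => gaussianPDFReal_nonneg _ _ x)
  rw [← h] at h2
  exact h2

lemma gaussianDensity_pos (z : Fin d → ℝ) : 0 < gaussianDensity z :=
  Finset.prod_pos fun i _ => gaussianPDFReal_pos _ _ _ (by simp)

lemma measurable_gaussianDensity : Measurable (gaussianDensity (d := d)) :=
  Finset.measurable_prod _ fun i _ => (measurable_gaussianPDFReal _ _).comp (measurable_pi_apply i)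

lemma volume_absolutelyContinuous_gaussianLaw :
    (volume : Measure (Fin d → ℝ)) ≪ gaussianLaw d := by
  rw [gaussianLaw_eq_withDensity]
  refine withDensity_absolutelyContinuous' (by
    exact measurable_gaussianDensity.ennreal_ofReal.aemeasurable) (ae_of_all _ fun z => ?_)
  simpa using gaussianDensity_pos z

lemma gaussianLaw_absolutelyContinuous_volume :
    gaussianLaw d ≪ (volume : Measure (Fin d → ℝ)) := by
  rw [gaussianLaw_eq_withDensity]
  exact withDensity_absolutelyContinuous _ _

omit [IsProbabilityMeasure μ] in
lemma measurable_copulaDensity : Measurable (copulaDensity μ) :=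
  (Measure.measurable_rnDeriv _ _).ennreal_toNNReal

variable [∀ i, NullSingletonClass (marginal μ i)]

lemma map_marginalCDF_independentLaw : (independentLaw μ).map (marginalCDF μ) = cubeLaw d := by
  have h : ∀ i, (marginal μ i).map (cdf (marginal μ i)) = volume.restrict (Set.Ioo (0 : ℝ) 1) :=
    fun i => map_cdf_eq_uniform
  have hm : ∀ i, AEMeasurable (cdf (marginal μ i)) (marginal μ i) :=
    fun i => (monotone_cdf _).measurable.aemeasurable
  have (i : Fin d) := Measure.isProbabilityMeasure_map (hm i)
  rw [cubeLaw_eq_pi]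
  refine (Measure.pi_map_pi (μ := marginal μ) (f := fun i => cdf (marginal μ i)) hm).trans ?_
  simp_rw [h]

/-- Coordinates stay independent under the product law; each becomes uniform by the probability
integral transform, then normal by the normal quantile function. -/
lemma map_transform_independentLaw : (independentLaw μ).map (transform μ) = gaussianLaw d := by
  rw [transform_eq, ← Measure.map_map measurable_gaussianQuantiles measurable_marginalCDF,
    map_marginalCDF_independentLaw, map_gaussianQuantiles_cubeLaw]

/-- The quantile functions of the marginals, applied coordinatewise. -/
noncomputable def marginalQuantiles (μ : Measure (Fin d → ℝ)) (u : Fin d → ℝ) : Fin d → ℝ :=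
  fun i => quantile (marginal μ i) (u i)

lemma measurable_marginalQuantiles : Measurable (marginalQuantiles μ) :=
  measurable_pi_lambda _ fun i => measurable_quantile.comp (measurable_pi_apply i)

-- A marginal distribution function may have plateaus, but almost every point is the left end of its
-- level set, where the quantile function inverts it. This makes the passage to the copula lossless.
omit [∀ i, NullSingletonClass (marginal μ i)] in
lemma ae_marginalQuantiles_marginalCDF :
    ∀ᵐ x ∂(independentLaw μ), marginalQuantiles μ (marginalCDF μ x) = x := by
  filter_upwards [ae_independentLaw_of_marginal fun i => ae_cdf_lt (ρ := marginal μ i)] with x hx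
  funext i
  exact quantile_cdf (hx i)

/-- Only the boundary of the cube, where the normal quantile takes default values, could spoil this,
and it has no mass. -/
lemma ae_gaussianCDFs_transform :
    ∀ᵐ x ∂(independentLaw μ), gaussianCDFs (transform μ x) = marginalCDF μ x := by
  have h := ae_cubeLaw_gaussianCDFs (d := d)
  rw [← map_marginalCDF_independentLaw (μ := μ)] at h
  exact ae_of_ae_map measurable_marginalCDF.aemeasurable h

/-- The consequences for the copula of a density `r` of the law with respect to the product of
its marginals. -/
lemma copula_of_density {r : (Fin d → ℝ) → ℝ≥0} (hr : Measurable r)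
    (hμr : μ = (independentLaw μ).withDensity fun x => (r x : ℝ≥0∞)) :
    (copula μ = volume.withDensity fun u => (copulaDensity μ u : ℝ≥0∞)) ∧
    (copula μ = (cubeLaw d).withDensity fun u => (copulaDensity μ u : ℝ≥0∞)) ∧
    ∀ᵐ x ∂(independentLaw μ), copulaDensity μ (marginalCDF μ x) = r x := by
  -- The candidate copula density on the open cube; it is extended by zero below to compare it with
  -- the Radon-Nikodym derivative on all of `ℝ^d`.
  set s : (Fin d → ℝ) → ℝ≥0 := r ∘ marginalQuantiles μ with hs
  have hsm : Measurable s := hr.comp measurable_marginalQuantiles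
  have h1 : copula μ = (cubeLaw d).withDensity fun u => (s u : ℝ≥0∞) := by
    have := map_withDensity_of_leftInverse (ρ := independentLaw μ)
      (f := fun x => (r x : ℝ≥0∞)) hr.coe_nnreal_ennreal measurable_marginalCDF
      measurable_marginalQuantiles ae_marginalQuantiles_marginalCDF
    rwa [← hμr, map_marginalCDF_independentLaw] at this
  have h2 : copula μ = volume.withDensity
      ((Set.univ.pi fun _ => Set.Ioo 0 1).indicator fun u => (s u : ℝ≥0∞)) := by
    rw [h1, cubeLaw, withDensity_indicator measurableSet_cube]
  have h3 : (copula μ).rnDeriv volume =ᵐ[volume]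
      (Set.univ.pi fun _ => Set.Ioo 0 1).indicator fun u => (s u : ℝ≥0∞) := by
    rw [h2]
    exact Measure.rnDeriv_withDensity _ (hsm.coe_nnreal_ennreal.indicator measurableSet_cube)
  have h4 : ∀ᵐ u, (copulaDensity μ u : ℝ≥0∞) =
      (Set.univ.pi fun _ => Set.Ioo 0 1).indicator (fun u => (s u : ℝ≥0∞)) u := by
    filter_upwards [h3] with u hu
    rw [copulaDensity, hu, ENNReal.coe_toNNReal]
    by_cases hm : u ∈ Set.univ.pi fun _ : Fin d => Set.Ioo (0 : ℝ) 1 <;> simp [hm]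
  have h5 : ∀ᵐ u ∂(cubeLaw d), copulaDensity μ u = s u := by
    filter_upwards [ae_restrict_of_ae h4, ae_restrict_mem measurableSet_cube] with u hu hm
    rw [Set.indicator_of_mem hm] at hu
    exact_mod_cast hu
  refine ⟨?_, ?_, ?_⟩
  · rw [withDensity_congr_ae h4]
    exact h2
  · rw [h1]
    exact withDensity_congr_ae (h5.mono fun u hu => by simp only [hu])
  · rw [← map_marginalCDF_independentLaw (μ := μ)] at h5
    filter_upwards [ae_of_ae_map measurable_marginalCDF.aemeasurable h5,
      ae_marginalQuantiles_marginalCDF (μ := μ)] with x hx hx2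
    rw [hx, hs, Function.comp_apply, hx2]

omit [IsProbabilityMeasure μ] [∀ i, NullSingletonClass (marginal μ i)] in
lemma latentLaw_of_copula
    (h : copula μ = (cubeLaw d).withDensity fun u => (copulaDensity μ u : ℝ≥0∞)) :
    latentLaw μ =
      (gaussianLaw d).withDensity fun z => (copulaDensity μ (gaussianCDFs z) : ℝ≥0∞) := by
  have h1 : latentLaw μ = (copula μ).map gaussianQuantiles := by
    rw [latentLaw, copula, transform_eq, Measure.map_map measurable_gaussianQuantiles
      measurable_marginalCDF]
  rw [h1, h, map_withDensity_of_leftInverse measurable_copulaDensity.coe_nnreal_ennreal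
    measurable_gaussianQuantiles measurable_gaussianCDFs ae_cubeLaw_gaussianCDFs,
    map_gaussianQuantiles_cubeLaw]
  rfl

omit [IsProbabilityMeasure μ] [∀ i, NullSingletonClass (marginal μ i)] in
lemma latentDensity_of_withDensity {r : (Fin d → ℝ) → ℝ≥0} (hr : Measurable r)
    (h : latentLaw μ = (gaussianLaw d).withDensity fun z => (r z : ℝ≥0∞)) :
    ∀ᵐ z : Fin d → ℝ, latentDensity μ z = r z * gaussianDensity z := by
  rw [gaussianLaw_eq_withDensity, ← withDensity_mul _
    measurable_gaussianDensity.ennreal_ofReal hr.coe_nnreal_ennreal] at h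
  have := Measure.rnDeriv_withDensity (volume : Measure (Fin d → ℝ))
    (measurable_gaussianDensity.ennreal_ofReal.mul hr.coe_nnreal_ennreal)
  rw [← h] at this
  filter_upwards [this] with z hz
  rw [latentDensity, hz]
  simp [ENNReal.toReal_mul, (gaussianDensity_pos z).le, mul_comm]

end Transform

lemma nullSingletonClass_withDensity {f : ℝ → ℝ≥0∞} {ρ : Measure ℝ}
    (h : ρ = volume.withDensity f) : NullSingletonClass ρ :=
  ⟨fun x => by rw [h]; exact withDensity_absolutelyContinuous _ _ (measure_singleton x)⟩

/-- The density of a law with respect to the product of its marginals. -/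
lemma eq_withDensity_independentLaw {d : ℕ} {μ : Measure (Fin d → ℝ)} [IsProbabilityMeasure μ]
    {p : (Fin d → ℝ) → ℝ≥0} (hp : Measurable p)
    (hμ : μ = volume.withDensity (fun x => (p x : ℝ≥0∞)))
    {pm : Fin d → ℝ → ℝ≥0} (hpm : ∀ i, Measurable (pm i))
    (hμm : ∀ i, marginal μ i = volume.withDensity (fun t => (pm i t : ℝ≥0∞))) :
    μ = (independentLaw μ).withDensity fun x => ((p x / ∏ i, pm i (x i) : ℝ≥0) : ℝ≥0∞) := by
  have hint : ∀ i, Integrable (fun t => (pm i t : ℝ)) := fun i => by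
    refine ⟨(hpm i).coe_nnreal_real.aestronglyMeasurable, ?_⟩
    have h1 : marginal μ i Set.univ = 1 := measure_univ
    rw [hμm i, withDensity_apply _ MeasurableSet.univ, Measure.restrict_univ] at h1
    simp [HasFiniteIntegral, h1, enorm_eq_nnnorm]
  have hprod : Measurable fun x : Fin d → ℝ => ∏ i, pm i (x i) :=
    Finset.measurable_prod _ fun i _ => (hpm i).comp (measurable_pi_apply i)
  have hind : independentLaw μ =
      volume.withDensity fun x => ((∏ i, pm i (x i) : ℝ≥0) : ℝ≥0∞) := by
    have h2 := pi_withDensity_ofReal (ι := Fin d) (X := fun _ => ℝ)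
      (g := fun i t => (pm i t : ℝ)) hint (fun _ _ => NNReal.coe_nonneg _)
    simp only [ENNReal.ofReal_coe_nnreal, ← hμm, ← NNReal.coe_prod] at h2
    exact h2
  -- A law gives no mass to the zeros of its own density, so almost surely no marginal density
  -- vanishes. Hence `p` vanishes wherever the product does, and the quotient `0 / 0 = 0` is
  -- harmless.
  have hzero : ∀ᵐ x ∂μ, ∏ i, pm i (x i) ≠ 0 := by
    have h1 : ∀ i, ∀ᵐ x ∂μ, pm i (x i) ≠ 0 := fun i => by
      have : ∀ᵐ t ∂(marginal μ i), pm i t ≠ 0 := by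
        rw [hμm i, ae_withDensity_iff (hpm i).coe_nnreal_ennreal]
        exact ae_of_all _ fun t ht => by exact_mod_cast ht
      exact ae_of_ae_map (f := fun x : Fin d → ℝ => x i) (measurable_pi_apply i).aemeasurable this
    filter_upwards [ae_all_iff.2 h1] with x hx
    exact Finset.prod_ne_zero_iff.2 fun i _ => hx i
  have hzero' : ∀ᵐ x : Fin d → ℝ, ∏ i, pm i (x i) = 0 → p x = 0 := by
    rw [hμ, ae_withDensity_iff hp.coe_nnreal_ennreal] at hzero
    filter_upwards [hzero] with x hx h0
    by_contra hne
    exact hx (by exact_mod_cast hne) h0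
  have hr : Measurable fun x => p x / ∏ i, pm i (x i) := hp.div hprod
  rw [hind, ← withDensity_mul _ hprod.coe_nnreal_ennreal hr.coe_nnreal_ennreal]
  conv_lhs => rw [hμ]
  refine withDensity_congr_ae ?_
  filter_upwards [hzero'] with x hx
  simp only [Pi.mul_apply]
  rw [← ENNReal.coe_mul]
  congr 1
  by_cases h0 : ∏ i, pm i (x i) = 0
  · rw [hx h0, h0, zero_mul]
  · rw [mul_div_cancel₀ _ h0]

/-! ### The conditional logistic risk and its quadratic lower bound. -/

section Risk

lemma measurable_negLog : Measurable negLog :=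
  Measurable.ite measurableSet_Iic measurable_const
    (Real.measurable_log.neg.ennreal_ofReal)

lemma negLog_of_pos {u : ℝ} (hu : 0 < u) : negLog u = ENNReal.ofReal (-Real.log u) :=
  if_neg (not_le.2 hu)

lemma measurable_lossPos (ν : ℝ) : Measurable (lossPos ν) :=
  measurable_negLog.comp (by fun_prop)

lemma measurable_lossNeg (ν : ℝ) : Measurable (lossNeg ν) :=
  measurable_negLog.comp (by fun_prop)

/-- The conditional risk of the value `b` of the ratio where the true ratio is `a`. -/
noncomputable def pointRisk (ν : ℝ) (a b : ℝ≥0) : ℝ≥0∞ :=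
  a * lossPos ν b + ENNReal.ofReal ν * lossNeg ν b

/-- The gap in the bound below the excess of the conditional risk. -/
noncomputable def riskGap (ν : ℝ) (a b : ℝ≥0) : ℝ :=
  ν / 4 * ((a : ℝ) / (ν + a) - b / (ν + b)) ^ 2

/-- This is `1 + log (y / x) ≤ y / x`, multiplied by `2 * x ^ 2`. With probabilities written as
squares, the sum over both outcomes bounds the divergence below by a squared Hellinger distance. -/
lemma two_mul_sub_le_mul_log {x y : ℝ} (hx : 0 ≤ x) (hy : 0 < y) :
    2 * x ^ 2 - 2 * x * y ≤ x ^ 2 * (Real.log (x ^ 2) - Real.log (y ^ 2)) := by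
  rcases hx.eq_or_lt with rfl | hx
  · simp
  have h := Real.add_one_le_exp (Real.log (y / x))
  rw [Real.exp_log (by positivity), Real.log_div hy.ne' hx.ne'] at h
  rw [Real.log_pow, Real.log_pow]
  have h2 : x * (Real.log y - Real.log x + 1) ≤ y := by
    calc _ ≤ x * (y / x) := by gcongr
      _ = y := by field_simp
  push_cast
  nlinarith

/-- A quadratic lower bound for the Kullback-Leibler divergence of Bernoulli laws. -/
lemma sq_sub_le_bernoulli_kl {p₀ q₀ p q : ℝ} (hp₀ : 0 ≤ p₀) (hq₀ : 0 ≤ q₀) (hp : 0 < p)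
    (hq : 0 < q) (h₀ : p₀ + q₀ = 1) (h : p + q = 1) :
    (p₀ - p) ^ 2 / 4 ≤ p₀ * (Real.log p₀ - Real.log p) + q₀ * (Real.log q₀ - Real.log q) := by
  have h1 := two_mul_sub_le_mul_log (Real.sqrt_nonneg p₀) (Real.sqrt_pos.2 hp)
  have h2 := two_mul_sub_le_mul_log (Real.sqrt_nonneg q₀) (Real.sqrt_pos.2 hq)
  have e1 := Real.sq_sqrt hp₀
  have e2 := Real.sq_sqrt hq₀
  have e3 := Real.sq_sqrt hp.le
  have e4 := Real.sq_sqrt hq.le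
  rw [e1, e3] at h1
  rw [e2, e4] at h2
  have hx : √p₀ ≤ 1 := Real.sqrt_le_one.2 (by linarith)
  have hy : √p ≤ 1 := Real.sqrt_le_one.2 (by linarith)
  -- Factor `p₀ - p` through the square roots; the sum of the roots is at most `2`, whence the `4`.
  have h3 : (p₀ - p) ^ 2 ≤ 4 * (√p₀ - √p) ^ 2 := by
    have : p₀ - p = (√p₀ - √p) * (√p₀ + √p) := by nlinarith
    rw [this, mul_pow, mul_comm]
    have : (√p₀ + √p) ^ 2 ≤ 4 := by
      nlinarith [Real.sqrt_nonneg p₀, Real.sqrt_nonneg p]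
    gcongr
  nlinarith [sq_nonneg (√q₀ - √q)]

variable {ν : ℝ}

lemma lossPos_of_pos (hν : 0 < ν) {b : ℝ≥0} (hb : 0 < b) :
    lossPos ν b = ENNReal.ofReal (-Real.log (b / (ν + b))) :=
  negLog_of_pos (by positivity)

lemma lossNeg_eq (hν : 0 < ν) (b : ℝ≥0) :
    lossNeg ν b = ENNReal.ofReal (-Real.log (ν / (ν + b))) :=
  negLog_of_pos (by positivity)

lemma neg_log_nonneg_pos (hν : 0 < ν) (b : ℝ≥0) : 0 ≤ -Real.log ((b : ℝ) / (ν + b)) := by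
  have : (b : ℝ) / (ν + b) ≤ 1 := (div_le_one (by positivity)).2 (by linarith)
  linarith [Real.log_nonpos (by positivity) this]

lemma neg_log_nonneg_neg (hν : 0 < ν) (b : ℝ≥0) : 0 ≤ -Real.log (ν / (ν + b)) := by
  have : ν / (ν + b) ≤ 1 := (div_le_one (by positivity)).2 (by simp)
  linarith [Real.log_nonpos (by positivity) this]

/-- For `a = 0` the value `b = 0` is allowed: the infinite loss then carries the weight `0`. -/
lemma pointRisk_of_pos (hν : 0 < ν) (a : ℝ≥0) {b : ℝ≥0} (h : a ≠ 0 → 0 < b) :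
    pointRisk ν a b = ENNReal.ofReal
      (a * -Real.log (b / (ν + b)) + ν * -Real.log (ν / (ν + b))) := by
  rw [pointRisk, lossNeg_eq hν, ENNReal.ofReal_add (mul_nonneg a.coe_nonneg (neg_log_nonneg_pos hν b))
    (mul_nonneg hν.le (neg_log_nonneg_neg hν b)), ENNReal.ofReal_mul hν.le,
    ENNReal.ofReal_mul a.coe_nonneg]
  congr 1
  by_cases ha : a = 0
  · simp [ha]
  · rw [lossPos_of_pos hν (h ha)]
    simp

lemma riskGap_nonneg (hν : 0 < ν) (a b : ℝ≥0) : 0 ≤ riskGap ν a b := by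
  unfold riskGap; positivity

lemma riskGap_eq_zero_iff (hν : 0 < ν) (a b : ℝ≥0) : riskGap ν a b = 0 ↔ b = a := by
  have h1 : ν + (a : ℝ) ≠ 0 := by positivity
  have h2 : ν + (b : ℝ) ≠ 0 := by positivity
  rw [riskGap, mul_eq_zero_iff_left (by positivity), sq_eq_zero_iff, sub_eq_zero,
    div_eq_div_iff h1 h2]
  constructor
  · intro h
    have : ν * ((b : ℝ) - a) = 0 := by linarith
    have := (mul_eq_zero.1 this).resolve_left hν.ne'
    exact_mod_cast (sub_eq_zero.1 this)
  · rintro rfl; ring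

lemma measurable_riskGap {α : Type*} [MeasurableSpace α] {a b : α → ℝ≥0} (ha : Measurable a)
    (hb : Measurable b) : Measurable fun z => riskGap ν (a z) (b z) := by
  unfold riskGap; fun_prop

/-- The excess risk is `ν + a` times the divergence between the label laws with ratios `a` and `b`;
bounding `ν + a` below by `ν` gives `riskGap`. If `b = 0`, either `a = 0` too or the right side is
infinite. -/
lemma pointRisk_self_add_le (hν : 0 < ν) (a b : ℝ≥0) :
    pointRisk ν a a + ENNReal.ofReal (riskGap ν a b) ≤ pointRisk ν a b := by
  by_cases hb : b = 0
  · by_cases ha : a = 0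
    · subst ha hb
      simp [(riskGap_eq_zero_iff hν 0 0).2]
    · have : pointRisk ν a b = ∞ := by
        have : lossPos ν b = ∞ := by simp [hb, lossPos, negLog]
        rw [pointRisk, this, ENNReal.mul_top (by exact_mod_cast ha), top_add]
      rw [this]
      exact le_top
  have hb : 0 < b := pos_iff_ne_zero.2 hb
  have hνa : 0 < ν + (a : ℝ) := by positivity
  have hνb : 0 < ν + (b : ℝ) := by positivity
  rw [pointRisk_of_pos hν a (fun h => pos_iff_ne_zero.2 h), pointRisk_of_pos hν a (fun _ => hb),
    ← ENNReal.ofReal_add (add_nonneg (mul_nonneg a.coe_nonneg (neg_log_nonneg_pos hν a))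
      (mul_nonneg hν.le (neg_log_nonneg_neg hν a))) (riskGap_nonneg hν a b)]
  apply ENNReal.ofReal_le_ofReal
  have hkl := sq_sub_le_bernoulli_kl (p₀ := a / (ν + a)) (q₀ := ν / (ν + a)) (p := b / (ν + b))
    (q := ν / (ν + b)) (by positivity) (by positivity) (by positivity) (by positivity)
    (by field_simp; ring) (by field_simp; ring)
  have hkl2 := mul_le_mul_of_nonneg_left hkl hνa.le
  have e1 : (ν + a) * ((a : ℝ) / (ν + a)) = a := by field_simp
  have e2 : (ν + a) * (ν / (ν + a)) = ν := by field_simp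
  rw [mul_add, ← mul_assoc, ← mul_assoc, e1, e2] at hkl2
  have : riskGap ν a b ≤ (ν + a) * (((a : ℝ) / (ν + a) - b / (ν + b)) ^ 2 / 4) := by
    rw [riskGap]
    have : 0 ≤ (a : ℝ) * ((a : ℝ) / (ν + a) - b / (ν + b)) ^ 2 := by positivity
    linarith
  linarith

end Risk

/-! ### The logistic loss as a Gaussian integral, and its minimisers. -/

section Loss

variable {d : ℕ} {μ : Measure (Fin d → ℝ)} {ν : ℝ} {r₀ : (Fin d → ℝ) → ℝ≥0}

lemma lintegral_transform_independentLaw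
    (hind : (independentLaw μ).map (transform μ) = gaussianLaw d)
    {f : (Fin d → ℝ) → ℝ≥0∞} (hf : Measurable f) :
    ∫⁻ x, f (transform μ x) ∂(independentLaw μ) = ∫⁻ z, f z ∂(gaussianLaw d) := by
  rw [← hind, lintegral_map hf measurable_transform]

lemma lintegral_transform (hr₀ : Measurable r₀)
    (hlat : latentLaw μ = (gaussianLaw d).withDensity fun z => (r₀ z : ℝ≥0∞))
    {f : (Fin d → ℝ) → ℝ≥0∞} (hf : Measurable f) :
    ∫⁻ x, f (transform μ x) ∂μ = ∫⁻ z, r₀ z * f z ∂(gaussianLaw d) := by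
  rw [← lintegral_map hf measurable_transform]
  change ∫⁻ z, f z ∂(latentLaw μ) = _
  rw [hlat, lintegral_withDensity_eq_lintegral_mul _ hr₀.coe_nnreal_ennreal hf]
  rfl

lemma logisticLoss_eq (hr₀ : Measurable r₀)
    (hlat : latentLaw μ = (gaussianLaw d).withDensity fun z => (r₀ z : ℝ≥0∞))
    (hind : (independentLaw μ).map (transform μ) = gaussianLaw d)
    {r : (Fin d → ℝ) → ℝ≥0} (hr : Measurable r) :
    logisticLoss μ ν r = ∫⁻ z, pointRisk ν (r₀ z) (r z) ∂(gaussianLaw d) := by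
  have h1 : Measurable fun z => lossPos ν (r z) := (measurable_lossPos ν).comp hr
  have h2 : Measurable fun z => lossNeg ν (r z) := (measurable_lossNeg ν).comp hr
  rw [logisticLoss, lintegral_transform hr₀ hlat (f := fun z => lossPos ν (r z)) h1,
    lintegral_transform_independentLaw hind (f := fun z => lossNeg ν (r z)) h2,
    ← lintegral_const_mul _ h2, ← lintegral_add_left (f := fun z => (r₀ z : ℝ≥0∞) * lossPos ν (r z))
      (hr₀.coe_nnreal_ennreal.mul h1)]
  rfl

lemma logisticLoss_add_gap_le (hν : 0 < ν) (hr₀ : Measurable r₀)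
    (hlat : latentLaw μ = (gaussianLaw d).withDensity fun z => (r₀ z : ℝ≥0∞))
    (hind : (independentLaw μ).map (transform μ) = gaussianLaw d)
    {r : (Fin d → ℝ) → ℝ≥0} (hr : Measurable r) :
    logisticLoss μ ν r₀ + ∫⁻ z, ENNReal.ofReal (riskGap ν (r₀ z) (r z)) ∂(gaussianLaw d) ≤
      logisticLoss μ ν r := by
  rw [logisticLoss_eq hr₀ hlat hind hr, logisticLoss_eq hr₀ hlat hind hr₀,
    ← lintegral_add_right _ (measurable_riskGap hr₀ hr).ennreal_ofReal]
  exact lintegral_mono fun z => pointRisk_self_add_le hν _ _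

/-- The true ratio does at least as well as the constant ratio `1`, whose loss is finite. Finiteness
is what allows the minimal loss to be cancelled later. -/
lemma logisticLoss_lt_top (hν : 0 < ν) [IsProbabilityMeasure μ] (hr₀ : Measurable r₀)
    (hlat : latentLaw μ = (gaussianLaw d).withDensity fun z => (r₀ z : ℝ≥0∞))
    (hind : (independentLaw μ).map (transform μ) = gaussianLaw d) :
    logisticLoss μ ν r₀ < ∞ := by
  refine lt_of_le_of_lt (le_self_add.trans (logisticLoss_add_gap_le hν hr₀ hlat hind
    (measurable_const (a := (1 : ℝ≥0))))) ?_
  rw [logisticLoss, lossNeg_eq hν, lossPos_of_pos hν one_pos]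
  simp [ENNReal.mul_lt_top]

lemma logisticLoss_congr_ae {r₁ r₂ : (Fin d → ℝ) → ℝ≥0} (hr₀ : Measurable r₀)
    (hlat : latentLaw μ = (gaussianLaw d).withDensity fun z => (r₀ z : ℝ≥0∞))
    (hind : (independentLaw μ).map (transform μ) = gaussianLaw d)
    (h₁ : Measurable r₁) (h₂ : Measurable r₂) (h : ∀ᵐ z ∂(gaussianLaw d), r₁ z = r₂ z) :
    logisticLoss μ ν r₁ = logisticLoss μ ν r₂ := by
  rw [logisticLoss_eq hr₀ hlat hind h₁, logisticLoss_eq hr₀ hlat hind h₂]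
  exact lintegral_congr_ae (h.mono fun z hz => by simp only [hz])

lemma ae_eq_of_logisticLoss_le (hν : 0 < ν) [IsProbabilityMeasure μ] (hr₀ : Measurable r₀)
    (hlat : latentLaw μ = (gaussianLaw d).withDensity fun z => (r₀ z : ℝ≥0∞))
    (hind : (independentLaw μ).map (transform μ) = gaussianLaw d)
    {r : (Fin d → ℝ) → ℝ≥0} (hr : Measurable r)
    (h : logisticLoss μ ν r ≤ logisticLoss μ ν r₀) :
    ∀ᵐ z ∂(gaussianLaw d), r z = r₀ z := by
  have h1 := (logisticLoss_add_gap_le hν hr₀ hlat hind hr).trans h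
  have h2 : ∫⁻ z, ENNReal.ofReal (riskGap ν (r₀ z) (r z)) ∂(gaussianLaw d) ≤ 0 := by
    refine ENNReal.le_of_add_le_add_left (logisticLoss_lt_top hν hr₀ hlat hind).ne ?_
    rwa [add_zero]
  have h3 := (lintegral_eq_zero_iff (measurable_riskGap hr₀ hr).ennreal_ofReal).1
    (nonpos_iff_eq_zero.1 h2)
  filter_upwards [h3] with z hz
  exact (riskGap_eq_zero_iff hν _ _).1
    (le_antisymm (ENNReal.ofReal_eq_zero.1 hz) (riskGap_nonneg hν _ _))

variable {E : Type*} {Θ : Set E} {c : E → (Fin d → ℝ) → ℝ≥0}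

/-- The minimisers of the loss in a well specified model are the parameters of the truth. -/
lemma isMinOn_logisticLoss_iff (hν : 0 < ν) [IsProbabilityMeasure μ] (hr₀ : Measurable r₀)
    (hlat : latentLaw μ = (gaussianLaw d).withDensity fun z => (r₀ z : ℝ≥0∞))
    (hind : (independentLaw μ).map (transform μ) = gaussianLaw d)
    (hc : ∀ θ ∈ Θ, Measurable (c θ))
    (hwell : ∃ θ ∈ Θ, ∀ᵐ z ∂(gaussianLaw d), c θ z = r₀ z) {θs : E} (hθs : θs ∈ Θ) :
    IsMinOn (fun θ => logisticLoss μ ν (c θ)) Θ θs ↔ ∀ᵐ z ∂(gaussianLaw d), c θs z = r₀ z := by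
  constructor
  · intro h
    obtain ⟨θ, hθ, hθr⟩ := hwell
    refine ae_eq_of_logisticLoss_le hν hr₀ hlat hind (hc θs hθs) ?_
    rw [← logisticLoss_congr_ae hr₀ hlat hind (hc θ hθ) hr₀ hθr]
    exact h hθ
  · intro h θ hθ
    change logisticLoss μ ν (c θs) ≤ logisticLoss μ ν (c θ)
    rw [logisticLoss_congr_ae hr₀ hlat hind (hc θs hθs) hr₀ h]
    exact le_self_add.trans (logisticLoss_add_gap_le hν hr₀ hlat hind (hc θ hθ))

/-- The gap controls `b / (ν + b)`, and `b ↦ ν / (ν + b)` has the continuous inverse `s ↦ ν / s - ν`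
on positive `s`. -/
lemma tendsto_of_riskGap_tendsto (hν : 0 < ν) {a : ℝ≥0} {b : ℕ → ℝ≥0}
    (h : Tendsto (fun n => riskGap ν a (b n)) atTop (𝓝 0)) : Tendsto b atTop (𝓝 a) := by
  have h1 : Tendsto (fun n => ((a : ℝ) / (ν + a) - b n / (ν + b n)) ^ 2) atTop (𝓝 0) := by
    have := h.const_mul (4 / ν)
    rw [mul_zero] at this
    refine this.congr fun n => ?_
    rw [riskGap]
    field_simp
  have h2 : Tendsto (fun n => (a : ℝ) / (ν + a) - b n / (ν + b n)) atTop (𝓝 0) := by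
    rw [tendsto_zero_iff_abs_tendsto_zero]
    have := h1.sqrt
    rw [Real.sqrt_zero] at this
    exact this.congr fun n => Real.sqrt_sq_eq_abs _
  have ha : ν + (a : ℝ) ≠ 0 := by positivity
  have h3 : Tendsto (fun n => ν / (ν + b n)) atTop (𝓝 (ν / (ν + a))) := by
    have h4 := h2.add_const (ν / (ν + a))
    rw [zero_add] at h4
    refine h4.congr fun n => ?_
    have hb : ν + (b n : ℝ) ≠ 0 := by positivity
    field_simp
    ring
  have h5 : Tendsto (fun n => ν / (ν / (ν + b n)) - ν) atTop (𝓝 (ν / (ν / (ν + a)) - ν)) :=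
    (tendsto_const_nhds.div h3 (by positivity)).sub_const ν
  refine NNReal.tendsto_coe.1 ?_
  convert h5 using 2
  · rename_i n
    have hb : ν + (b n : ℝ) ≠ 0 := by positivity
    field_simp
    ring
  · field_simp
    ring

end Loss

/-! ### Separation of the minimiser and consistency. -/

section Consistency

variable {d m : ℕ} {μ : Measure (Fin d → ℝ)} {ν : ℝ} {r₀ : (Fin d → ℝ) → ℝ≥0}
  {Θ : Set (EuclideanSpace ℝ (Fin m))} {c : EuclideanSpace ℝ (Fin m) → (Fin d → ℝ) → ℝ≥0}

/-- An identified minimiser of the loss is well separated. -/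
lemma exists_gap_of_identifiedAt (hν : 0 < ν) [IsProbabilityMeasure μ] (hr₀ : Measurable r₀)
    (hlat : latentLaw μ = (gaussianLaw d).withDensity fun z => (r₀ z : ℝ≥0∞))
    (hind : (independentLaw μ).map (transform μ) = gaussianLaw d)
    (hc : ∀ θ ∈ Θ, Measurable (c θ)) {θs : EuclideanSpace ℝ (Fin m)}
    (hs : ∀ᵐ z ∂(gaussianLaw d), c θs z = r₀ z) (hid : IdentifiedAt Θ c θs)
    {ε : ℝ} (hε : 0 < ε) :
    ∃ δ : ℝ≥0∞, 0 < δ ∧ δ ≠ ∞ ∧ ∀ θ ∈ Θ, logisticLoss μ ν (c θ) ≤ logisticLoss μ ν r₀ + δ →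
      dist θ θs < ε := by
  by_contra hcon
  push Not at hcon
  -- Excess losses of size `2⁻¹ ^ n` are summable, so the gaps tend to zero almost everywhere along
  -- the whole sequence, without passing to a subsequence.
  have hpos : ∀ n : ℕ, (0 : ℝ≥0∞) < 2⁻¹ ^ n := fun n => ENNReal.pow_pos (by simp) n
  have hfin : ∀ n : ℕ, (2⁻¹ ^ n : ℝ≥0∞) ≠ ∞ := fun n => ENNReal.pow_ne_top (by simp)
  choose θ hθ hle hdist using fun n : ℕ => hcon (2⁻¹ ^ n) (hpos n) (hfin n)
  have hgap : ∀ n, ∫⁻ z, ENNReal.ofReal (riskGap ν (r₀ z) (c (θ n) z)) ∂(gaussianLaw d) ≤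
      2⁻¹ ^ n := fun n =>
    ENNReal.le_of_add_le_add_left (logisticLoss_lt_top hν hr₀ hlat hind).ne
      ((logisticLoss_add_gap_le hν hr₀ hlat hind (hc _ (hθ n))).trans (hle n))
  have hmeas : ∀ n, Measurable fun z => ENNReal.ofReal (riskGap ν (r₀ z) (c (θ n) z)) :=
    fun n => (measurable_riskGap hr₀ (hc _ (hθ n))).ennreal_ofReal
  have hsum : ∫⁻ z, ∑' n, ENNReal.ofReal (riskGap ν (r₀ z) (c (θ n) z)) ∂(gaussianLaw d) ≠ ∞ := by
    rw [lintegral_tsum fun n => (hmeas n).aemeasurable]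
    refine ne_top_of_le_ne_top ?_ (ENNReal.tsum_le_tsum hgap)
    simp [ENNReal.tsum_geometric]
  have hae : ∀ᵐ z ∂(gaussianLaw d), Tendsto (fun n => c (θ n) z) atTop (𝓝 (c θs z)) := by
    filter_upwards [ae_lt_top (Measurable.tsum hmeas) hsum, hs] with z hz hsz
    rw [hsz]
    refine tendsto_of_riskGap_tendsto hν ?_
    have := ENNReal.tendsto_atTop_zero_of_tsum_ne_top hz.ne
    have h2 := (ENNReal.tendsto_toReal ENNReal.zero_ne_top).comp this
    rw [ENNReal.toReal_zero] at h2
    refine h2.congr fun n => ?_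
    rw [Function.comp_apply, ENNReal.toReal_ofReal (riskGap_nonneg hν _ _)]
  have hlim := hid θ hθ (tendstoInMeasure_of_tendsto_ae
    (fun n => (hc _ (hθ n)).aestronglyMeasurable) hae)
  obtain ⟨n, hn⟩ := ((Metric.tendsto_nhds.1 hlim) ε hε).exists
  exact absurd hn (not_lt.2 (hdist n))

/-- Consistency of the estimator which minimises a uniformly convergent empirical loss. -/
lemma tendstoInMeasure_of_gap {Ω E : Type*} [MeasurableSpace Ω] {P : Measure Ω}
    [PseudoMetricSpace E] {Θ : Set E} {θs : E} (hθs : θs ∈ Θ) {L : E → ℝ≥0∞}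
    {Lhat : ℕ → Ω → E → ℝ≥0∞} {θhat : ℕ → Ω → E}
    (hgap : ∀ ε : ℝ, 0 < ε → ∃ δ : ℝ≥0∞, 0 < δ ∧ δ ≠ ∞ ∧ ∀ θ ∈ Θ, L θ ≤ L θs + δ → dist θ θs < ε)
    (hmin : Tendsto (fun k => P {ω | ¬ (θhat k ω ∈ Θ ∧ IsMinOn (Lhat k ω) Θ (θhat k ω))}) atTop
      (𝓝 0))
    (hunif : ∀ ε : ℝ≥0∞, 0 < ε →
      Tendsto (fun k => P {ω | ε ≤ supDist Θ (Lhat k ω) L}) atTop (𝓝 0)) :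
    TendstoInMeasure P θhat atTop (fun _ => θs) := by
  rw [tendstoInMeasure_iff_dist]
  intro ε hε
  obtain ⟨δ, hδ, -, h⟩ := hgap ε hε
  -- The uniform error enters twice, at the estimator and at `θs`.
  have hδ2 : 0 < δ / 2 := ENNReal.half_pos hδ.ne'
  have hz : Tendsto (fun k => P {ω | ¬ (θhat k ω ∈ Θ ∧ IsMinOn (Lhat k ω) Θ (θhat k ω))} +
      P {ω | δ / 2 ≤ supDist Θ (Lhat k ω) L}) atTop (𝓝 0) := by
    simpa using hmin.add (hunif _ hδ2)
  refine tendsto_of_tendsto_of_tendsto_of_le_of_le tendsto_const_nhds hz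
    (fun _ => zero_le) fun k => ?_
  refine (measure_mono fun ω hω => ?_).trans (measure_union_le _ _)
  by_contra hcon
  simp only [Set.mem_union, Set.mem_ofPred_eq, not_or, not_not, not_le] at hcon
  obtain ⟨⟨hin, hm⟩, hsup⟩ := hcon
  have hb : ∀ θ ∈ Θ, max (Lhat k ω θ - L θ) (L θ - Lhat k ω θ) ≤ δ / 2 := fun θ hθ =>
    (le_iSup₂ (f := fun θ (_ : θ ∈ Θ) => max (Lhat k ω θ - L θ) (L θ - Lhat k ω θ)) θ hθ).trans
      hsup.le
  have h1 : L (θhat k ω) ≤ Lhat k ω (θhat k ω) + δ / 2 := by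
    rw [add_comm]; exact tsub_le_iff_right.1 ((le_max_right _ _).trans (hb _ hin))
  have h2 : Lhat k ω θs ≤ L θs + δ / 2 := by
    rw [add_comm]; exact tsub_le_iff_right.1 ((le_max_left _ _).trans (hb _ hθs))
  have h3 : Lhat k ω (θhat k ω) ≤ Lhat k ω θs := hm hθs
  refine absurd (h _ hin ?_) (not_lt.2 hω)
  calc L (θhat k ω) ≤ (L θs + δ / 2) + δ / 2 := h1.trans (by gcongr; exact h3.trans h2)
    _ = L θs + δ := by rw [add_assoc, ENNReal.add_halves]

end Consistency

/-! ### Central limit theorem for two independent samples of proportional sizes. -/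

section TwoSample

variable {Ω : Type*} [MeasurableSpace Ω] {P : Measure Ω} [IsProbabilityMeasure P]

omit [IsProbabilityMeasure P] in
lemma charFun_two_sample {u v : ℕ → Ω → ℝ} (hindep : iIndepFun (Sum.elim u v) P)
    (hu : ∀ k, AEMeasurable (u k) P) (hv : ∀ k, AEMeasurable (v k) P) (n m : ℕ) (t : ℝ) :
    charFun (P.map fun ω => ∑ l ∈ Finset.range n, u l ω + ∑ l ∈ Finset.range m, v l ω) t =
      charFun (P.map fun ω => ∑ l ∈ Finset.range n, u l ω) t *
        charFun (P.map fun ω => ∑ l ∈ Finset.range m, v l ω) t := by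
  have hg : ∀ i, AEMeasurable (Sum.elim u v i) P := by
    rintro (i | i)
    exacts [hu i, hv i]
  have hsum : (fun ω => ∑ l ∈ Finset.range n, u l ω + ∑ l ∈ Finset.range m, v l ω) =
      fun ω => ∑ i ∈ (Finset.range n).disjSum (Finset.range m), Sum.elim u v i ω := by
    funext ω
    simp [Finset.sum_disjSum]
  rw [hsum, (hindep.restrict _).charFun_map_fun_finsetSum_eq_prod (fun i _ => hg i),
    Finset.prod_disjSum,
    ((hindep.precomp (g := Sum.inl) Sum.inl_injective).restrict
      (Finset.range n)).charFun_map_fun_finsetSum_eq_prod (fun i _ => hu i),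
    ((hindep.precomp (g := Sum.inr) Sum.inr_injective).restrict
      (Finset.range m)).charFun_map_fun_finsetSum_eq_prod (fun i _ => hv i)]
  rfl

lemma tendstoInDistribution_comp_tendsto {T : ℕ → Ω → ℝ} {ρ : Measure ℝ} [IsProbabilityMeasure ρ]
    (h : TendstoInDistribution T atTop (id : ℝ → ℝ) (fun _ => P) ρ) {N : ℕ → ℕ}
    (hN : Tendsto N atTop atTop) :
    TendstoInDistribution (fun k => T (N k)) atTop (id : ℝ → ℝ) (fun _ => P) ρ :=
  ⟨fun k => h.forall_aemeasurable (N k), h.aemeasurable_limit, h.tendsto.comp hN⟩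

/-- The one dimensional central limit theorem, for a rescaled sum along a sequence of sample
sizes, at the level of characteristic functions. -/
lemma tendsto_charFun_mul_sum {u : ℕ → Ω → ℝ} (hindep : iIndepFun u P)
    (hid : ∀ k, IdentDistrib (u k) (u 0) P P) (hL2 : MemLp (u 0) 2 P) {N : ℕ → ℕ}
    (hN : Tendsto N atTop atTop) {b : ℕ → ℝ} {β : ℝ} (hb : Tendsto b atTop (𝓝 β)) :
    Tendsto (fun k => charFun
      (P.map fun ω => ∑ l ∈ Finset.range (N k), b k * (√(N k : ℝ))⁻¹ * (u l ω - P[u 0])) 1) atTop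
      (𝓝 (Complex.exp (-(β ^ 2 * Var[u 0; P] : ℝ) / 2))) := by
  have hclt := tendstoInDistribution_comp_tendsto (tendstoInDistribution_inv_sqrt_mul_sum_sub
    (Y := id) (P' := gaussianReal 0 Var[u 0; P].toNNReal) HasLaw.id hL2 hindep hid) hN
  -- Slutsky's theorem with the deterministic factor `b k`.
  have hsl := hclt.continuous_comp_prodMk_of_tendstoInMeasure_const
    (g := fun q : ℝ × ℝ => q.2 * q.1) (by fun_prop) (Y := fun k _ => b k) (c := β)
    (tendstoInMeasure_of_tendsto_ae (fun k => aestronglyMeasurable_const)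
      (ae_of_all _ fun _ => hb)) (fun k => aemeasurable_const)
  have h1 := ProbabilityMeasure.tendsto_iff_tendsto_charFun.1 hsl.tendsto 1
  simp only [ProbabilityMeasure.coe_mk, id] at h1
  have hlim : charFun ((gaussianReal 0 Var[u 0; P].toNNReal).map fun x => β * x) 1 =
      Complex.exp (-(β ^ 2 * Var[u 0; P] : ℝ) / 2) := by
    rw [charFun_map_mul, charFun_gaussianReal]
    congr 1
    simp [variance_nonneg]
    ring
  rw [hlim] at h1
  refine h1.congr fun k => ?_
  congr 3 with ω
  rw [← Finset.mul_sum, Finset.sum_sub_distrib]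
  simp [mul_assoc]

omit [IsProbabilityMeasure P] in
lemma iIndepFun_sum_elim_comp {α β : Type*} [MeasurableSpace α] [MeasurableSpace β]
    {X Y : ℕ → Ω → α}
    (h : iIndepFun (Sum.elim X Y) P) (hX : ∀ k, AEMeasurable (X k) P)
    (hY : ∀ k, AEMeasurable (Y k) P) {f g : α → β}
    (hf : ∀ k, AEMeasurable f (P.map (X k))) (hg : ∀ k, AEMeasurable g (P.map (Y k))) :
    iIndepFun (Sum.elim (fun k ω => f (X k ω)) (fun k ω => g (Y k ω))) P := by
  have := h.comp₀ (fun i => Sum.elim (fun _ => f) (fun _ => g) i)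
    (by rintro (i | i); exacts [hX i, hY i]) (by rintro (i | i); exacts [hf i, hg i])
  convert this using 1
  funext i
  rcases i with i | i <;> rfl

lemma tendsto_atTop_of_ratio {N M : ℕ → ℕ} {ν : ℝ} (hν : 0 < ν) (hN : Tendsto N atTop atTop)
    (hNM : Tendsto (fun k => (M k : ℝ) / N k) atTop (𝓝 ν)) : Tendsto M atTop atTop := by
  rw [← tendsto_natCast_atTop_iff (R := ℝ)]
  refine ((tendsto_natCast_atTop_iff (R := ℝ)).2 hN |>.atTop_mul_pos hν hNM).congr' ?_
  filter_upwards [hN.eventually_gt_atTop 0] with k hk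
  field_simp

/-- Independence turns the characteristic function into a product, so each sample needs only its own
central limit theorem. The centrings cancel by `hmean`, exactly and for all positive sample sizes.
-/
lemma tendsto_charFun_two_sample {u v : ℕ → Ω → ℝ} (hindep : iIndepFun (Sum.elim u v) P)
    (hu : ∀ k, IdentDistrib (u k) (u 0) P P) (hv : ∀ k, IdentDistrib (v k) (v 0) P P)
    (hu2 : MemLp (u 0) 2 P) (hv2 : MemLp (v 0) 2 P) {ν : ℝ} (hν : 0 < ν)
    (hmean : P[u 0] + ν * P[v 0] = 0) {N M : ℕ → ℕ} (hN : Tendsto N atTop atTop)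
    (hNM : Tendsto (fun k => (M k : ℝ) / N k) atTop (𝓝 ν)) :
    Tendsto (fun k => charFun (P.map fun ω => √(N k : ℝ) *
      ((N k : ℝ)⁻¹ * ∑ l ∈ Finset.range (N k), u l ω +
        ν * ((M k : ℝ)⁻¹ * ∑ l ∈ Finset.range (M k), v l ω))) 1) atTop
      (𝓝 (Complex.exp (-(Var[u 0; P] + ν * Var[v 0; P] : ℝ) / 2))) := by
  have hN0 : ∀ᶠ k in atTop, 0 < N k := hN.eventually_gt_atTop 0
  have hM0 : ∀ᶠ k in atTop, 0 < M k := by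
    filter_upwards [hNM.eventually (lt_mem_nhds hν)] with k hk
    by_contra h
    simp [Nat.eq_zero_of_not_pos h] at hk
  have hM := tendsto_atTop_of_ratio hν hN hNM
  -- After normalising the second sum by the root of its own size, the factor `ν * √(N / M)`
  -- remains; its limit `√ν` puts the weight `ν` on the second variance.
  have hb : Tendsto (fun k => ν * (√(M k / N k : ℝ))⁻¹) atTop (𝓝 (√ν)) := by
    have : √ν = ν * (√ν)⁻¹ := by
      have := Real.mul_self_sqrt hν.le
      have h2 := (Real.sqrt_pos.2 hν).ne'
      field_simp
      linarith
    rw [this]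
    exact ((Real.continuous_sqrt.tendsto ν).comp hNM |>.inv₀ (Real.sqrt_pos.2 hν).ne').const_mul ν
  have h1 := tendsto_charFun_mul_sum (hindep.precomp (g := Sum.inl) Sum.inl_injective) hu hu2 hN
    (tendsto_const_nhds (x := (1 : ℝ)))
  have h2 := tendsto_charFun_mul_sum (hindep.precomp (g := Sum.inr) Sum.inr_injective) hv hv2 hM hb
  have hmul := h1.mul h2
  have hlim : Complex.exp (-(Var[u 0; P] + ν * Var[v 0; P] : ℝ) / 2) =
      Complex.exp (-(1 ^ 2 * Var[u 0; P] : ℝ) / 2) *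
        Complex.exp (-(√ν ^ 2 * Var[v 0; P] : ℝ) / 2) := by
    rw [← Complex.exp_add, Real.sq_sqrt hν.le]
    congr 1
    push_cast
    ring
  rw [hlim]
  refine hmul.congr' ?_
  filter_upwards [hN0, hM0] with k hkN hkM
  have haeu : ∀ l, AEMeasurable (u l) P := fun l => (hu l).aemeasurable_fst
  have haev : ∀ l, AEMeasurable (v l) P := fun l => (hv l).aemeasurable_fst
  have hind := iIndepFun_sum_elim_comp hindep haeu haev
    (f := fun x => 1 * (√(N k : ℝ))⁻¹ * (x - P[u 0]))
    (g := fun x => ν * (√(M k / N k : ℝ))⁻¹ * (√(M k : ℝ))⁻¹ * (x - P[v 0]))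
    (fun _ => by fun_prop) (fun _ => by fun_prop)
  have hprod := charFun_two_sample hind (fun l => by have := haeu l; fun_prop)
    (fun l => by have := haev l; fun_prop) (N k) (M k) 1
  refine Eq.trans hprod.symm ?_
  congr 3 with ω
  have hsN : √(N k : ℝ) ≠ 0 := (Real.sqrt_pos.2 (by exact_mod_cast hkN)).ne'
  have hsM : √(M k : ℝ) ≠ 0 := (Real.sqrt_pos.2 (by exact_mod_cast hkM)).ne'
  have hqN : (N k : ℝ) = √(N k : ℝ) * √(N k : ℝ) := (Real.mul_self_sqrt (by positivity)).symm
  have hqM : (M k : ℝ) = √(M k : ℝ) * √(M k : ℝ) := (Real.mul_self_sqrt (by positivity)).symm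
  have hsub : √(N k : ℝ) * P[u 0] = - (√(N k : ℝ) * (ν * P[v 0])) := by
    rw [← mul_neg]; congr 1; linarith
  rw [← Finset.mul_sum, ← Finset.mul_sum, Finset.sum_sub_distrib, Finset.sum_sub_distrib,
    Real.sqrt_div (by positivity)]
  simp only [Finset.sum_const, Finset.card_range, nsmul_eq_mul]
  have e1 : 1 * (√(N k : ℝ))⁻¹ * (∑ l ∈ Finset.range (N k), u l ω - N k * P[u 0]) =
      √(N k : ℝ) * ((N k : ℝ)⁻¹ * ∑ l ∈ Finset.range (N k), u l ω) - √(N k : ℝ) * P[u 0] := by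
    generalize (∑ l ∈ Finset.range (N k), u l ω) = A
    generalize √(N k : ℝ) = s at *
    rw [hqN]
    field_simp
  have e2 : ν * (√(M k : ℝ) / √(N k : ℝ))⁻¹ * (√(M k : ℝ))⁻¹ *
      (∑ l ∈ Finset.range (M k), v l ω - M k * P[v 0]) =
      √(N k : ℝ) * (ν * ((M k : ℝ)⁻¹ * ∑ l ∈ Finset.range (M k), v l ω)) -
        √(N k : ℝ) * (ν * P[v 0]) := by
    generalize (∑ l ∈ Finset.range (M k), v l ω) = A
    generalize √(M k : ℝ) = s at *
    rw [hqM]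
    field_simp
  rw [e1, e2, hsub]
  ring

open scoped RealInnerProductSpace in
/-- A multivariate central limit theorem for the sum of the means of two independent samples. -/
lemma tendstoInDistribution_two_sample {ι : Type*} [Fintype ι] [DecidableEq ι]
    {ξ η : ℕ → Ω → EuclideanSpace ℝ ι} (hindep : iIndepFun (Sum.elim ξ η) P)
    (hξ : ∀ k, IdentDistrib (ξ k) (ξ 0) P P) (hη : ∀ k, IdentDistrib (η k) (η 0) P P)
    (hξ2 : MemLp (ξ 0) 2 P) (hη2 : MemLp (η 0) 2 P) {ν : ℝ} (hν : 0 < ν)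
    (hmean : P[ξ 0] + ν • P[η 0] = 0) {N M : ℕ → ℕ} (hN : Tendsto N atTop atTop)
    (hNM : Tendsto (fun k => (M k : ℝ) / N k) atTop (𝓝 ν)) {S : Matrix ι ι ℝ}
    (hS : S.PosSemidef)
    (hquad : ∀ t : EuclideanSpace ℝ ι, t ⬝ᵥ S.mulVec t =
      Var[fun ω => ⟪t, ξ 0 ω⟫; P] + ν * Var[fun ω => ⟪t, η 0 ω⟫; P]) :
    TendstoInDistribution (fun k ω => √(N k : ℝ) •
      ((N k : ℝ)⁻¹ • ∑ l ∈ Finset.range (N k), ξ l ω +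
        ν • ((M k : ℝ)⁻¹ • ∑ l ∈ Finset.range (M k), η l ω))) atTop
      (id : EuclideanSpace ℝ ι → EuclideanSpace ℝ ι) (fun _ => P) (multivariateGaussian 0 S) := by
  have haeξ : ∀ l, AEMeasurable (ξ l) P := fun l => (hξ l).aemeasurable_fst
  have haeη : ∀ l, AEMeasurable (η l) P := fun l => (hη l).aemeasurable_fst
  have hae : ∀ k, AEMeasurable (fun ω => √(N k : ℝ) •
      ((N k : ℝ)⁻¹ • ∑ l ∈ Finset.range (N k), ξ l ω +
        ν • ((M k : ℝ)⁻¹ • ∑ l ∈ Finset.range (M k), η l ω))) P := fun k => by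
    have h1 : AEMeasurable (fun ω => ∑ l ∈ Finset.range (N k), ξ l ω) P :=
      Finset.aemeasurable_fun_sum _ fun l _ => haeξ l
    have h2 : AEMeasurable (fun ω => ∑ l ∈ Finset.range (M k), η l ω) P :=
      Finset.aemeasurable_fun_sum _ fun l _ => haeη l
    fun_prop
  -- Cramér-Wold: the characteristic function at `t` is that of the inner product with `t`, taken at
  -- `1`.
  refine ⟨hae, aemeasurable_id, ProbabilityMeasure.tendsto_iff_tendsto_charFun.2 fun t => ?_⟩
  simp only [ProbabilityMeasure.coe_mk, Measure.map_id]
  have hL : Measurable fun x : EuclideanSpace ℝ ι => ⟪t, x⟫ := by fun_prop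
  have hc := tendsto_charFun_two_sample (u := fun l ω => ⟪t, ξ l ω⟫) (v := fun l ω => ⟪t, η l ω⟫)
    (iIndepFun_sum_elim_comp hindep haeξ haeη (fun _ => hL.aemeasurable)
      (fun _ => hL.aemeasurable))
    (fun k => (hξ k).comp hL) (fun k => (hη k).comp hL) (hξ2.const_inner t) (hη2.const_inner t) hν
    (by
      rw [integral_inner (hξ2.integrable one_le_two), integral_inner (hη2.integrable one_le_two),
        ← inner_smul_right, ← inner_add_right, hmean, inner_zero_right]) hN hNM
  rw [charFun_multivariateGaussian hS, hquad]
  simp only [inner_zero_right, Complex.ofReal_zero, zero_mul, zero_sub, ← neg_div]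
  refine hc.congr fun k => ?_
  rw [charFun_apply, charFun_apply, integral_map (hae k) (by fun_prop), integral_map _ (by fun_prop)]
  · congr with ω
    simp only [inner_smul_left, inner_add_left, sum_inner, real_inner_comm]
    simp
  · have h1 : AEMeasurable (fun ω => ⟪t, √(N k : ℝ) •
      ((N k : ℝ)⁻¹ • ∑ l ∈ Finset.range (N k), ξ l ω +
        ν • ((M k : ℝ)⁻¹ • ∑ l ∈ Finset.range (M k), η l ω))⟫) P := hL.comp_aemeasurable (hae k)
    refine h1.congr (ae_of_all _ fun ω => ?_)
    simp [inner_smul_right, inner_add_right, inner_sum, mul_add]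

end TwoSample

/-! ### Uniform linearisation of empirical means at a consistent estimator. -/

section Linearization

variable {ι : Type*} [Fintype ι] {F : Type*} [NormedAddCommGroup F] [NormedSpace ℝ F]
  {α : Type*} [MeasurableSpace α] {ρ : Measure α}
  {ψ : EuclideanSpace ℝ ι → α → F} {D : α → EuclideanSpace ℝ ι →L[ℝ] F}
  {θs : EuclideanSpace ℝ ι} {r : ℝ} {B : α → ℝ}

lemma clm_eq_sum_smulRight [DecidableEq ι] (L : EuclideanSpace ℝ ι →L[ℝ] F) :
    L = ∑ i, (EuclideanSpace.proj i : EuclideanSpace ℝ ι →L[ℝ] ℝ).smulRight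
      (L (EuclideanSpace.single i 1)) := by
  refine ContinuousLinearMap.coe_injective
    ((EuclideanSpace.basisFun ι ℝ).toBasis.ext fun j => ?_)
  simp

/-- A derivative in the parameter is measurable in the data. -/
lemma aestronglyMeasurable_of_hasFDerivAt (hr : 0 < r)
    (hmeas : ∀ θ ∈ Metric.ball θs r, AEStronglyMeasurable (ψ θ) ρ)
    (hD : ∀ᵐ z ∂ρ, HasFDerivAt (fun θ => ψ θ z) (D z) θs) :
    AEStronglyMeasurable D ρ := by
  classical
  have happ : ∀ v, AEStronglyMeasurable (fun z => D z v) ρ := fun v => by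
    -- The shift `K` keeps all increments `v / (n + K)` inside the ball where measurability is
    -- known.
    obtain ⟨K, hK⟩ := exists_nat_gt (‖v‖ / r)
    have hK0 : (0 : ℝ) < K := (by positivity : 0 ≤ ‖v‖ / r).trans_lt hK
    have hball : ∀ n : ℕ, θs + ((n : ℝ) + K)⁻¹ • v ∈ Metric.ball θs r := fun n => by
      have hnK : 0 < (n : ℝ) + K := by positivity
      rw [mem_ball_iff_norm, add_sub_cancel_left, norm_smul, norm_inv, Real.norm_of_nonneg hnK.le,
        inv_mul_lt_iff₀ hnK]
      have := (div_lt_iff₀ hr).1 hK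
      nlinarith [(by positivity : (0 : ℝ) ≤ n)]
    refine aestronglyMeasurable_of_tendsto_ae atTop
      (f := fun (n : ℕ) z => ((n : ℝ) + K) • (ψ (θs + ((n : ℝ) + K)⁻¹ • v) z - ψ θs z))
      (fun n => ((hmeas _ (hball n)).sub (hmeas θs (Metric.mem_ball_self hr))).const_smul _) ?_
    filter_upwards [hD] with z hz
    refine hz.lim v ?_
    exact tendsto_norm_atTop_atTop.comp
      (tendsto_atTop_add_const_right _ _ tendsto_natCast_atTop_atTop)
  have hsum : D = fun z => ∑ i, (EuclideanSpace.proj i : EuclideanSpace ℝ ι →L[ℝ] ℝ).smulRight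
      (D z (EuclideanSpace.single i 1)) := funext fun z => clm_eq_sum_smulRight (D z)
  rw [hsum]
  refine Finset.aestronglyMeasurable_fun_sum _ fun i _ => ?_
  exact (ContinuousLinearMap.smulRightL ℝ (EuclideanSpace ℝ ι) F
    (EuclideanSpace.proj i)).continuous.comp_aestronglyMeasurable (happ _)

omit [MeasurableSpace α] in
lemma norm_le_of_hasFDerivAt_of_lipschitz (hr : 0 < r) (hB0 : ∀ z, 0 ≤ B z) {z : α}
    (hD : HasFDerivAt (fun θ => ψ θ z) (D z) θs)
    (hLip : ∀ θ ∈ Metric.ball θs r, ∀ θ' ∈ Metric.ball θs r,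
      ‖ψ θ z - ψ θ' z‖ ≤ B z * ‖θ - θ'‖) : ‖D z‖ ≤ B z := by
  refine hD.le_of_lip' (hB0 z) ?_
  filter_upwards [Metric.ball_mem_nhds θs hr] with θ hθ
  exact hLip θ hθ θs (Metric.mem_ball_self hr)

/-- A uniform modulus of differentiability at a point, which is integrable and tends to zero in
mean. -/
lemma exists_modulus (hr : 0 < r)
    (hmeas : ∀ θ ∈ Metric.ball θs r, AEStronglyMeasurable (ψ θ) ρ)
    (hB : Integrable B ρ) (hB0 : ∀ z, 0 ≤ B z)
    (hLip : ∀ᵐ z ∂ρ, ∀ θ ∈ Metric.ball θs r, ∀ θ' ∈ Metric.ball θs r,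
      ‖ψ θ z - ψ θ' z‖ ≤ B z * ‖θ - θ'‖)
    (hD : ∀ᵐ z ∂ρ, HasFDerivAt (fun θ => ψ θ z) (D z) θs) :
    ∃ w : ℕ → α → ℝ≥0∞, (∀ n, AEMeasurable (w n) ρ) ∧
      Tendsto (fun n => ∫⁻ z, w n z ∂ρ) atTop (𝓝 0) ∧
      ∀ᵐ z ∂ρ, ∀ n : ℕ, ∀ θ ∈ Metric.ball θs (r / (n + 1)),
        ‖ψ θ z - ψ θs z - D z (θ - θs)‖ₑ ≤ w n z * ‖θ - θs‖ₑ := by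
  classical
  set q : EuclideanSpace ℝ ι → α → ℝ≥0∞ := fun θ z =>
    ‖ψ θ z - ψ θs z - D z (θ - θs)‖ₑ / ‖θ - θs‖ₑ with hq
  set s : ℕ → EuclideanSpace ℝ ι := TopologicalSpace.denseSeq _ with hs
  -- The supremum of the difference quotients runs over a countable dense set to be measurable;
  -- continuity of `ψ` in the parameter extends the bound to the whole ball.
  set w : ℕ → α → ℝ≥0∞ := fun n z =>
    ⨆ i, if s i ∈ Metric.ball θs (r / (n + 1)) then q (s i) z else 0 with hw
  have hrn : ∀ n : ℕ, r / (n + 1) ≤ r := fun n =>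
    div_le_self hr.le (by linarith [(by positivity : (0 : ℝ) ≤ n)])
  have hsub : ∀ n : ℕ, Metric.ball θs (r / (n + 1)) ⊆ Metric.ball θs r := fun n =>
    Metric.ball_subset_ball (hrn n)
  have hDm := aestronglyMeasurable_of_hasFDerivAt hr hmeas hD
  have hqm : ∀ θ ∈ Metric.ball θs r, AEMeasurable (q θ) ρ := fun θ hθ => by
    refine AEMeasurable.div_const ?_ _
    refine (((hmeas θ hθ).sub (hmeas θs (Metric.mem_ball_self hr))).sub ?_).enorm
    exact (ContinuousLinearMap.apply ℝ F (θ - θs)).continuous.comp_aestronglyMeasurable hDm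
  have hwm : ∀ n, AEMeasurable (w n) ρ := fun n => AEMeasurable.iSup fun i => by
    by_cases h : s i ∈ Metric.ball θs (r / (n + 1))
    · simpa only [h, if_true] using hqm _ (hsub n h)
    · simpa only [h, if_false] using aemeasurable_const
  -- The Lipschitz bound controls the increment and the derivative by `B` each. This is the
  -- dominating function; the pointwise limit zero is differentiability at `θs`.
  have hqB : ∀ᵐ z ∂ρ, ∀ θ ∈ Metric.ball θs r, q θ z ≤ ENNReal.ofReal (2 * B z) := by
    filter_upwards [hLip, hD] with z h1 h2 θ hθ
    have h3 := norm_le_of_hasFDerivAt_of_lipschitz hr hB0 h2 h1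
    refine ENNReal.div_le_of_le_mul ?_
    rw [← ofReal_norm, ← ofReal_norm, ← ENNReal.ofReal_mul (by linarith [hB0 z])]
    refine ENNReal.ofReal_le_ofReal ((norm_sub_le _ _).trans ?_)
    have h4 := h1 θ hθ θs (Metric.mem_ball_self hr)
    have h5 := (D z).le_of_opNorm_le h3 (θ - θs)
    linarith
  have hwB : ∀ᵐ z ∂ρ, ∀ n, w n z ≤ ENNReal.ofReal (2 * B z) := by
    filter_upwards [hqB] with z hz n
    refine iSup_le fun i => ?_
    split_ifs with h
    · exact hz _ (hsub n h)
    · exact zero_le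
  refine ⟨w, hwm, ?_, ?_⟩
  · have hlim : ∀ᵐ z ∂ρ, Tendsto (fun n => w n z) atTop (𝓝 0) := by
      filter_upwards [hD] with z hz
      rw [ENNReal.tendsto_atTop_zero]
      intro ε hε
      obtain ⟨c, hc0, hcε⟩ : ∃ c : ℝ≥0, 0 < c ∧ (c : ℝ≥0∞) ≤ ε := by
        obtain ⟨c, hc0, hc⟩ := ENNReal.lt_iff_exists_nnreal_btwn.1 hε
        exact ⟨c, by exact_mod_cast hc0, hc.le⟩
      have h1 := (hasFDerivAt_iff_isLittleO.1 hz).def (c := c) (by exact_mod_cast hc0)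
      obtain ⟨δ, hδ, hδs⟩ := Metric.eventually_nhds_iff_ball.1 h1
      obtain ⟨n₀, hn₀⟩ := exists_nat_gt (r / δ)
      refine ⟨n₀, fun n hn => iSup_le fun i => ?_⟩
      split_ifs with h
      · refine le_trans (ENNReal.div_le_of_le_mul ?_) hcε
        have hn' : r / (n + 1) ≤ δ := by
          rw [div_le_iff₀ (by positivity)]
          have h2 := (div_lt_iff₀ hδ).1 hn₀
          have h3 : (n₀ : ℝ) ≤ n := by exact_mod_cast hn
          nlinarith
        have h4 := hδs (s i) (Metric.ball_subset_ball hn' h)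
        rw [← ofReal_norm, ← ofReal_norm, ← ENNReal.ofReal_coe_nnreal,
          ← ENNReal.ofReal_mul c.coe_nonneg]
        exact ENNReal.ofReal_le_ofReal h4
      · exact zero_le
    have hfin : ∫⁻ z, ENNReal.ofReal (2 * B z) ∂ρ ≠ ∞ := by
      have := (hB.const_mul 2).lintegral_lt_top
      exact this.ne
    have := tendsto_lintegral_of_dominated_convergence' (fun z => ENNReal.ofReal (2 * B z))
      hwm (fun n => hwB.mono fun z hz => hz n) hfin hlim
    simpa using this
  · filter_upwards [hLip, hwB] with z hz hzB n θ hθ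
    have hopen := Metric.isOpen_ball (x := θs) (ε := r / ((n : ℝ) + 1))
    have hcl : θ ∈ closure (Metric.ball θs (r / ((n : ℝ) + 1)) ∩ Set.range s) :=
      (TopologicalSpace.denseRange_denseSeq _).open_subset_closure_inter hopen hθ
    have hne : (𝓝[Metric.ball θs (r / ((n : ℝ) + 1)) ∩ Set.range s] θ).NeBot :=
      mem_closure_iff_nhdsWithin_neBot.1 hcl
    have hcont : ContinuousAt (fun θ => ψ θ z) θ := by
      have hLO : LipschitzOnWith (B z).toNNReal (fun θ => ψ θ z) (Metric.ball θs r) :=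
        LipschitzOnWith.of_dist_le_mul fun x hx y hy => by
          rw [dist_eq_norm, dist_eq_norm, Real.coe_toNNReal _ (hB0 z)]
          exact hz x hx y hy
      exact hLO.continuousOn.continuousAt (Metric.isOpen_ball.mem_nhds (hsub n hθ))
    have hf : ContinuousAt (fun θ => ‖ψ θ z - ψ θs z - D z (θ - θs)‖ₑ) θ := by
      refine ContinuousAt.enorm ?_
      have : ContinuousAt (fun θ => D z (θ - θs)) θ := by fun_prop
      exact (hcont.sub continuousAt_const).sub this
    have hg : ContinuousAt (fun θ => ‖θ - θs‖ₑ) θ := by fun_prop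
    refine le_of_tendsto_of_tendsto (b := 𝓝[Metric.ball θs (r / ((n : ℝ) + 1)) ∩ Set.range s] θ)
      (hf.tendsto.mono_left nhdsWithin_le_nhds)
      (ENNReal.Tendsto.const_mul (hg.tendsto.mono_left nhdsWithin_le_nhds)
        (Or.inr ((hzB n).trans_lt ENNReal.ofReal_lt_top).ne)) ?_
    filter_upwards [self_mem_nhdsWithin (s := Metric.ball θs (r / ((n : ℝ) + 1)) ∩ Set.range s)]
      with x hx
    obtain ⟨hxb, i, rfl⟩ := hx
    have hle : q (s i) z ≤ w n z := by
      refine le_trans ?_ (le_iSup (fun i => if s i ∈ Metric.ball θs (r / (n + 1)) then q (s i) z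
        else 0) i)
      simp only [if_pos hxb, le_refl]
    by_cases h0 : s i = θs
    · simp [h0]
    · have hne0 : ‖s i - θs‖ₑ ≠ 0 := by simpa [sub_eq_zero] using h0
      exact (ENNReal.div_le_iff hne0 (by simp)).1 hle

variable {Ω : Type*} [MeasurableSpace Ω] {P : Measure Ω} [IsProbabilityMeasure P]
  [IsProbabilityMeasure ρ] {Z : ℕ → Ω → α}

omit [IsProbabilityMeasure P] [IsProbabilityMeasure ρ] in
lemma ae_forall_hasLaw (hZ : ∀ l, HasLaw (Z l) ρ P) {p : α → Prop} (h : ∀ᵐ z ∂ρ, p z) :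
    ∀ᵐ ω ∂P, ∀ l, p (Z l ω) :=
  ae_all_iff.2 fun l => ae_of_ae_map (hZ l).aemeasurable (by rwa [(hZ l).map_eq])

omit [IsProbabilityMeasure ρ] in
/-- The weak law of large numbers along a sequence of sample sizes. -/
lemma tendstoInMeasure_average {G : Type*} [NormedAddCommGroup G] [NormedSpace ℝ G]
    [CompleteSpace G] (hZ : ∀ l, HasLaw (Z l) ρ P) (hindep : iIndepFun Z P) {f : α → G}
    (hf : Integrable f ρ) {N : ℕ → ℕ} (hN : Tendsto N atTop atTop) :
    TendstoInMeasure P (fun k ω => (N k : ℝ)⁻¹ • ∑ l ∈ Finset.range (N k), f (Z l ω)) atTop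
      (fun _ => ∫ z, f z ∂ρ) := by
  borelize G
  -- A strongly measurable version keeps the compositions independent, and almost surely agrees with
  -- `f` at all observations.
  obtain ⟨f', hsm, hff⟩ := hf.aestronglyMeasurable
  have hae := ae_forall_hasLaw hZ hff
  have hcomp : ∀ l, Integrable (fun ω => f' (Z l ω)) P := fun l => by
    have h1 : Integrable f' (P.map (Z l)) := by
      rw [(hZ l).map_eq]; exact hf.congr hff
    exact h1.comp_aemeasurable (hZ l).aemeasurable
  have hid : ∀ l, IdentDistrib (fun ω => f' (Z l ω)) (fun ω => f' (Z 0 ω)) P P := fun l =>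
    IdentDistrib.comp ⟨(hZ l).aemeasurable, (hZ 0).aemeasurable,
      (hZ l).map_eq.trans (hZ 0).map_eq.symm⟩ hsm.measurable
  have hlln := strong_law_ae (fun l ω => f' (Z l ω)) (hcomp 0)
    (fun i j hij => (hindep.indepFun hij).comp hsm.measurable hsm.measurable) hid
  have hmean : ∫ ω, f' (Z 0 ω) ∂P = ∫ z, f z ∂ρ := by
    rw [integral_congr_ae hff, ← (hZ 0).map_eq,
      integral_map (hZ 0).aemeasurable hsm.aestronglyMeasurable]
  have hmeas : ∀ l, AEStronglyMeasurable (fun ω => f (Z l ω)) P := fun l => by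
    refine (hcomp l).1.congr ?_
    filter_upwards [hae] with ω hω
    exact (hω l).symm
  refine tendstoInMeasure_of_tendsto_ae (fun k => ?_) ?_
  · exact (Finset.aestronglyMeasurable_fun_sum _ fun l _ => hmeas l).const_smul _
  · filter_upwards [hlln, hae] with ω h1 h2
    rw [hmean] at h1
    refine (h1.comp hN).congr fun k => ?_
    simp only [Function.comp_apply, h2]

omit [IsProbabilityMeasure P] [IsProbabilityMeasure ρ] in
lemma lintegral_average_le (hZ : ∀ l, HasLaw (Z l) ρ P) {w : α → ℝ≥0∞} (hw : AEMeasurable w ρ)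
    (n : ℕ) : ∫⁻ ω, (n : ℝ≥0∞)⁻¹ * ∑ l ∈ Finset.range n, w (Z l ω) ∂P ≤ ∫⁻ z, w z ∂ρ := by
  have hm : ∀ l, AEMeasurable (fun ω => w (Z l ω)) P := fun l =>
    AEMeasurable.comp_aemeasurable (by rwa [(hZ l).map_eq]) (hZ l).aemeasurable
  have hI : ∀ l, ∫⁻ ω, w (Z l ω) ∂P = ∫⁻ z, w z ∂ρ := fun l => by
    rw [← (hZ l).map_eq, lintegral_map' (by rwa [(hZ l).map_eq]) (hZ l).aemeasurable]
  rw [lintegral_const_mul'' _ (Finset.aemeasurable_fun_sum _ fun l _ => hm l),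
    lintegral_finsetSum' _ fun l _ => hm l]
  simp only [hI, Finset.sum_const, Finset.card_range, nsmul_eq_mul]
  rw [← mul_assoc]
  exact (mul_le_mul_left (ENNReal.inv_mul_le_one _) _).trans (one_mul _).le

omit [IsProbabilityMeasure ρ] in
/-- Linearization of an empirical mean at a consistent estimator. -/
lemma tendsto_measure_linearization_error [CompleteSpace F] (hr : 0 < r)
    (hmeas : ∀ θ ∈ Metric.ball θs r, AEStronglyMeasurable (ψ θ) ρ)
    (hB : Integrable B ρ) (hB0 : ∀ z, 0 ≤ B z)
    (hLip : ∀ᵐ z ∂ρ, ∀ θ ∈ Metric.ball θs r, ∀ θ' ∈ Metric.ball θs r,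
      ‖ψ θ z - ψ θ' z‖ ≤ B z * ‖θ - θ'‖)
    (hD : ∀ᵐ z ∂ρ, HasFDerivAt (fun θ => ψ θ z) (D z) θs)
    (hZ : ∀ l, HasLaw (Z l) ρ P) (hindep : iIndepFun Z P)
    {N : ℕ → ℕ} (hN : Tendsto N atTop atTop) {θhat : ℕ → Ω → EuclideanSpace ℝ ι}
    (hθ : TendstoInMeasure P θhat atTop (fun _ => θs)) {ε : ℝ} (hε : 0 < ε) :
    Tendsto (fun k => P {ω | ε * ‖θhat k ω - θs‖ <
      ‖(N k : ℝ)⁻¹ • ∑ l ∈ Finset.range (N k), (ψ (θhat k ω) (Z l ω) - ψ θs (Z l ω)) -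
        (∫ z, D z ∂ρ) (θhat k ω - θs)‖}) atTop (𝓝 0) := by
  obtain ⟨w, hwm, hwlim, hw⟩ := exists_modulus hr hmeas hB hB0 hLip hD
  have hDint : Integrable D ρ := by
    refine hB.mono' (aestronglyMeasurable_of_hasFDerivAt hr hmeas hD) ?_
    filter_upwards [hLip, hD] with z h1 h2
    exact norm_le_of_hasFDerivAt_of_lipschitz hr hB0 h2 h1
  have hlln := tendstoInMeasure_average hZ hindep hDint hN
  rw [tendstoInMeasure_iff_norm] at hlln hθ
  have hε2 : 0 < ε / 2 := half_pos hε
  rw [ENNReal.tendsto_atTop_zero]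
  intro η hη
  have hη3 : 0 < η / 3 := ENNReal.div_pos hη.ne' (by simp)
  have hc0 : ENNReal.ofReal (ε / 2) ≠ 0 := by simpa using hε2
  -- Markov's inequality: the radius is fixed first, so small that the averaged modulus exceeds `ε /
  -- 2` with probability at most `η / 3`. The bound on the modulus is uniform in the parameter, so
  -- the estimator may depend on the sample.
  obtain ⟨n, hn⟩ : ∃ n, (∫⁻ z, w n z ∂ρ) / ENNReal.ofReal (ε / 2) ≤ η / 3 := by
    have h1 : Tendsto (fun n => (∫⁻ z, w n z ∂ρ) / ENNReal.ofReal (ε / 2)) atTop (𝓝 0) := by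
      have := ENNReal.Tendsto.div_const hwlim (b := ENNReal.ofReal (ε / 2)) (Or.inr hc0)
      simpa using this
    obtain ⟨n, hn⟩ := (ENNReal.tendsto_atTop_zero.1 h1) _ hη3
    exact ⟨n, hn n le_rfl⟩
  obtain ⟨k₁, hk₁⟩ := ENNReal.tendsto_atTop_zero.1 (hlln (ε / 2) hε2) _ hη3
  obtain ⟨k₂, hk₂⟩ := ENNReal.tendsto_atTop_zero.1
    (hθ (r / (n + 1)) (by positivity)) _ hη3
  obtain ⟨k₃, hk₃⟩ := eventually_atTop.1 (hN.eventually_gt_atTop 0)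
  refine ⟨max k₁ (max k₂ k₃), fun k hk => ?_⟩
  have hkN : 0 < N k := hk₃ k (((le_max_right _ _).trans (le_max_right _ _)).trans hk)
  set S₁ : Set Ω := {ω | ε / 2 ≤ ‖(N k : ℝ)⁻¹ • ∑ l ∈ Finset.range (N k), D (Z l ω) -
    ∫ z, D z ∂ρ‖}
  set S₂ : Set Ω := {ω | r / (n + 1) ≤ ‖θhat k ω - θs‖}
  set S₃ : Set Ω := {ω | ENNReal.ofReal (ε / 2) ≤
    (N k : ℝ≥0∞)⁻¹ * ∑ l ∈ Finset.range (N k), w n (Z l ω)}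
  have hS₁ : P S₁ ≤ η / 3 := hk₁ k ((le_max_left _ _).trans hk)
  have hS₂ : P S₂ ≤ η / 3 := hk₂ k (((le_max_left _ _).trans (le_max_right _ _)).trans hk)
  have hS₃ : P S₃ ≤ η / 3 := by
    refine (meas_ge_le_lintegral_div ?_ hc0 (by simp)).trans
      ((ENNReal.div_le_div_right (lintegral_average_le hZ (hwm n) (N k)) _).trans hn)
    refine AEMeasurable.const_mul (Finset.aemeasurable_fun_sum _ fun l _ => ?_) _
    exact AEMeasurable.comp_aemeasurable (by rw [(hZ l).map_eq]; exact hwm n) (hZ l).aemeasurable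
  have hsub : ({ω | ε * ‖θhat k ω - θs‖ <
      ‖(N k : ℝ)⁻¹ • ∑ l ∈ Finset.range (N k), (ψ (θhat k ω) (Z l ω) - ψ θs (Z l ω)) -
        (∫ z, D z ∂ρ) (θhat k ω - θs)‖} : Set Ω) ≤ᵐ[P] (S₁ ∪ (S₂ ∪ S₃) : Set Ω) := by
    filter_upwards [ae_forall_hasLaw hZ hw] with ω hω hbad
    by_contra hcon
    have hcon : ω ∉ S₁ ∪ (S₂ ∪ S₃) := hcon
    simp only [Set.mem_union, not_or] at hcon
    obtain ⟨h1, h2, h3⟩ := hcon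
    have h1 : ‖(N k : ℝ)⁻¹ • ∑ l ∈ Finset.range (N k), D (Z l ω) - ∫ z, D z ∂ρ‖ < ε / 2 :=
      not_le.1 h1
    have h2 : ‖θhat k ω - θs‖ < r / (n + 1) := not_le.1 h2
    have h3 : (N k : ℝ≥0∞)⁻¹ * ∑ l ∈ Finset.range (N k), w n (Z l ω) < ENNReal.ofReal (ε / 2) :=
      not_le.1 h3
    set h := θhat k ω - θs with hh
    -- Averaged remainder plus the fluctuation of the averaged derivative; each takes half of `ε`.
    have e1 : (N k : ℝ)⁻¹ • ∑ l ∈ Finset.range (N k), (ψ (θhat k ω) (Z l ω) - ψ θs (Z l ω)) -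
        (∫ z, D z ∂ρ) h =
        (N k : ℝ)⁻¹ • ∑ l ∈ Finset.range (N k),
          (ψ (θhat k ω) (Z l ω) - ψ θs (Z l ω) - D (Z l ω) h) +
        ((N k : ℝ)⁻¹ • ∑ l ∈ Finset.range (N k), D (Z l ω) - ∫ z, D z ∂ρ) h := by
      simp only [Finset.sum_sub_distrib, smul_sub, sub_apply, smul_apply, sum_apply]
      abel
    have e2 : ‖(N k : ℝ)⁻¹ • ∑ l ∈ Finset.range (N k),
        (ψ (θhat k ω) (Z l ω) - ψ θs (Z l ω) - D (Z l ω) h)‖ ≤ ε / 2 * ‖h‖ := by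
      rw [← ENNReal.ofReal_le_ofReal_iff (by positivity), ofReal_norm,
        ENNReal.ofReal_mul hε2.le, ofReal_norm, enorm_smul]
      have hinv : ‖(N k : ℝ)⁻¹‖ₑ = (N k : ℝ≥0∞)⁻¹ := by
        rw [enorm_inv (by positivity)]
        simp
      calc _ ≤ (N k : ℝ≥0∞)⁻¹ * ∑ l ∈ Finset.range (N k), w n (Z l ω) * ‖h‖ₑ := by
            rw [hinv]
            gcongr
            refine (enorm_sum_le _ _).trans (Finset.sum_le_sum fun l _ => ?_)
            exact hω l n _ (by rw [mem_ball_iff_norm]; exact h2)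
        _ = ((N k : ℝ≥0∞)⁻¹ * ∑ l ∈ Finset.range (N k), w n (Z l ω)) * ‖h‖ₑ := by
            rw [← Finset.sum_mul, mul_assoc]
        _ ≤ _ := by gcongr
    have e3 := ContinuousLinearMap.le_of_opNorm_le _ h1.le h
    have hbad : ε * ‖h‖ < ‖(N k : ℝ)⁻¹ • ∑ l ∈ Finset.range (N k),
      (ψ (θhat k ω) (Z l ω) - ψ θs (Z l ω)) - (∫ z, D z ∂ρ) h‖ := hbad
    rw [e1] at hbad
    have := norm_add_le ((N k : ℝ)⁻¹ • ∑ l ∈ Finset.range (N k),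
          (ψ (θhat k ω) (Z l ω) - ψ θs (Z l ω) - D (Z l ω) h))
        (((N k : ℝ)⁻¹ • ∑ l ∈ Finset.range (N k), D (Z l ω) - ∫ z, D z ∂ρ) h)
    linarith
  calc _ ≤ P (S₁ ∪ (S₂ ∪ S₃)) := measure_mono_ae hsub
    _ ≤ η / 3 + (η / 3 + η / 3) := (measure_union_le _ _).trans
        (add_le_add hS₁ ((measure_union_le _ _).trans (add_le_add hS₂ hS₃)))
    _ = η := by rw [← add_assoc, ENNReal.add_thirds]

end Linearization

/-! ### First and second derivatives of a function of the log-ratio. -/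

section Calculus

variable {E : Type*} [NormedAddCommGroup E] [InnerProductSpace ℝ E] [CompleteSpace E]

variable (E) in
/-- The Riesz isomorphism of a real Hilbert space, as a linear isometry. -/
noncomputable def rieszVector : StrongDual ℝ E →ₗᵢ[ℝ] E where
  toFun := (InnerProductSpace.toDual ℝ E).symm
  map_add' := map_add _
  map_smul' a L := by simp
  norm_map' L := by simp

lemma gradient_eq_rieszVector (f : E → ℝ) (θ : E) :
    gradient f θ = rieszVector E (fderiv ℝ f θ) := rfl

lemma norm_gradient (f : E → ℝ) (θ : E) : ‖gradient f θ‖ = ‖fderiv ℝ f θ‖ := by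
  rw [gradient_eq_rieszVector, LinearIsometry.norm_map]

lemma fderiv_apply_eq_inner_gradient (f : E → ℝ) (θ v : E) :
    fderiv ℝ f θ v = inner ℝ (gradient f θ) v := by
  rw [gradient, InnerProductSpace.toDual_symm_apply]

omit [CompleteSpace E] in
lemma differentiableAt_fderiv {f : E → ℝ} {θ : E} (hf : ContDiffAt ℝ 2 f θ) :
    DifferentiableAt ℝ (fderiv ℝ f) θ :=
  (hf.fderiv_right (m := 1) (by norm_num)).differentiableAt (by norm_num)

lemma hasFDerivAt_gradient {f : E → ℝ} {θ : E} (hf : ContDiffAt ℝ 2 f θ) :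
    HasFDerivAt (gradient f)
      ((rieszVector E).toContinuousLinearMap.comp (fderiv ℝ (fderiv ℝ f) θ)) θ :=
  (rieszVector E).toContinuousLinearMap.hasFDerivAt.comp θ (differentiableAt_fderiv hf).hasFDerivAt

lemma norm_fderiv_gradient_le {f : E → ℝ} {θ : E} (hf : ContDiffAt ℝ 2 f θ) :
    ‖fderiv ℝ (gradient f) θ‖ ≤ ‖iteratedFDeriv ℝ 2 f θ‖ := by
  rw [(hasFDerivAt_gradient hf).fderiv, ← norm_iteratedFDeriv_fderiv, norm_iteratedFDeriv_one]
  refine (ContinuousLinearMap.opNorm_comp_le _ _).trans ?_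
  exact (mul_le_mul_of_nonneg_right (rieszVector E).norm_toContinuousLinearMap_le
    (norm_nonneg _)).trans (one_mul _).le

/-- The gradient of `s ∘ f`, where `s' = σ`. -/
noncomputable def weightedGradient (σ : ℝ → ℝ) (f : E → ℝ) (θ : E) : E := σ (f θ) • gradient f θ

/-- The derivative of `weightedGradient σ f`, where `σ' = τ`. -/
noncomputable def weightedHessian (σ τ : ℝ → ℝ) (f : E → ℝ) (θ : E) : E →L[ℝ] E :=
  σ (f θ) • fderiv ℝ (gradient f) θ + (τ (f θ) • fderiv ℝ f θ).smulRight (gradient f θ)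

variable {σ τ : ℝ → ℝ} {f : E → ℝ}

lemma hasFDerivAt_weightedGradient (hσ : ∀ t, HasDerivAt σ (τ t) t) {θ : E}
    (hf : ContDiffAt ℝ 2 f θ) :
    HasFDerivAt (weightedGradient σ f) (weightedHessian σ τ f θ) θ :=
  ((hσ (f θ)).comp_hasFDerivAt θ (hf.differentiableAt (by norm_num)).hasFDerivAt).smul
    (hasFDerivAt_gradient hf).differentiableAt.hasFDerivAt

/-- The chain rule gives a second derivative and a squared gradient, each bounded by `b`; hence
domination of both is assumed. -/
lemma norm_weightedHessian_le (hσ1 : ∀ t, |σ t| ≤ 1) (hτ1 : ∀ t, |τ t| ≤ 1) {θ : E}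
    (hf : ContDiffAt ℝ 2 f θ) {b : ℝ} (hg : ‖gradient f θ‖ ^ 2 ≤ b)
    (hh : ‖iteratedFDeriv ℝ 2 f θ‖ ≤ b) : ‖weightedHessian σ τ f θ‖ ≤ 2 * b := by
  refine (norm_add_le _ _).trans ?_
  rw [ContinuousLinearMap.norm_smulRight_apply, norm_smul, norm_smul, Real.norm_eq_abs,
    Real.norm_eq_abs, ← norm_gradient, mul_assoc, ← sq]
  have h1 : |σ (f θ)| * ‖fderiv ℝ (gradient f) θ‖ ≤ 1 * b :=
    mul_le_mul (hσ1 _) ((norm_fderiv_gradient_le hf).trans hh) (norm_nonneg _) zero_le_one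
  have h2 : |τ (f θ)| * ‖gradient f θ‖ ^ 2 ≤ 1 * b :=
    mul_le_mul (hτ1 _) hg (sq_nonneg _) zero_le_one
  linarith

lemma norm_weightedGradient_sub_le (hσ : ∀ t, HasDerivAt σ (τ t) t) (hσ1 : ∀ t, |σ t| ≤ 1)
    (hτ1 : ∀ t, |τ t| ≤ 1) {s : Set E} (hs : Convex ℝ s) {b : ℝ}
    (hf : ∀ θ ∈ s, ContDiffAt ℝ 2 f θ) (hg : ∀ θ ∈ s, ‖gradient f θ‖ ^ 2 ≤ b)
    (hh : ∀ θ ∈ s, ‖iteratedFDeriv ℝ 2 f θ‖ ≤ b) {θ θ' : E} (hθ : θ ∈ s) (hθ' : θ' ∈ s) :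
    ‖weightedGradient σ f θ - weightedGradient σ f θ'‖ ≤ 2 * b * ‖θ - θ'‖ :=
  hs.norm_image_sub_le_of_norm_hasFDerivWithin_le
    (fun x hx => (hasFDerivAt_weightedGradient hσ (hf x hx)).hasFDerivWithinAt)
    (fun x hx => norm_weightedHessian_le hσ1 hτ1 (hf x hx) (hg x hx) (hh x hx)) hθ' hθ

end Calculus

/-! ### The logistic functions of the log-ratio. -/

section Sigmoid

/-- The probability `ν / (ν + eᵗ)` of the label `0` where the log-ratio is `t`. -/
noncomputable def noiseProb (ν t : ℝ) : ℝ := ν / (ν + Real.exp t)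

/-- The probability `eᵗ / (ν + eᵗ)` of the label `1` where the log-ratio is `t`. -/
noncomputable def dataProb (ν t : ℝ) : ℝ := Real.exp t / (ν + Real.exp t)

/-- The derivative of `dataProb`. -/
noncomputable def probSlope (ν t : ℝ) : ℝ := ν * Real.exp t / (ν + Real.exp t) ^ 2

variable {ν : ℝ}

lemma hasDerivAt_dataProb (hν : 0 < ν) (t : ℝ) :
    HasDerivAt (dataProb ν) (probSlope ν t) t := by
  have h := (Real.hasDerivAt_exp t).div ((Real.hasDerivAt_exp t).const_add ν) (by positivity)
  refine HasDerivAt.congr_deriv (f := dataProb ν) h ?_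
  rw [probSlope]
  ring

/-- The two probabilities sum to one, so both score weights have the same derivative. -/
lemma hasDerivAt_neg_noiseProb (hν : 0 < ν) (t : ℝ) :
    HasDerivAt (fun t => -noiseProb ν t) (probSlope ν t) t := by
  refine ((hasDerivAt_dataProb hν t).sub_const 1).congr_of_eventuallyEq
    (Eventually.of_forall fun s => ?_)
  have : ν + Real.exp s ≠ 0 := by positivity
  simp only [noiseProb, dataProb]
  field_simp
  ring

lemma abs_dataProb_le (hν : 0 < ν) (t : ℝ) : |dataProb ν t| ≤ 1 := by
  have := Real.exp_pos t
  rw [dataProb, abs_of_pos (by positivity), div_le_one (by positivity)]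
  linarith

lemma abs_neg_noiseProb_le (hν : 0 < ν) (t : ℝ) : |-noiseProb ν t| ≤ 1 := by
  have := Real.exp_pos t
  rw [abs_neg, noiseProb, abs_of_pos (by positivity), div_le_one (by positivity)]
  linarith

lemma abs_probSlope_le (hν : 0 < ν) (t : ℝ) : |probSlope ν t| ≤ 1 := by
  have := Real.exp_pos t
  rw [probSlope, abs_of_pos (by positivity), div_le_one (by positivity)]
  nlinarith [mul_pos hν this]

/-- With its counterpart for label `0`, this identifies the gradients of the losses as
`weightedGradient` with the bounded weights `-noiseProb` and `dataProb`. -/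
lemma hasDerivAt_neg_log_dataProb (hν : 0 < ν) (t : ℝ) :
    HasDerivAt (fun t => -Real.log (dataProb ν t)) (-noiseProb ν t) t := by
  have h0 : 0 < ν + Real.exp t := by positivity
  have h1 : 0 < dataProb ν t := by unfold dataProb; positivity
  refine HasDerivAt.congr_deriv ((hasDerivAt_dataProb hν t).log h1.ne').neg ?_
  rw [noiseProb, probSlope, dataProb]
  field_simp

lemma hasDerivAt_neg_log_noiseProb (hν : 0 < ν) (t : ℝ) :
    HasDerivAt (fun t => -Real.log (noiseProb ν t)) (dataProb ν t) t := by
  have h0 : 0 < ν + Real.exp t := by positivity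
  have h1 : noiseProb ν t ≠ 0 := by unfold noiseProb; positivity
  have h := ((hasDerivAt_neg_noiseProb hν t).neg).congr_of_eventuallyEq
    (f₁ := noiseProb ν) (Eventually.of_forall fun s => (neg_neg _).symm)
  refine HasDerivAt.congr_deriv (h.log h1).neg ?_
  rw [noiseProb, probSlope, dataProb]
  field_simp

lemma lossPos_eq_dataProb (hν : 0 < ν) {b : ℝ≥0} (hb : 0 < b) :
    lossPos ν b = ENNReal.ofReal (-Real.log (dataProb ν (Real.log b))) := by
  rw [lossPos_of_pos hν hb, dataProb, Real.exp_log (by exact_mod_cast hb)]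

lemma lossNeg_eq_noiseProb (hν : 0 < ν) {b : ℝ≥0} (hb : 0 < b) :
    lossNeg ν b = ENNReal.ofReal (-Real.log (noiseProb ν (Real.log b))) := by
  rw [lossNeg_eq hν, noiseProb, Real.exp_log (by exact_mod_cast hb)]

lemma neg_log_dataProb_nonneg (hν : 0 < ν) (t : ℝ) : 0 ≤ -Real.log (dataProb ν t) := by
  have h1 : 0 < dataProb ν t := by unfold dataProb; positivity
  have := Real.log_nonpos h1.le ((le_abs_self _).trans (abs_dataProb_le hν t))
  linarith

lemma neg_log_noiseProb_nonneg (hν : 0 < ν) (t : ℝ) : 0 ≤ -Real.log (noiseProb ν t) := by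
  have h1 : 0 < noiseProb ν t := by unfold noiseProb; positivity
  have h2 := abs_neg_noiseProb_le hν t
  rw [abs_neg] at h2
  have := Real.log_nonpos h1.le ((le_abs_self _).trans h2)
  linarith

end Sigmoid

/-! ### The first order condition. -/

section EmpiricalScore

variable {E : Type*} [NormedAddCommGroup E] [InnerProductSpace ℝ E] [CompleteSpace E]
  {α : Type*} {ν : ℝ} {c : E → α → ℝ≥0}

/-- The score equation at an interior minimiser of the empirical loss. -/
lemma empirical_score_eq_zero (hν : 0 < ν) {N M : ℕ} (hN : 0 < N) (hM : 0 < M) {x y : ℕ → α}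
    {Θ V : Set E} (hV : IsOpen V) (hVΘ : V ⊆ Θ)
    (hx : ∀ l, (∀ θ ∈ V, 0 < c θ (x l)) ∧
      ∀ θ ∈ V, DifferentiableAt ℝ (fun θ => Real.log (c θ (x l))) θ)
    (hy : ∀ l, (∀ θ ∈ V, 0 < c θ (y l)) ∧
      ∀ θ ∈ V, DifferentiableAt ℝ (fun θ => Real.log (c θ (y l))) θ)
    {θhat : E} (hθ : θhat ∈ V)
    (hmin : IsMinOn (fun θ => (N : ℝ≥0∞)⁻¹ * ∑ k ∈ Finset.range N, lossPos ν (c θ (x k)) +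
      ENNReal.ofReal ν * ((M : ℝ≥0∞)⁻¹ * ∑ k ∈ Finset.range M, lossNeg ν (c θ (y k)))) Θ θhat) :
    (N : ℝ)⁻¹ • ∑ l ∈ Finset.range N, weightedGradient (fun t => -noiseProb ν t)
        (fun θ => Real.log (c θ (x l))) θhat +
      ν • ((M : ℝ)⁻¹ • ∑ l ∈ Finset.range M, weightedGradient (dataProb ν)
        (fun θ => Real.log (c θ (y l))) θhat) = 0 := by
  -- Positive ratios on `V` make the empirical loss finite there; `G` is its real version, to which
  -- Fermat's rule applies since `V` is an open subset of `Θ`.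
  set G : E → ℝ := fun θ => (N : ℝ)⁻¹ * ∑ l ∈ Finset.range N,
      -Real.log (dataProb ν (Real.log (c θ (x l)))) +
    ν * ((M : ℝ)⁻¹ * ∑ l ∈ Finset.range M, -Real.log (noiseProb ν (Real.log (c θ (y l))))) with hG
  have h1 : ∀ θ, 0 ≤ ∑ l ∈ Finset.range N, -Real.log (dataProb ν (Real.log (c θ (x l)))) :=
    fun θ => Finset.sum_nonneg fun l _ => neg_log_dataProb_nonneg hν _
  have h2 : ∀ θ, 0 ≤ ∑ l ∈ Finset.range M, -Real.log (noiseProb ν (Real.log (c θ (y l)))) :=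
    fun θ => Finset.sum_nonneg fun l _ => neg_log_noiseProb_nonneg hν _
  have hG0 : ∀ θ, 0 ≤ G θ := fun θ => by
    have := h1 θ
    have := h2 θ
    positivity
  have hGeq : ∀ θ ∈ V, (N : ℝ≥0∞)⁻¹ * ∑ k ∈ Finset.range N, lossPos ν (c θ (x k)) +
      ENNReal.ofReal ν * ((M : ℝ≥0∞)⁻¹ * ∑ k ∈ Finset.range M, lossNeg ν (c θ (y k))) =
      ENNReal.ofReal (G θ) := fun θ hθ => by
    have hi : ∀ n : ℕ, 0 < n → (n : ℝ≥0∞)⁻¹ = ENNReal.ofReal (n : ℝ)⁻¹ := fun n hn => by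
      rw [ENNReal.ofReal_inv_of_pos (by exact_mod_cast hn), ENNReal.ofReal_natCast]
    rw [hG, ENNReal.ofReal_add (mul_nonneg (by positivity) (h1 θ))
      (mul_nonneg hν.le (mul_nonneg (by positivity) (h2 θ))), ENNReal.ofReal_mul (by positivity),
      ENNReal.ofReal_mul hν.le, ENNReal.ofReal_mul (by positivity), hi N hN, hi M hM,
      ENNReal.ofReal_sum_of_nonneg fun l _ => neg_log_dataProb_nonneg hν _,
      ENNReal.ofReal_sum_of_nonneg fun l _ => neg_log_noiseProb_nonneg hν _]
    simp only [lossPos_eq_dataProb hν ((hx _).1 θ hθ), lossNeg_eq_noiseProb hν ((hy _).1 θ hθ)]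
  have hloc : IsLocalMin G θhat := by
    filter_upwards [hV.mem_nhds hθ] with θ hθV
    have := hmin (hVΘ hθV)
    simp only [Set.mem_ofPred_eq] at this
    rw [hGeq θ hθV, hGeq θhat hθ] at this
    exact (ENNReal.ofReal_le_ofReal_iff (hG0 θ)).1 this
  have hd1 : ∀ l, HasFDerivAt (fun θ => -Real.log (dataProb ν (Real.log (c θ (x l)))))
      (-noiseProb ν (Real.log (c θhat (x l))) •
        fderiv ℝ (fun θ => Real.log (c θ (x l))) θhat) θhat := fun l =>
    (hasDerivAt_neg_log_dataProb hν _).comp_hasFDerivAt θhat ((hx l).2 θhat hθ).hasFDerivAt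
  have hd2 : ∀ l, HasFDerivAt (fun θ => -Real.log (noiseProb ν (Real.log (c θ (y l)))))
      (dataProb ν (Real.log (c θhat (y l))) •
        fderiv ℝ (fun θ => Real.log (c θ (y l))) θhat) θhat := fun l =>
    (hasDerivAt_neg_log_noiseProb hν _).comp_hasFDerivAt θhat ((hy l).2 θhat hθ).hasFDerivAt
  have hdG := ((HasFDerivAt.fun_sum fun l (_ : l ∈ Finset.range N) => hd1 l).const_mul
    (N : ℝ)⁻¹).add (((HasFDerivAt.fun_sum fun l (_ : l ∈ Finset.range M) => hd2 l).const_mul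
    (M : ℝ)⁻¹).const_mul ν)
  have h0 := congrArg (rieszVector E) (hloc.hasFDerivAt_eq_zero hdG)
  simpa [map_add, map_smul, map_sum, weightedGradient, gradient_eq_rieszVector] using h0

end EmpiricalScore

/-! ### Quadratic forms of inverse matrices. -/

section MatrixAlgebra

open Matrix

variable {ι : Type*} [Fintype ι] [DecidableEq ι] {A : Matrix ι ι ℝ}

lemma isUnit_det_of_rank_eq {m : ℕ} {A : Matrix (Fin m) (Fin m) ℝ} (h : A.rank = m) :
    IsUnit A.det := by
  rw [← Matrix.isUnit_iff_isUnit_det, ← Matrix.mulVec_surjective_iff_isUnit]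
  have htop : LinearMap.range A.mulVecLin = ⊤ :=
    Submodule.eq_top_of_finrank_eq (by simpa [Matrix.rank] using h)
  exact LinearMap.range_eq_top.1 htop

/-- The quadratic form of an inverse with a correction of rank one. -/
lemma dotProduct_inv_sub_mulVec (hA : A.IsSymm) (hdet : IsUnit A.det) (a t : ι → ℝ) (q : ℝ) :
    t ⬝ᵥ (A⁻¹ - q • (A⁻¹ * vecMulVec a a * A⁻¹)) *ᵥ t =
      (A⁻¹ *ᵥ t) ⬝ᵥ A *ᵥ (A⁻¹ *ᵥ t) - q * (a ⬝ᵥ (A⁻¹ *ᵥ t)) ^ 2 := by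
  have hsym : ∀ v w : ι → ℝ, v ⬝ᵥ A⁻¹ *ᵥ w = (A⁻¹ *ᵥ v) ⬝ᵥ w := fun v w => by
    rw [dotProduct_mulVec, ← mulVec_transpose, transpose_nonsing_inv, hA.eq]
  have h1 : A *ᵥ (A⁻¹ *ᵥ t) = t := by
    rw [mulVec_mulVec, mul_nonsing_inv _ hdet, one_mulVec]
  rw [h1, sub_mulVec, dotProduct_sub, smul_mulVec, dotProduct_smul, smul_eq_mul, ← mulVec_mulVec,
    ← mulVec_mulVec, hsym, hsym]
  congr 2
  rw [vecMulVec_mulVec, dotProduct_smul, dotProduct_comm (A⁻¹ *ᵥ t) a]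
  simp [sq]

lemma isSymm_inv_sub (hA : A.IsSymm) (a : ι → ℝ) (q : ℝ) :
    (A⁻¹ - q • (A⁻¹ * vecMulVec a a * A⁻¹)).IsSymm := by
  have h1 : A⁻¹ᵀ = A⁻¹ := by rw [transpose_nonsing_inv, hA.eq]
  have h2 : (vecMulVec a a)ᵀ = vecMulVec a a := transpose_vecMulVec a a
  rw [Matrix.IsSymm, transpose_sub, transpose_smul, transpose_mul, transpose_mul, h1, h2,
    Matrix.mul_assoc]

end MatrixAlgebra

/-! ### Mean, variance and mean derivative of the score at the truth. -/

section Moments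

open scoped RealInnerProductSpace

variable {ν : ℝ}

/-- The weight `ν b / (ν + b)` of the information matrix where the ratio is `b`. -/
noncomputable def infoWeight (ν : ℝ) (b : ℝ≥0) : ℝ := ν * b / (ν + b)

lemma infoWeight_nonneg (hν : 0 < ν) (b : ℝ≥0) : 0 ≤ infoWeight ν b := by
  unfold infoWeight; positivity

lemma infoWeight_le (hν : 0 < ν) (b : ℝ≥0) : infoWeight ν b ≤ ν := by
  rw [infoWeight, div_le_iff₀ (by positivity)]
  nlinarith [b.coe_nonneg]

/-- This and the next three identities make one weight govern everything at the true ratio: this one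
and `mul_dataProb` the means, `mul_probSlope` the Hessian, `mul_sq_noiseProb_add` the second
moments. -/
lemma mul_noiseProb {b : ℝ≥0} (hb : 0 < b) :
    (b : ℝ) * noiseProb ν (Real.log b) = infoWeight ν b := by
  rw [noiseProb, Real.exp_log (by exact_mod_cast hb), infoWeight]
  ring

lemma mul_dataProb {b : ℝ≥0} (hb : 0 < b) :
    ν * dataProb ν (Real.log b) = infoWeight ν b := by
  rw [dataProb, Real.exp_log (by exact_mod_cast hb), infoWeight]
  ring

lemma mul_probSlope (hν : 0 < ν) {b : ℝ≥0} (hb : 0 < b) :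
    (b + ν) * probSlope ν (Real.log b) = infoWeight ν b := by
  have : ν + (b : ℝ) ≠ 0 := by positivity
  rw [probSlope, Real.exp_log (by exact_mod_cast hb), infoWeight]
  field_simp
  ring

lemma mul_sq_noiseProb_add (hν : 0 < ν) {b : ℝ≥0} (hb : 0 < b) :
    (b : ℝ) * noiseProb ν (Real.log b) ^ 2 + ν * dataProb ν (Real.log b) ^ 2 =
      infoWeight ν b := by
  have : ν + (b : ℝ) ≠ 0 := by positivity
  rw [noiseProb, dataProb, Real.exp_log (by exact_mod_cast hb), infoWeight]
  field_simp

lemma continuous_dataProb (hν : 0 < ν) : Continuous (dataProb ν) :=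
  continuous_iff_continuousAt.2 fun t => (hasDerivAt_dataProb hν t).continuousAt

lemma continuous_neg_noiseProb (hν : 0 < ν) : Continuous fun t => -noiseProb ν t :=
  continuous_iff_continuousAt.2 fun t => (hasDerivAt_neg_noiseProb hν t).continuousAt

variable {m : ℕ} {α : Type*} [MeasurableSpace α] {γ : Measure α} {r : α → ℝ≥0}
  {g : α → EuclideanSpace ℝ (Fin m)} {B : α → ℝ}

/-- The information matrix of the score `g`. -/
noncomputable def weightedGram (ν : ℝ) (γ : Measure α) (r : α → ℝ≥0)
    (g : α → EuclideanSpace ℝ (Fin m)) : Matrix (Fin m) (Fin m) ℝ :=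
  Matrix.of fun i j => ∫ z, infoWeight ν (r z) * (g z i * g z j) ∂γ

/-- The weighted mean of the score `g`. -/
noncomputable def weightedMean (ν : ℝ) (γ : Measure α) (r : α → ℝ≥0)
    (g : α → EuclideanSpace ℝ (Fin m)) : EuclideanSpace ℝ (Fin m) :=
  ∫ z, infoWeight ν (r z) • g z ∂γ

lemma isSymm_weightedGram : (weightedGram ν γ r g).IsSymm := by
  ext i j
  simp only [weightedGram, Matrix.transpose_apply, Matrix.of_apply, mul_comm (g _ i)]

lemma memLp_two_smul {ρ : Measure α} {σ : ℝ → ℝ} (hσ : Continuous σ) (hσ1 : ∀ t, |σ t| ≤ 1)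
    (hr : Measurable r) (hg : AEStronglyMeasurable g ρ) (hB : Integrable B ρ)
    (hgB : ∀ᵐ z ∂ρ, ‖g z‖ ^ 2 ≤ B z) :
    MemLp (fun z => σ (Real.log (r z)) • g z) 2 ρ := by
  have hlog : Measurable fun z => σ (Real.log (r z)) :=
    hσ.measurable.comp (Real.measurable_log.comp hr.coe_nnreal_real)
  have hm : AEStronglyMeasurable (fun z => σ (Real.log (r z)) • g z) ρ :=
    hlog.aestronglyMeasurable.smul hg
  rw [memLp_two_iff_integrable_sq_norm hm]
  refine hB.mono' (hm.norm.pow 2) ?_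
  filter_upwards [hgB] with z hz
  rw [norm_pow, norm_norm, norm_smul, mul_pow, Real.norm_eq_abs, sq_abs]
  have : σ (Real.log (r z)) ^ 2 ≤ 1 := by
    rw [← sq_abs]; exact pow_le_one₀ (abs_nonneg _) (hσ1 _)
  nlinarith [sq_nonneg ‖g z‖]

lemma integrable_infoWeight_mul (hν : 0 < ν) (hr : Measurable r)
    (hg : AEStronglyMeasurable g γ) (hB : Integrable B γ) (hgB : ∀ᵐ z ∂γ, ‖g z‖ ^ 2 ≤ B z)
    (i j : Fin m) : Integrable (fun z => infoWeight ν (r z) * (g z i * g z j)) γ := by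
  have hcoord : ∀ i, AEStronglyMeasurable (fun z => g z i) γ := fun i =>
    (EuclideanSpace.proj i : EuclideanSpace ℝ (Fin m) →L[ℝ] ℝ).continuous.comp_aestronglyMeasurable
      hg
  have hw : Measurable fun z => infoWeight ν (r z) := by unfold infoWeight; fun_prop
  refine (hB.const_mul ν).mono' (hw.aestronglyMeasurable.mul ((hcoord i).mul (hcoord j))) ?_
  filter_upwards [hgB] with z hz
  rw [norm_mul, norm_mul, Real.norm_of_nonneg (infoWeight_nonneg hν _)]
  have h1 := PiLp.norm_apply_le (g z) i
  have h2 := PiLp.norm_apply_le (g z) j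
  have h3 : ‖g z i‖ * ‖g z j‖ ≤ B z := by
    refine le_trans ?_ hz
    rw [sq]
    exact mul_le_mul h1 h2 (norm_nonneg _) (norm_nonneg _)
  exact mul_le_mul (infoWeight_le hν _) h3 (by positivity) hν.le

lemma weightedGram_mulVec_dotProduct (hν : 0 < ν) (hr : Measurable r)
    (hg : AEStronglyMeasurable g γ) (hB : Integrable B γ) (hgB : ∀ᵐ z ∂γ, ‖g z‖ ^ 2 ≤ B z)
    (u v : EuclideanSpace ℝ (Fin m)) :
    u ⬝ᵥ (weightedGram ν γ r g).mulVec v = ∫ z, infoWeight ν (r z) * (⟪u, g z⟫ * ⟪v, g z⟫) ∂γ := by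
  have hI := integrable_infoWeight_mul hν hr hg hB hgB
  have h1 : ∀ z, infoWeight ν (r z) * (⟪u, g z⟫ * ⟪v, g z⟫) =
      ∑ i, ∑ j, u i * (infoWeight ν (r z) * (g z i * g z j) * v j) := fun z => by
    simp only [PiLp.inner_apply, RCLike.inner_apply, conj_trivial, Finset.sum_mul_sum]
    simp only [Finset.mul_sum]
    exact Finset.sum_congr rfl fun i _ => Finset.sum_congr rfl fun j _ => by ring
  simp_rw [h1]
  rw [integral_finsetSum _ fun i _ => integrable_finsetSum _ fun j _ =>
    ((hI i j).mul_const _).const_mul _]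
  simp only [dotProduct, Matrix.mulVec, weightedGram, Matrix.of_apply]
  refine Finset.sum_congr rfl fun i _ => ?_
  rw [integral_finsetSum _ fun j _ => ((hI i j).mul_const _).const_mul _, Finset.mul_sum]
  refine Finset.sum_congr rfl fun j _ => ?_
  rw [integral_const_mul, integral_mul_const]

lemma integral_score_withDensity (hr : Measurable r) (hr0 : ∀ᵐ z ∂γ, 0 < r z) :
    ∫ z, (-noiseProb ν (Real.log (r z))) • g z ∂(γ.withDensity fun z => (r z : ℝ≥0∞)) =
      -weightedMean ν γ r g := by
  rw [integral_withDensity_eq_integral_smul hr, weightedMean, ← integral_neg]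
  refine integral_congr_ae (hr0.mono fun z hz => ?_)
  simp only [NNReal.smul_def, neg_smul, smul_neg, smul_smul, mul_noiseProb hz]

lemma integral_score (hν : 0 < ν) (hr0 : ∀ᵐ z ∂γ, 0 < r z) :
    ∫ z, dataProb ν (Real.log (r z)) • g z ∂γ = ν⁻¹ • weightedMean ν γ r g := by
  rw [weightedMean, ← integral_smul]
  refine integral_congr_ae (hr0.mono fun z hz => ?_)
  simp only [smul_smul, ← mul_dataProb hz, inv_mul_cancel_left₀ hν.ne']

/-- The variance of the limit of the rescaled score. -/
lemma variance_score_add (hν : 0 < ν) [IsProbabilityMeasure γ]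
    [IsProbabilityMeasure (γ.withDensity fun z => (r z : ℝ≥0∞))] (hr : Measurable r)
    (hr0 : ∀ᵐ z ∂γ, 0 < r z) (hg : AEStronglyMeasurable g γ) (hB : Integrable B γ)
    (hB' : Integrable B (γ.withDensity fun z => (r z : ℝ≥0∞)))
    (hgB : ∀ᵐ z ∂γ, ‖g z‖ ^ 2 ≤ B z) (u : EuclideanSpace ℝ (Fin m)) :
    Var[fun z => ⟪u, (-noiseProb ν (Real.log (r z))) • g z⟫;
        γ.withDensity fun z => (r z : ℝ≥0∞)] +
      ν * Var[fun z => ⟪u, dataProb ν (Real.log (r z)) • g z⟫; γ] =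
    u ⬝ᵥ (weightedGram ν γ r g).mulVec u -
      (1 + 1 / ν) * (weightedMean ν γ r g ⬝ᵥ u) ^ 2 := by
  have hac : (γ.withDensity fun z => (r z : ℝ≥0∞)) ≪ γ := withDensity_absolutelyContinuous _ _
  have h1 := memLp_two_smul (continuous_neg_noiseProb hν) (abs_neg_noiseProb_le hν) hr
    (hg.mono_ac hac) hB' (hac.ae_le hgB)
  have h2 := memLp_two_smul (continuous_dataProb hν) (abs_dataProb_le hν) hr hg hB hgB
  have hu1 := h1.const_inner (𝕜 := ℝ) u
  have hu2 := h2.const_inner (𝕜 := ℝ) u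
  -- The second moments add up to the Gram form. The means are `-w` and `ν⁻¹ • w`, so the subtracted
  -- squares have total coefficient `1 + ν * ν⁻¹ ^ 2 = 1 + 1 / ν`.
  rw [variance_eq_sub hu1, variance_eq_sub hu2, integral_inner (h1.integrable one_le_two),
    integral_inner (h2.integrable one_le_two), integral_score_withDensity hr hr0,
    integral_score hν hr0, inner_neg_right, inner_smul_right]
  have hdot : weightedMean ν γ r g ⬝ᵥ u = ⟪u, weightedMean ν γ r g⟫ := by
    simp [PiLp.inner_apply, dotProduct]
  rw [hdot, weightedGram_mulVec_dotProduct hν hr hg hB hgB]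
  have e1 : ∫ z, ((fun z => ⟪u, (-noiseProb ν (Real.log (r z))) • g z⟫) ^ 2) z
      ∂(γ.withDensity fun z => (r z : ℝ≥0∞)) +
      ν * ∫ z, ((fun z => ⟪u, dataProb ν (Real.log (r z)) • g z⟫) ^ 2) z ∂γ =
      ∫ z, infoWeight ν (r z) * (⟪u, g z⟫ * ⟪u, g z⟫) ∂γ := by
    have i1 := (integrable_withDensity_iff_integrable_smul hr).1 hu1.integrable_sq
    have i2 := hu2.integrable_sq.const_mul ν
    rw [integral_withDensity_eq_integral_smul hr, ← integral_const_mul]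
    refine (integral_add i1 i2).symm.trans (integral_congr_ae (hr0.mono fun z hz => ?_))
    simp only [inner_smul_right, NNReal.smul_def, smul_eq_mul,
      ← mul_sq_noiseProb_add hν hz]
    ring
  have hν0 := hν.ne'
  rw [← e1]
  field_simp
  ring

/-- The limit of the Hessian of the empirical loss. -/
lemma integral_hessian_add (hν : 0 < ν) (hr : Measurable r) (hr0 : ∀ᵐ z ∂γ, 0 < r z)
    (hg : AEStronglyMeasurable g γ) (hB : Integrable B γ) (hgB : ∀ᵐ z ∂γ, ‖g z‖ ^ 2 ≤ B z)
    {G D₁ D₂ : α → EuclideanSpace ℝ (Fin m) →L[ℝ] EuclideanSpace ℝ (Fin m)}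
    (hD₁ : ∀ᵐ z ∂γ, ∀ v, D₁ z v = (-noiseProb ν (Real.log (r z))) • G z v +
      (probSlope ν (Real.log (r z)) * ⟪g z, v⟫) • g z)
    (hD₂ : ∀ᵐ z ∂γ, ∀ v, D₂ z v = dataProb ν (Real.log (r z)) • G z v +
      (probSlope ν (Real.log (r z)) * ⟪g z, v⟫) • g z)
    (hi₁ : Integrable D₁ (γ.withDensity fun z => (r z : ℝ≥0∞))) (hi₂ : Integrable D₂ γ)
    (v : EuclideanSpace ℝ (Fin m)) :
    (∫ z, D₁ z ∂(γ.withDensity fun z => (r z : ℝ≥0∞))) v + ν • (∫ z, D₂ z ∂γ) v =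
      Matrix.toEuclideanCLM (𝕜 := ℝ) (weightedGram ν γ r g) v := by
  refine ext_inner_left ℝ fun u => ?_
  rw [Matrix.inner_toEuclideanCLM, weightedGram_mulVec_dotProduct hν hr hg hB hgB,
    ContinuousLinearMap.integral_apply hi₁, ContinuousLinearMap.integral_apply hi₂, inner_add_right,
    inner_smul_right, ← integral_inner (hi₁.apply_continuousLinearMap v),
    ← integral_inner (hi₂.apply_continuousLinearMap v)]
  have i1 := (integrable_withDensity_iff_integrable_smul hr).1
    ((hi₁.apply_continuousLinearMap v).const_inner (𝕜 := ℝ) u)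
  have i2 := ((hi₂.apply_continuousLinearMap v).const_inner (𝕜 := ℝ) u).const_mul ν
  rw [integral_withDensity_eq_integral_smul hr, ← integral_const_mul, ← integral_add i1 i2]
  refine integral_congr_ae ?_
  filter_upwards [hr0, hD₁, hD₂] with z hz h1 h2
  rw [h1, h2, ← mul_probSlope hν hz, NNReal.smul_def, smul_eq_mul, inner_add_right,
    inner_add_right, inner_smul_right, inner_smul_right, inner_smul_right,
    real_inner_comm v (g z)]
  -- The second derivative `G` of the log-ratio has weights `-r * noiseProb` and `ν * dataProb`,
  -- which cancel.
  have := (mul_noiseProb (ν := ν) hz).trans (mul_dataProb hz).symm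
  linear_combination (-⟪u, G z v⟫) * this

end Moments

/-! ### The information matrix and mean score as Gaussian integrals. -/

section InfoMatrix

variable {d m : ℕ} {μ : Measure (Fin d → ℝ)} {ν : ℝ} {r : (Fin d → ℝ) → ℝ≥0}
  {c : EuclideanSpace ℝ (Fin m) → (Fin d → ℝ) → ℝ≥0} {θs : EuclideanSpace ℝ (Fin m)}

/-- Substituting `p̃ = r q̃` turns `F_ν p̃` into `infoWeight ν r` times `q̃`. -/
lemma integral_noiseWeight_mul {G : Type*} [NormedAddCommGroup G] [NormedSpace ℝ G] (hν : 0 < ν)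
    (hlat : ∀ᵐ z : Fin d → ℝ, latentDensity μ z = r z * gaussianDensity z)
    (φ : (Fin d → ℝ) → G) :
    ∫ z, (noiseWeight μ ν z * latentDensity μ z) • φ z =
      ∫ z, infoWeight ν (r z) • φ z ∂(gaussianLaw d) := by
  rw [gaussianLaw_eq_withDensity, integral_withDensity_eq_integral_toReal_smul
    measurable_gaussianDensity.ennreal_ofReal (by simp)]
  refine integral_congr_ae (hlat.mono fun z hz => ?_)
  have h0 := gaussianDensity_pos z
  have h1 : ν + (r z : ℝ) ≠ 0 := by positivity
  simp only [noiseWeight, hz, ENNReal.toReal_ofReal h0.le, smul_smul, infoWeight]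
  congr 1
  have h2 : (r z : ℝ) * gaussianDensity z + ν * gaussianDensity z ≠ 0 := by positivity
  field_simp
  ring

lemma infoMatrix_eq_weightedGram (hν : 0 < ν)
    (hlat : ∀ᵐ z : Fin d → ℝ, latentDensity μ z = r z * gaussianDensity z) :
    infoMatrix μ ν c θs = weightedGram ν (gaussianLaw d) r (score c θs) := by
  ext i j
  have := integral_noiseWeight_mul (μ := μ) hν hlat fun z => score c θs z i * score c θs z j
  simp only [smul_eq_mul] at this
  rw [infoMatrix, weightedGram, Matrix.of_apply, Matrix.of_apply, ← this]
  congr with z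
  ring

lemma meanScore_eq_weightedMean (hν : 0 < ν)
    (hlat : ∀ᵐ z : Fin d → ℝ, latentDensity μ z = r z * gaussianDensity z)
    (hint : Integrable (fun z => infoWeight ν (r z) • score c θs z) (gaussianLaw d)) :
    meanScore μ ν c θs = weightedMean ν (gaussianLaw d) r (score c θs) := by
  funext i
  have := integral_noiseWeight_mul (μ := μ) hν hlat fun z => score c θs z i
  have h2 := (EuclideanSpace.proj i : EuclideanSpace ℝ (Fin m) →L[ℝ] ℝ).integral_comp_comm hint
  simp only [PiLp.proj_apply, PiLp.smul_apply, smul_eq_mul] at h2 this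
  rw [weightedMean, ← h2, ← this, meanScore]
  congr with z
  ring

end InfoMatrix

/-! ### Slutsky's theorem with a relative error. -/

section RelativeError

variable {Ω Ω' : Type*} [MeasurableSpace Ω] [MeasurableSpace Ω'] {P : Measure Ω}
  [IsProbabilityMeasure P] {P' : Measure Ω'} [IsProbabilityMeasure P']
  {E : Type*} [NormedAddCommGroup E] [MeasurableSpace E] [BorelSpace E]

/-- A sequence which converges in distribution is bounded in probability. -/
lemma exists_eventually_measure_norm_ge_le {T : ℕ → Ω → E} {Z : Ω' → E}
    (h : TendstoInDistribution T atTop Z (fun _ => P) P') {η : ℝ≥0∞} (hη : 0 < η) :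
    ∃ K : ℝ, 0 < K ∧ ∀ᶠ k in atTop, P {ω | K ≤ ‖T k ω‖} ≤ η := by
  have hcl : ∀ n : ℕ, IsClosed {x : E | (n : ℝ) + 1 ≤ ‖x‖} := fun n =>
    isClosed_le continuous_const continuous_norm
  have hlim : Tendsto (fun n : ℕ => (P'.map Z) {x : E | (n : ℝ) + 1 ≤ ‖x‖}) atTop (𝓝 0) := by
    have := Measure.isProbabilityMeasure_map h.aemeasurable_limit
    have hempty : ⋂ n : ℕ, {x : E | (n : ℝ) + 1 ≤ ‖x‖} = ∅ := by
      ext x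
      simp only [Set.mem_iInter, Set.mem_ofPred_eq, Set.mem_empty_iff_false, iff_false, not_forall,
        not_le]
      obtain ⟨n, hn⟩ := exists_nat_gt ‖x‖
      exact ⟨n, by linarith⟩
    have h1 := tendsto_measure_iInter_atTop (μ := P'.map Z)
      (s := fun n : ℕ => {x : E | (n : ℝ) + 1 ≤ ‖x‖})
      (fun n => (hcl n).measurableSet.nullMeasurableSet)
      (fun i j hij x (hx : (j : ℝ) + 1 ≤ ‖x‖) => by
        have : (i : ℝ) ≤ j := by exact_mod_cast hij
        exact (by linarith : (i : ℝ) + 1 ≤ ‖x‖))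
      ⟨0, measure_ne_top _ _⟩
    rwa [hempty, measure_empty] at h1
  obtain ⟨n, hn⟩ := (hlim.eventually (gt_mem_nhds hη)).exists
  refine ⟨n + 1, by positivity, ?_⟩
  -- Portmanteau for the closed complement of a ball, chosen to have small mass under the limit.
  have hport := ProbabilityMeasure.limsup_measure_closed_le_of_tendsto h.tendsto (hcl n)
  filter_upwards [eventually_lt_of_limsup_lt (hport.trans_lt hn)] with k hk
  refine le_trans (le_of_eq ?_) hk.le
  simp only [ProbabilityMeasure.coe_mk]
  rw [Measure.map_apply_of_aemeasurable (h.forall_aemeasurable k) (hcl n).measurableSet]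
  rfl

/-- A sequence whose relative distance to one which converges in distribution is asymptotically
negligible converges in distribution to the same limit. -/
lemma tendstoInDistribution_of_relative_error [SecondCountableTopology E] {T W : ℕ → Ω → E}
    {Z : Ω' → E} (h : TendstoInDistribution T atTop Z (fun _ => P) P')
    (hW : ∀ k, AEMeasurable (W k) P)
    (herr : ∀ ε : ℝ, 0 < ε →
      Tendsto (fun k => P {ω | ε * ‖W k ω‖ < ‖W k ω - T k ω‖}) atTop (𝓝 0)) :
    TendstoInDistribution W atTop Z (fun _ => P) P' := by
  refine tendstoInDistribution_of_tendstoInMeasure_sub W Z h ?_ hW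
  rw [tendstoInMeasure_iff_norm]
  intro a ha
  rw [ENNReal.tendsto_atTop_zero]
  intro η hη
  have hη2 : 0 < η / 2 := ENNReal.half_pos hη.ne'
  obtain ⟨K, hK, hT⟩ := exists_eventually_measure_norm_ge_le h hη2
  -- The bound `1 / 2` gives `‖W‖ ≤ 2 * ‖T‖ < 2 * K` by absorption; the bound `a / (2 * K)` then
  -- makes the error smaller than `a`.
  set ε : ℝ := min (1 / 2) (a / (2 * K)) with hε
  have hε0 : 0 < ε := by positivity
  obtain ⟨k₁, hk₁⟩ := ENNReal.tendsto_atTop_zero.1 (herr ε hε0) _ hη2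
  obtain ⟨k₂, hk₂⟩ := eventually_atTop.1 hT
  refine ⟨max k₁ k₂, fun k hk => ?_⟩
  calc P {ω | a ≤ ‖(W - T) k ω - (0 : Ω → E) ω‖}
      ≤ P ({ω | ε * ‖W k ω‖ < ‖W k ω - T k ω‖} ∪ {ω | K ≤ ‖T k ω‖}) := by
        refine measure_mono fun ω hω => ?_
        have hω : a ≤ ‖W k ω - T k ω‖ := by simpa using hω
        by_contra hcon
        simp only [Set.mem_union, Set.mem_ofPred_eq, not_or, not_lt, not_le] at hcon
        obtain ⟨h1, h2⟩ := hcon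
        have h3 : ‖W k ω‖ ≤ ‖W k ω - T k ω‖ + ‖T k ω‖ := by
          simpa using norm_add_le (W k ω - T k ω) (T k ω)
        have h4 : ε * ‖W k ω‖ ≤ 1 / 2 * ‖W k ω‖ := by
          gcongr
          exact min_le_left _ _
        have h5 : ‖W k ω‖ < 2 * K := by linarith
        have h6 : a ≤ ε * ‖W k ω‖ := hω.trans h1
        have h7 : ε * ‖W k ω‖ < ε * (2 * K) := mul_lt_mul_of_pos_left h5 hε0
        have h8 : ε * (2 * K) ≤ a := by
          calc ε * (2 * K) ≤ a / (2 * K) * (2 * K) := by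
                gcongr
                exact min_le_right _ _
            _ = a := by field_simp
        linarith
    _ ≤ η / 2 + η / 2 := (measure_union_le _ _).trans (add_le_add
        (hk₁ k ((le_max_left _ _).trans hk)) (hk₂ k ((le_max_right _ _).trans hk)))
    _ = η := ENNReal.add_halves η

end RelativeError

/-! ### Consequences of the smoothness assumption. -/

section Regularity

variable {m : ℕ} {α : Type*} [MeasurableSpace α] {ρ : Measure α}
  {c : EuclideanSpace ℝ (Fin m) → α → ℝ≥0} {θs : EuclideanSpace ℝ (Fin m)} {r : ℝ} {B : α → ℝ}

lemma aestronglyMeasurable_gradient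
    (hc : ∀ θ ∈ Metric.ball θs r, Measurable (c θ))
    (hd : ∀ᵐ z ∂ρ, ∀ θ ∈ Metric.ball θs r, DifferentiableAt ℝ (fun θ => Real.log (c θ z)) θ)
    {θ : EuclideanSpace ℝ (Fin m)} (hθ : θ ∈ Metric.ball θs r) :
    AEStronglyMeasurable (fun z => gradient (fun θ => Real.log (c θ z)) θ) ρ := by
  obtain ⟨r', hr', hsub⟩ := Metric.isOpen_iff.1 Metric.isOpen_ball θ hθ
  have := aestronglyMeasurable_of_hasFDerivAt (ρ := ρ) (θs := θ) (F := ℝ)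
    (ψ := fun θ z => Real.log (c θ z)) (D := fun z => fderiv ℝ (fun θ => Real.log (c θ z)) θ) hr'
    (fun θ' hθ' => (Real.measurable_log.comp
      (hc θ' (hsub hθ')).coe_nnreal_real).aestronglyMeasurable)
    (hd.mono fun z hz => (hz θ hθ).hasFDerivAt)
  exact (rieszVector _).continuous.comp_aestronglyMeasurable this

/-- The regularity of the log-ratio on a ball which the asymptotic analysis uses. -/
def RegularOn (ρ : Measure α) (c : EuclideanSpace ℝ (Fin m) → α → ℝ≥0)
    (θs : EuclideanSpace ℝ (Fin m)) (r : ℝ) (B : α → ℝ) : Prop :=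
  ∀ᵐ z ∂ρ, ∀ θ ∈ Metric.ball θs r, 0 < c θ z ∧ ContDiffAt ℝ 2 (fun θ => Real.log (c θ z)) θ ∧
    ‖gradient (fun θ => Real.log (c θ z)) θ‖ ^ 2 ≤ B z ∧
    ‖iteratedFDeriv ℝ 2 (fun θ => Real.log (c θ z)) θ‖ ≤ B z

variable {σ τ : ℝ → ℝ}

lemma RegularOn.aestronglyMeasurable_weightedGradient (h : RegularOn ρ c θs r B)
    (hc : ∀ θ ∈ Metric.ball θs r, Measurable (c θ)) (hσ : ∀ t, HasDerivAt σ (τ t) t) :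
    ∀ θ ∈ Metric.ball θs r, AEStronglyMeasurable
      (fun z => weightedGradient σ (fun θ => Real.log (c θ z)) θ) ρ := fun θ hθ => by
  have hcont : Continuous σ := continuous_iff_continuousAt.2 fun t => (hσ t).continuousAt
  have h1 : AEStronglyMeasurable (fun z => σ (Real.log (c θ z))) ρ :=
    (hcont.measurable.comp
      (Real.measurable_log.comp (hc θ hθ).coe_nnreal_real)).aestronglyMeasurable
  exact h1.smul (aestronglyMeasurable_gradient hc
    (h.mono fun z hz θ hθ => (hz θ hθ).2.1.differentiableAt (by norm_num)) hθ)

lemma RegularOn.lipschitz (h : RegularOn ρ c θs r B) (hσ : ∀ t, HasDerivAt σ (τ t) t)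
    (hσ1 : ∀ t, |σ t| ≤ 1) (hτ1 : ∀ t, |τ t| ≤ 1) :
    ∀ᵐ z ∂ρ, ∀ θ ∈ Metric.ball θs r, ∀ θ' ∈ Metric.ball θs r,
      ‖weightedGradient σ (fun θ => Real.log (c θ z)) θ -
        weightedGradient σ (fun θ => Real.log (c θ z)) θ'‖ ≤ 2 * |B z| * ‖θ - θ'‖ := by
  filter_upwards [h] with z hz θ hθ θ' hθ'
  exact norm_weightedGradient_sub_le hσ hσ1 hτ1 (convex_ball θs r) (fun x hx => (hz x hx).2.1)
    (fun x hx => (hz x hx).2.2.1.trans (le_abs_self _))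
    (fun x hx => (hz x hx).2.2.2.trans (le_abs_self _)) hθ hθ'

lemma RegularOn.hasFDerivAt (hr : 0 < r) (h : RegularOn ρ c θs r B)
    (hσ : ∀ t, HasDerivAt σ (τ t) t) :
    ∀ᵐ z ∂ρ, HasFDerivAt (fun θ => weightedGradient σ (fun θ => Real.log (c θ z)) θ)
      (weightedHessian σ τ (fun θ => Real.log (c θ z)) θs) θs := by
  filter_upwards [h] with z hz
  exact hasFDerivAt_weightedGradient hσ (hz θs (Metric.mem_ball_self hr)).2.1

lemma RegularOn.integrable_weightedHessian (hr : 0 < r) (h : RegularOn ρ c θs r B)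
    (hc : ∀ θ ∈ Metric.ball θs r, Measurable (c θ)) (hB : Integrable B ρ)
    (hσ : ∀ t, HasDerivAt σ (τ t) t) (hσ1 : ∀ t, |σ t| ≤ 1) (hτ1 : ∀ t, |τ t| ≤ 1) :
    Integrable (fun z => weightedHessian σ τ (fun θ => Real.log (c θ z)) θs) ρ := by
  refine (hB.const_mul 2).mono' (aestronglyMeasurable_of_hasFDerivAt hr
    (h.aestronglyMeasurable_weightedGradient hc hσ) (h.hasFDerivAt hr hσ)) ?_
  filter_upwards [h] with z hz
  obtain ⟨-, h1, h2, h3⟩ := hz θs (Metric.mem_ball_self hr)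
  exact norm_weightedHessian_le hσ1 hτ1 h1 h2 h3

lemma RegularOn.tendsto_linearization_error {Ω : Type*} [MeasurableSpace Ω] {P : Measure Ω}
    [IsProbabilityMeasure P] (hr : 0 < r) (h : RegularOn ρ c θs r B)
    (hc : ∀ θ ∈ Metric.ball θs r, Measurable (c θ)) (hB : Integrable B ρ)
    (hσ : ∀ t, HasDerivAt σ (τ t) t) (hσ1 : ∀ t, |σ t| ≤ 1) (hτ1 : ∀ t, |τ t| ≤ 1)
    {Z : ℕ → Ω → α} (hZ : ∀ l, HasLaw (Z l) ρ P) (hindep : iIndepFun Z P)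
    {N : ℕ → ℕ} (hN : Tendsto N atTop atTop) {θhat : ℕ → Ω → EuclideanSpace ℝ (Fin m)}
    (hθ : TendstoInMeasure P θhat atTop (fun _ => θs)) {ε : ℝ} (hε : 0 < ε) :
    Tendsto (fun k => P {ω | ε * ‖θhat k ω - θs‖ < ‖(N k : ℝ)⁻¹ • ∑ l ∈ Finset.range (N k),
        (weightedGradient σ (fun θ => Real.log (c θ (Z l ω))) (θhat k ω) -
          weightedGradient σ (fun θ => Real.log (c θ (Z l ω))) θs) -
        (∫ z, weightedHessian σ τ (fun θ => Real.log (c θ z)) θs ∂ρ) (θhat k ω - θs)‖})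
      atTop (𝓝 0) :=
  tendsto_measure_linearization_error (B := fun z => 2 * |B z|)
    (ψ := fun θ z => weightedGradient σ (fun θ => Real.log (c θ z)) θ) hr
    (h.aestronglyMeasurable_weightedGradient hc hσ) (hB.abs.const_mul 2) (fun z => by positivity)
    (h.lipschitz hσ hσ1 hτ1) (h.hasFDerivAt hr hσ) hZ hindep hN hθ hε

lemma exists_regularOn_of_smoothAt {d : ℕ} {μ : Measure (Fin d → ℝ)}
    {Θ : Set (EuclideanSpace ℝ (Fin m))} {c : EuclideanSpace ℝ (Fin m) → (Fin d → ℝ) → ℝ≥0}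
    (hlat : latentLaw μ ≪ volume) (h : SmoothAt μ Θ c θs) :
    ∃ (r : ℝ) (B : (Fin d → ℝ) → ℝ), 0 < r ∧ Metric.ball θs r ⊆ Θ ∧ Integrable B (latentLaw μ) ∧
      Integrable B (gaussianLaw d) ∧ RegularOn (latentLaw μ) c θs r B ∧
      RegularOn (gaussianLaw d) c θs r B := by
  obtain ⟨U, hU, hθU, hUΘ, B, hB1, hB2, hsm⟩ := h
  obtain ⟨r, hr, hball⟩ := Metric.isOpen_iff.1 hU θs hθU
  have hreg : RegularOn volume c θs r B := by
    filter_upwards [hsm] with z hz θ hθ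
    exact ⟨hz.1 θ (hball hθ), hz.2.1.contDiffAt (hU.mem_nhds (hball hθ)),
      (hz.2.2 θ (hball hθ)).1, (hz.2.2 θ (hball hθ)).2⟩
  exact ⟨r, B, hr, hball.trans hUΘ, hB1, hB2, hlat.ae_le hreg,
    gaussianLaw_absolutelyContinuous_volume.ae_le hreg⟩

end Regularity

/-! ### From the linearised score equation to the limit law. -/

section AbstractEstimator

variable {Ω Ω' : Type*} [MeasurableSpace Ω] [MeasurableSpace Ω'] {P : Measure Ω}
  [IsProbabilityMeasure P] {P' : Measure Ω'} [IsProbabilityMeasure P']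
  {E : Type*} [NormedAddCommGroup E] [NormedSpace ℝ E] [MeasurableSpace E] [BorelSpace E]
  [SecondCountableTopology E]

/-- The limit law of a zero of the linearized score, where `u₁`, `u₂` are the two parts of the
score at the true parameter, and `v₁`, `v₂` those at the estimator. -/
lemma tendstoInDistribution_of_linearized_score {ν : ℝ} (hν : 0 < ν) {A D₁ D₂ : E →L[ℝ] E}
    (hA : ∀ v, A (D₁ v + ν • D₂ v) = v) {u₁ u₂ v₁ v₂ h : ℕ → Ω → E}
    (hh : ∀ k, AEMeasurable (h k) P)
    (h₁ : ∀ ε : ℝ, 0 < ε →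
      Tendsto (fun k => P {ω | ε * ‖h k ω‖ < ‖v₁ k ω - u₁ k ω - D₁ (h k ω)‖}) atTop (𝓝 0))
    (h₂ : ∀ ε : ℝ, 0 < ε →
      Tendsto (fun k => P {ω | ε * ‖h k ω‖ < ‖v₂ k ω - u₂ k ω - D₂ (h k ω)‖}) atTop (𝓝 0))
    (hzero : Tendsto (fun k => P {ω | ¬ v₁ k ω + ν • v₂ k ω = 0}) atTop (𝓝 0))
    {s : ℕ → ℝ} {Z : Ω' → E}
    (hlim : TendstoInDistribution (fun k ω => s k • -A (u₁ k ω + ν • u₂ k ω)) atTop Z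
      (fun _ => P) P') :
    TendstoInDistribution (fun k ω => s k • h k ω) atTop Z (fun _ => P) P' := by
  refine tendstoInDistribution_of_relative_error hlim (fun k => (hh k).const_smul _) fun ε hε => ?_
  set ε' : ℝ := ε / ((1 + ν) * (‖A‖ + 1)) with hε'
  have hpos : 0 < (1 + ν) * (‖A‖ + 1) := by positivity
  have hε0 : 0 < ε' := by positivity
  refine tendsto_of_tendsto_of_tendsto_of_le_of_le tendsto_const_nhds
    (by simpa using ((h₁ ε' hε0).add (h₂ ε' hε0)).add hzero) (fun _ => zero_le) fun k => ?_
  refine le_trans (measure_mono ?_) ((measure_union_le _ _).trans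
    (add_le_add_left (measure_union_le _ _) _))
  intro ω hω
  by_contra hcon
  simp only [Set.mem_union, Set.mem_ofPred_eq, not_or, not_lt, not_not] at hcon hω
  obtain ⟨⟨c₁, c₂⟩, c₃⟩ := hcon
  set x := h k ω
  set e₁ := v₁ k ω - u₁ k ω - D₁ x with he₁
  set e₂ := v₂ k ω - u₂ k ω - D₂ x with he₂
  -- As `A` inverts the mean Hessian and the score vanishes at the estimator, only the image of the
  -- linearisation errors is left.
  have key : s k • x - s k • -A (u₁ k ω + ν • u₂ k ω) = -(s k • A (e₁ + ν • e₂)) := by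
    have h3 : e₁ + ν • e₂ = (v₁ k ω + ν • v₂ k ω) - (u₁ k ω + ν • u₂ k ω) -
        (D₁ x + ν • D₂ x) := by
      rw [he₁, he₂]; module
    rw [h3, c₃, map_sub, map_sub, hA, map_zero]
    module
  have h4 : ‖e₁ + ν • e₂‖ ≤ (1 + ν) * (ε' * ‖x‖) := by
    refine (norm_add_le _ _).trans ?_
    rw [norm_smul, Real.norm_of_nonneg hν.le]
    nlinarith
  have h5 : ‖A (e₁ + ν • e₂)‖ ≤ ε * ‖x‖ := by
    calc _ ≤ ‖A‖ * ‖e₁ + ν • e₂‖ := A.le_opNorm _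
      _ ≤ (‖A‖ + 1) * ((1 + ν) * (ε' * ‖x‖)) := by gcongr; linarith
      _ = ε * ‖x‖ := by rw [hε']; field_simp
  rw [key, norm_neg, norm_smul, norm_smul] at hω
  have := mul_le_mul_of_nonneg_left h5 (norm_nonneg (s k))
  linarith

end AbstractEstimator

/-! ### The quadratic form of the asymptotic covariance. -/

section AsymptoticCovariance

open scoped RealInnerProductSpace

variable {d m : ℕ} {μ : Measure (Fin d → ℝ)} {ν : ℝ} {r : (Fin d → ℝ) → ℝ≥0}
  {c : EuclideanSpace ℝ (Fin m) → (Fin d → ℝ) → ℝ≥0} {θs : EuclideanSpace ℝ (Fin m)}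
  {B : (Fin d → ℝ) → ℝ}

lemma norm_le_one_add_sq {F : Type*} [NormedAddCommGroup F] (x : F) : ‖x‖ ≤ 1 + ‖x‖ ^ 2 := by
  nlinarith [sq_nonneg (‖x‖ - 1), norm_nonneg x]

lemma integrable_infoWeight_smul {α : Type*} [MeasurableSpace α] {γ : Measure α}
    [IsFiniteMeasure γ] {r : α → ℝ≥0} {g : α → EuclideanSpace ℝ (Fin m)} {B : α → ℝ} (hν : 0 < ν)
    (hr : Measurable r) (hg : AEStronglyMeasurable g γ) (hB : Integrable B γ)
    (hgB : ∀ᵐ z ∂γ, ‖g z‖ ^ 2 ≤ B z) :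
    Integrable (fun z => infoWeight ν (r z) • g z) γ := by
  have hw : Measurable fun z => infoWeight ν (r z) := by unfold infoWeight; fun_prop
  refine (((integrable_const (1 : ℝ)).add hB).const_mul ν).mono'
    (hw.aestronglyMeasurable.smul hg) ?_
  filter_upwards [hgB] with z hz
  rw [norm_smul, Real.norm_of_nonneg (infoWeight_nonneg hν _)]
  exact mul_le_mul (infoWeight_le hν _) ((norm_le_one_add_sq _).trans (by simpa using hz))
    (norm_nonneg _) hν.le

/-- The quadratic form of the asymptotic covariance. -/
lemma dotProduct_asymptoticCov_mulVec (hν : 0 < ν) [IsProbabilityMeasure (latentLaw μ)]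
    (hr : Measurable r)
    (hlat : latentLaw μ = (gaussianLaw d).withDensity fun z => (r z : ℝ≥0∞))
    (hdens : ∀ᵐ z : Fin d → ℝ, latentDensity μ z = r z * gaussianDensity z)
    (hr0 : ∀ᵐ z ∂(gaussianLaw d), 0 < r z)
    (hg : AEStronglyMeasurable (score c θs) (gaussianLaw d)) (hB : Integrable B (gaussianLaw d))
    (hB' : Integrable B (latentLaw μ)) (hgB : ∀ᵐ z ∂(gaussianLaw d), ‖score c θs z‖ ^ 2 ≤ B z)
    (hrank : (infoMatrix μ ν c θs).rank = m) (t : EuclideanSpace ℝ (Fin m)) :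
    t ⬝ᵥ (asymptoticCov μ ν c θs).mulVec t =
      Var[fun z => ⟪Matrix.toEuclideanCLM (𝕜 := ℝ) (infoMatrix μ ν c θs)⁻¹ t,
        (-noiseProb ν (Real.log (r z))) • score c θs z⟫; latentLaw μ] +
      ν * Var[fun z => ⟪Matrix.toEuclideanCLM (𝕜 := ℝ) (infoMatrix μ ν c θs)⁻¹ t,
        dataProb ν (Real.log (r z)) • score c θs z⟫; gaussianLaw d] := by
  have : IsProbabilityMeasure ((gaussianLaw d).withDensity fun z => (r z : ℝ≥0∞)) := by
    rw [← hlat]; infer_instance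
  have hI := infoMatrix_eq_weightedGram (c := c) (θs := θs) hν hdens
  rw [hlat] at hB' ⊢
  rw [variance_score_add hν hr hr0 hg hB hB' hgB, asymptoticCov,
    meanScore_eq_weightedMean hν hdens (integrable_infoWeight_smul hν hr hg hB hgB),
    dotProduct_inv_sub_mulVec (hI ▸ isSymm_weightedGram) (isUnit_det_of_rank_eq hrank), ← hI]
  rfl

/-- The quadratic form is a variance plus `ν` times another variance. -/
lemma posSemidef_asymptoticCov (hν : 0 < ν) [IsProbabilityMeasure (latentLaw μ)]
    (hr : Measurable r)
    (hlat : latentLaw μ = (gaussianLaw d).withDensity fun z => (r z : ℝ≥0∞))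
    (hdens : ∀ᵐ z : Fin d → ℝ, latentDensity μ z = r z * gaussianDensity z)
    (hr0 : ∀ᵐ z ∂(gaussianLaw d), 0 < r z)
    (hg : AEStronglyMeasurable (score c θs) (gaussianLaw d)) (hB : Integrable B (gaussianLaw d))
    (hB' : Integrable B (latentLaw μ)) (hgB : ∀ᵐ z ∂(gaussianLaw d), ‖score c θs z‖ ^ 2 ≤ B z)
    (hrank : (infoMatrix μ ν c θs).rank = m) : (asymptoticCov μ ν c θs).PosSemidef := by
  refine Matrix.PosSemidef.of_dotProduct_mulVec_nonneg ?_ fun x => ?_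
  · have := isSymm_inv_sub (A := infoMatrix μ ν c θs)
      (infoMatrix_eq_weightedGram (c := c) (θs := θs) hν hdens ▸ isSymm_weightedGram)
      (meanScore μ ν c θs) (1 + 1 / ν)
    rw [Matrix.IsHermitian, Matrix.conjTranspose_eq_transpose_of_trivial]
    exact this
  · have := dotProduct_asymptoticCov_mulVec hν hr hlat hdens hr0 hg hB hB' hgB hrank
      (WithLp.toLp 2 x)
    simp only [star_trivial]
    refine le_of_le_of_eq ?_ this.symm
    exact add_nonneg (variance_nonneg _ _) (mul_nonneg hν.le (variance_nonneg _ _))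

end AsymptoticCovariance

open scoped RealInnerProductSpace in
/-- The central limit theorem for the image under a symmetric map `-A` of the sum of two empirical
means. -/
lemma tendstoInDistribution_neg_map_two_sample {α Ω ι : Type*} [MeasurableSpace α]
    [MeasurableSpace Ω] {P : Measure Ω} [IsProbabilityMeasure P] [Fintype ι] [DecidableEq ι]
    {ρ₁ ρ₂ : Measure α} {Z W : ℕ → Ω → α} (hZ : ∀ l, HasLaw (Z l) ρ₁ P)
    (hW : ∀ l, HasLaw (W l) ρ₂ P) (hindep : iIndepFun (Sum.elim Z W) P)
    {f₁ f₂ : α → EuclideanSpace ℝ ι} (hf₁ : MemLp f₁ 2 ρ₁) (hf₂ : MemLp f₂ 2 ρ₂) {ν : ℝ}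
    (hν : 0 < ν) (hmean : ∫ z, f₁ z ∂ρ₁ + ν • ∫ z, f₂ z ∂ρ₂ = 0) {N M : ℕ → ℕ}
    (hN : Tendsto N atTop atTop) (hNM : Tendsto (fun k => (M k : ℝ) / N k) atTop (𝓝 ν))
    {A : EuclideanSpace ℝ ι →L[ℝ] EuclideanSpace ℝ ι} (hA : ∀ t x, ⟪t, A x⟫ = ⟪A t, x⟫)
    {S : Matrix ι ι ℝ} (hS : S.PosSemidef)
    (hquad : ∀ t : EuclideanSpace ℝ ι, t ⬝ᵥ S.mulVec t =
      Var[fun z => ⟪A t, f₁ z⟫; ρ₁] + ν * Var[fun z => ⟪A t, f₂ z⟫; ρ₂]) :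
    TendstoInDistribution (fun k ω => √(N k : ℝ) •
      -A ((N k : ℝ)⁻¹ • ∑ l ∈ Finset.range (N k), f₁ (Z l ω) +
        ν • ((M k : ℝ)⁻¹ • ∑ l ∈ Finset.range (M k), f₂ (W l ω)))) atTop
      (id : EuclideanSpace ℝ ι → EuclideanSpace ℝ ι) (fun _ => P) (multivariateGaussian 0 S) := by
  have hprob₁ : IsProbabilityMeasure ρ₁ := (hZ 0).isProbabilityMeasure_iff.1 inferInstance
  have hprob₂ : IsProbabilityMeasure ρ₂ := (hW 0).isProbabilityMeasure_iff.1 inferInstance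
  have hL₁ : MemLp (fun z => (-A) (f₁ z)) 2 ρ₁ := (-A).comp_memLp' hf₁
  have hL₂ : MemLp (fun z => (-A) (f₂ z)) 2 ρ₂ := (-A).comp_memLp' hf₂
  have hae₁ := hL₁.1.aemeasurable
  have hae₂ := hL₂.1.aemeasurable
  have hm₁ : ∀ l, AEMeasurable (fun z => (-A) (f₁ z)) (P.map (Z l)) := fun l => by
    rwa [(hZ l).map_eq]
  have hm₂ : ∀ l, AEMeasurable (fun z => (-A) (f₂ z)) (P.map (W l)) := fun l => by
    rwa [(hW l).map_eq]
  have hmem : ∀ {ρ : Measure α} {Y : Ω → α} {f : α → EuclideanSpace ℝ ι}, HasLaw Y ρ P →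
      MemLp f 2 ρ → MemLp (fun ω => f (Y ω)) 2 P := fun hY hf =>
    (memLp_map_measure_iff (by rw [hY.map_eq]; exact hf.1) hY.aemeasurable).1
      (by rw [hY.map_eq]; exact hf)
  have hvar : ∀ {ρ : Measure α} {Y : Ω → α} {f : α → EuclideanSpace ℝ ι}, HasLaw Y ρ P →
      MemLp f 2 ρ → ∀ t, Var[fun ω => ⟪t, (-A) (f (Y ω))⟫; P] = Var[fun z => ⟪A t, f z⟫; ρ] :=
    fun {ρ Y f} hY hf t => by
      have h1 : ∀ z, ⟪t, (-A) (f z)⟫ = -⟪A t, f z⟫ := fun z => by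
        rw [neg_apply, inner_neg_right, hA]
      simp only [h1]
      rw [variance_fun_neg]
      have h2 := (hf.const_inner (𝕜 := ℝ) (A t)).1.aemeasurable
      rw [← hY.map_eq] at h2 ⊢
      exact (variance_map h2 hY.aemeasurable).symm
  have hid : ∀ {ρ : Measure α} {Y : ℕ → Ω → α}, (∀ l, HasLaw (Y l) ρ P) →
      ∀ l, IdentDistrib (Y l) (Y 0) P P := fun hY l =>
    ⟨(hY l).aemeasurable, (hY 0).aemeasurable, (hY l).map_eq.trans (hY 0).map_eq.symm⟩
  have key := tendstoInDistribution_two_sample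
    (iIndepFun_sum_elim_comp hindep (fun l => (hZ l).aemeasurable) (fun l => (hW l).aemeasurable)
      hm₁ hm₂)
    (fun l => (hid hZ l).comp_of_aemeasurable (hm₁ l))
    (fun l => (hid hW l).comp_of_aemeasurable (hm₂ l))
    (hmem (hZ 0) hL₁) (hmem (hW 0) hL₂) hν ?_ hN hNM hS (fun t => ?_)
  · refine key.congr (fun k => ae_of_all _ fun ω => ?_) ae_eq_rfl
    simp only [map_add, map_smul, map_sum, neg_apply, Finset.sum_neg_distrib, smul_neg, neg_add]
  · have e₁ := (hZ 0).integral_comp hL₁.1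
    have e₂ := (hW 0).integral_comp hL₂.1
    rw [(-A).integral_comp_comm (hf₁.integrable one_le_two)] at e₁
    rw [(-A).integral_comp_comm (hf₂.integrable one_le_two)] at e₂
    refine (congrArg₂ (fun x y => x + ν • y) e₁ e₂).trans ?_
    rw [← map_smul, ← map_add, hmean, map_zero]
  · rw [hquad, hvar (hZ 0) hf₁, hvar (hW 0) hf₂]

/-! ### Asymptotic normality. -/

section Asymptotics

open scoped RealInnerProductSpace

variable {d m : ℕ} {μ : Measure (Fin d → ℝ)} [IsProbabilityMeasure μ] {ν : ℝ}
  {Θ : Set (EuclideanSpace ℝ (Fin m))}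
  {c : EuclideanSpace ℝ (Fin m) → (Fin d → ℝ) → ℝ≥0} {θs : EuclideanSpace ℝ (Fin m)}

lemma symm_toEuclideanCLM_inv {A : Matrix (Fin m) (Fin m) ℝ} (hA : A.IsSymm)
    (t x : EuclideanSpace ℝ (Fin m)) :
    ⟪t, Matrix.toEuclideanCLM (𝕜 := ℝ) A⁻¹ x⟫ = ⟪Matrix.toEuclideanCLM (𝕜 := ℝ) A⁻¹ t, x⟫ := by
  rw [Matrix.inner_toEuclideanCLM, real_inner_comm, Matrix.inner_toEuclideanCLM,
    Matrix.dotProduct_mulVec, ← Matrix.mulVec_transpose, Matrix.transpose_nonsing_inv, hA.eq,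
    dotProduct_comm]

/-- The asymptotic normality of the estimator. -/
theorem asymptotic_normality (hν : 0 < ν) (hc : ∀ θ ∈ Θ, Measurable (c θ)) (hθs : θs ∈ Θ)
    (hlat : latentLaw μ = (gaussianLaw d).withDensity fun z => (c θs z : ℝ≥0∞))
    (hind : (independentLaw μ).map (transform μ) = gaussianLaw d)
    {Ω : Type*} [MeasurableSpace Ω] {P : Measure Ω} [IsProbabilityMeasure P]
    {X Y : ℕ → Ω → Fin d → ℝ} (hX : ∀ k, HasLaw (X k) μ P)
    (hY : ∀ k, HasLaw (Y k) (independentLaw μ) P) (hindep : iIndepFun (Sum.elim X Y) P)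
    {N M : ℕ → ℕ} (hN : Tendsto N atTop atTop)
    (hNM : Tendsto (fun k => (M k : ℝ) / N k) atTop (𝓝 ν))
    {θhat : ℕ → Ω → EuclideanSpace ℝ (Fin m)} (hθhat : ∀ k, AEMeasurable (θhat k) P)
    (hmin : Tendsto (fun k => P {ω | ¬ (θhat k ω ∈ Θ ∧ IsMinOn (fun θ => empiricalLoss μ ν (N k)
      (M k) (fun l => X l ω) (fun l => Y l ω) (c θ)) Θ (θhat k ω))}) atTop (𝓝 0))
    (hcons : TendstoInMeasure P θhat atTop (fun _ => θs)) (hsmooth : SmoothAt μ Θ c θs)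
    (hrank : (infoMatrix μ ν c θs).rank = m) :
    (asymptoticCov μ ν c θs).PosSemidef ∧
      TendstoInDistribution (fun k ω => √(N k : ℝ) • (θhat k ω - θs)) atTop
        (id : EuclideanSpace ℝ (Fin m) → EuclideanSpace ℝ (Fin m)) (fun _ => P)
        (multivariateGaussian 0 (asymptoticCov μ ν c θs)) := by
  have hlatac : latentLaw μ ≪ gaussianLaw d := hlat ▸ withDensity_absolutelyContinuous _ _
  obtain ⟨r, B, hr, hball, hB', hB, hreg₁, hreg₂⟩ := exists_regularOn_of_smoothAt
    (hlatac.trans gaussianLaw_absolutelyContinuous_volume) hsmooth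
  have hprob : IsProbabilityMeasure (latentLaw μ) :=
    Measure.isProbabilityMeasure_map measurable_transform.aemeasurable
  have hcb : ∀ θ ∈ Metric.ball θs r, Measurable (c θ) := fun θ hθ => hc θ (hball hθ)
  have hs := Metric.mem_ball_self (x := θs) hr
  have hcs := hc θs hθs
  have hdens := latentDensity_of_withDensity hcs hlat
  have hr0 : ∀ᵐ z ∂(gaussianLaw d), 0 < c θs z := hreg₂.mono fun z hz => (hz θs hs).1
  have hgB : ∀ᵐ z ∂(gaussianLaw d), ‖score c θs z‖ ^ 2 ≤ B z :=
    hreg₂.mono fun z hz => (hz θs hs).2.2.1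
  have hg : AEStronglyMeasurable (score c θs) (gaussianLaw d) := aestronglyMeasurable_gradient hcb
    (hreg₂.mono fun z hz θ hθ => (hz θ hθ).2.1.differentiableAt (by norm_num)) hs
  have hpsd := posSemidef_asymptoticCov hν hcs hlat hdens hr0 hg hB hB' hgB hrank
  refine ⟨hpsd, ?_⟩
  have hM := tendsto_atTop_of_ratio hν hN hNM
  have hZ : ∀ l, HasLaw (fun ω => transform μ (X l ω)) (latentLaw μ) P := fun l =>
    HasLaw.fun_comp ⟨measurable_transform.aemeasurable, rfl⟩ (hX l)
  have hW : ∀ l, HasLaw (fun ω => transform μ (Y l ω)) (gaussianLaw d) P := fun l =>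
    HasLaw.fun_comp ⟨measurable_transform.aemeasurable, hind⟩ (hY l)
  have hZW : iIndepFun (Sum.elim (fun l ω => transform μ (X l ω))
      (fun l ω => transform μ (Y l ω))) P :=
    iIndepFun_sum_elim_comp hindep (fun l => (hX l).aemeasurable) (fun l => (hY l).aemeasurable)
      (fun _ => measurable_transform.aemeasurable) (fun _ => measurable_transform.aemeasurable)
  have hI := infoMatrix_eq_weightedGram (c := c) (θs := θs) hν hdens
  have hsymm : (infoMatrix μ ν c θs).IsSymm := hI ▸ isSymm_weightedGram
  have hf₁ := memLp_two_smul (continuous_neg_noiseProb hν) (abs_neg_noiseProb_le hν) hcs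
    (hg.mono_ac hlatac) hB' (hlatac.ae_le hgB)
  have hf₂ := memLp_two_smul (continuous_dataProb hν) (abs_dataProb_le hν) hcs hg hB hgB
  have hmean : ∫ z, (-noiseProb ν (Real.log (c θs z))) • score c θs z ∂(latentLaw μ) +
      ν • ∫ z, dataProb ν (Real.log (c θs z)) • score c θs z ∂(gaussianLaw d) = 0 := by
    rw [hlat, integral_score_withDensity hcs hr0, integral_score hν hr0, smul_smul,
      mul_inv_cancel₀ hν.ne', one_smul, neg_add_cancel]
  have hlim := tendstoInDistribution_neg_map_two_sample hZ hW hZW hf₁ hf₂ hν hmean hN hNM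
    (symm_toEuclideanCLM_inv hsymm) hpsd
    (dotProduct_asymptoticCov_mulVec hν hcs hlat hdens hr0 hg hB hB' hgB hrank)
  have happly : ∀ (σ τ : ℝ → ℝ) z v, weightedHessian σ τ (fun θ => Real.log (c θ z)) θs v =
      σ (Real.log (c θs z)) • fderiv ℝ (gradient fun θ => Real.log (c θ z)) θs v +
        (τ (Real.log (c θs z)) * ⟪score c θs z, v⟫) • score c θs z := fun σ τ z v => by
    simp only [weightedHessian, add_apply, smul_apply, ContinuousLinearMap.smulRight_apply,
      smul_eq_mul, fderiv_apply_eq_inner_gradient, score]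
  have hi₁ := hreg₁.integrable_weightedHessian hr hcb hB' (hasDerivAt_neg_noiseProb hν)
    (abs_neg_noiseProb_le hν) (abs_probSlope_le hν)
  have hi₂ := hreg₂.integrable_weightedHessian hr hcb hB (hasDerivAt_dataProb hν)
    (abs_dataProb_le hν) (abs_probSlope_le hν)
  -- The mean Hessian of the loss is the information matrix, invertible by full rank.
  have hinv : ∀ v, Matrix.toEuclideanCLM (𝕜 := ℝ) (infoMatrix μ ν c θs)⁻¹
      ((∫ z, weightedHessian (fun t => -noiseProb ν t) (probSlope ν)
          (fun θ => Real.log (c θ z)) θs ∂(latentLaw μ)) v +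
        ν • (∫ z, weightedHessian (dataProb ν) (probSlope ν)
          (fun θ => Real.log (c θ z)) θs ∂(gaussianLaw d)) v) = v := fun v => by
    rw [hlat] at hi₁ ⊢
    rw [integral_hessian_add hν hcs hr0 hg hB hgB
      (ae_of_all _ fun z v => happly _ _ z v) (ae_of_all _ fun z v => happly _ _ z v) hi₁ hi₂ v,
      ← hI, ← mul_apply_eq_comp, ← map_mul,
      Matrix.nonsing_inv_mul _ (isUnit_det_of_rank_eq hrank), map_one,
      one_apply_eq_self]
  have herr₁ : ∀ ε : ℝ, 0 < ε → _ := fun ε hε =>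
    hreg₁.tendsto_linearization_error hr hcb hB' (hasDerivAt_neg_noiseProb hν)
      (abs_neg_noiseProb_le hν) (abs_probSlope_le hν) hZ
      (hZW.precomp (g := Sum.inl) Sum.inl_injective) hN hcons hε
  have herr₂ : ∀ ε : ℝ, 0 < ε → _ := fun ε hε =>
    hreg₂.tendsto_linearization_error hr hcb hB (hasDerivAt_dataProb hν)
      (abs_dataProb_le hν) (abs_probSlope_le hν) hW
      (hZW.precomp (g := Sum.inr) Sum.inr_injective) hM hcons hε
  simp only [Finset.sum_sub_distrib, smul_sub] at herr₁ herr₂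
  refine tendstoInDistribution_of_linearized_score hν hinv
    (fun k => (hθhat k).sub_const _) herr₁ herr₂ ?_ hlim
  rw [tendstoInMeasure_iff_dist] at hcons
  -- The score equation can fail, up to a null set, only if the estimator is no minimiser or lies
  -- outside the ball of regularity.
  have hbad := hmin.add (hcons r hr)
  rw [add_zero] at hbad
  refine tendsto_of_tendsto_of_tendsto_of_le_of_le' tendsto_const_nhds
    hbad
    (Eventually.of_forall fun _ => zero_le) ?_
  filter_upwards [hN.eventually_gt_atTop 0, hM.eventually_gt_atTop 0] with k hkN hkM
  refine le_trans (measure_mono_ae ?_) (measure_union_le _ _)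
  filter_upwards [ae_forall_hasLaw hZ hreg₁, ae_forall_hasLaw hW hreg₂] with ω h₁ h₂ hω
  by_contra hcon
  have h₃ : θhat k ω ∈ Θ ∧ IsMinOn (fun θ => empiricalLoss μ ν (N k) (M k) (fun l => X l ω)
      (fun l => Y l ω) (c θ)) Θ (θhat k ω) := by_contra fun h => hcon (Or.inl h)
  have h₄ : dist (θhat k ω) θs < r := not_le.1 fun h => hcon (Or.inr h)
  refine hω (empirical_score_eq_zero hν hkN hkM Metric.isOpen_ball hball (fun l => ?_)
    (fun l => ?_) h₄ h₃.2)
  · exact ⟨fun θ hθ => (h₁ l θ hθ).1,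
      fun θ hθ => (h₁ l θ hθ).2.1.differentiableAt (by norm_num)⟩
  · exact ⟨fun θ hθ => (h₂ l θ hθ).1,
      fun θ hθ => (h₂ l θ hθ).2.1.differentiableAt (by norm_num)⟩

end Asymptotics

end RatioCopula

/-! ### The main theorem. -/

theorem theorem1 {d m : ℕ}
    -- the law of the data, its joint density `p` and its marginal densities `pm i`
    (μ : Measure (Fin d → ℝ)) [IsProbabilityMeasure μ]
    (p : (Fin d → ℝ) → ℝ≥0) (hp : Measurable p)
    (hμ : μ = volume.withDensity (fun x => (p x : ℝ≥0∞)))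
    (pm : Fin d → ℝ → ℝ≥0) (hpm : ∀ i, Measurable (pm i))
    (hμm : ∀ i, RatioCopula.marginal μ i = volume.withDensity (fun t => (pm i t : ℝ≥0∞)))
    (ν : ℝ) (hν : 0 < ν)
    -- the model class, which contains the true copula density
    (Θ : Set (EuclideanSpace ℝ (Fin m)))
    (c : EuclideanSpace ℝ (Fin m) → (Fin d → ℝ) → ℝ≥0)
    (hc : ∀ θ ∈ Θ, Measurable (c θ))
    (hwell : ∃ θ ∈ Θ, ∀ᵐ z : Fin d → ℝ,
      c θ z = RatioCopula.copulaDensity μ (fun i => RatioCopula.gaussianCDF (z i))) :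
    -- uniqueness: the minimisers of the loss are the parameters of the true copula density
    (RatioCopula.copula μ =
        volume.withDensity (fun u => (RatioCopula.copulaDensity μ u : ℝ≥0∞)) ∧
      (∃ θs ∈ Θ, IsMinOn (fun θ => RatioCopula.logisticLoss μ ν (c θ)) Θ θs) ∧
      (∀ θs ∈ Θ, IsMinOn (fun θ => RatioCopula.logisticLoss μ ν (c θ)) Θ θs ↔
        ∀ᵐ x ∂(RatioCopula.independentLaw μ),
          c θs (RatioCopula.transform μ x) =
            RatioCopula.copulaDensity μ (RatioCopula.marginalCDF μ x)) ∧
      (∀ᵐ x ∂(RatioCopula.independentLaw μ),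
        RatioCopula.copulaDensity μ (RatioCopula.marginalCDF μ x) = p x / ∏ i, pm i (x i)) ∧
      (∀ᵐ z : Fin d → ℝ,
        (RatioCopula.copulaDensity μ (fun i => RatioCopula.gaussianCDF (z i)) : ℝ) =
          RatioCopula.latentDensity μ z / RatioCopula.gaussianDensity z) ∧
      (∀ θ₁ ∈ Θ, ∀ θ₂ ∈ Θ,
        IsMinOn (fun θ => RatioCopula.logisticLoss μ ν (c θ)) Θ θ₁ →
        IsMinOn (fun θ => RatioCopula.logisticLoss μ ν (c θ)) Θ θ₂ →
        ∀ᵐ z : Fin d → ℝ, c θ₁ z = c θ₂ z)) ∧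
    -- asymptotics at the minimiser `θs`, for `N k` observations `X` from `μ` and `M k`
    -- observations `Y` from the product of the marginals
    ∀ θs ∈ Θ, IsMinOn (fun θ => RatioCopula.logisticLoss μ ν (c θ)) Θ θs →
    ∀ (Ω : Type*) [MeasurableSpace Ω] (P : Measure Ω) [IsProbabilityMeasure P]
      (X Y : ℕ → Ω → Fin d → ℝ),
      (∀ k, HasLaw (X k) μ P) → (∀ k, HasLaw (Y k) (RatioCopula.independentLaw μ) P) →
      iIndepFun (Sum.elim X Y) P →
    ∀ (N M : ℕ → ℕ), Tendsto N atTop atTop →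
      Tendsto (fun k => (M k : ℝ) / N k) atTop (𝓝 ν) →
    -- the estimator minimises the empirical loss, with probability tending to one
    ∀ (θhat : ℕ → Ω → EuclideanSpace ℝ (Fin m)), (∀ k, AEMeasurable (θhat k) P) →
      Tendsto (fun k => P {ω | ¬ (θhat k ω ∈ Θ ∧
        IsMinOn (fun θ => RatioCopula.empiricalLoss μ ν (N k) (M k)
          (fun l => X l ω) (fun l => Y l ω) (c θ)) Θ (θhat k ω))}) atTop (𝓝 0) →
    -- uniform convergence of the empirical loss, in probability
      (∀ ε : ℝ≥0∞, 0 < ε →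
        Tendsto (fun k => P {ω | ε ≤ RatioCopula.supDist Θ
          (fun θ => RatioCopula.empiricalLoss μ ν (N k) (M k)
            (fun l => X l ω) (fun l => Y l ω) (c θ))
          (fun θ => RatioCopula.logisticLoss μ ν (c θ))}) atTop (𝓝 0)) →
      RatioCopula.IdentifiedAt Θ c θs →
    -- consistency
      TendstoInMeasure P θhat atTop (fun _ => θs) ∧
    -- asymptotic normality
      (RatioCopula.SmoothAt μ Θ c θs → (RatioCopula.infoMatrix μ ν c θs).rank = m →
        (RatioCopula.asymptoticCov μ ν c θs).PosSemidef ∧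
        TendstoInDistribution (fun k ω => √(N k : ℝ) • (θhat k ω - θs)) atTop
          (id : EuclideanSpace ℝ (Fin m) → EuclideanSpace ℝ (Fin m)) (fun _ => P)
          (multivariateGaussian 0 (RatioCopula.asymptoticCov μ ν c θs))) := by
  have hna : ∀ i, NullSingletonClass (RatioCopula.marginal μ i) := fun i =>
    RatioCopula.nullSingletonClass_withDensity (hμm i)
  have hrm : Measurable fun x : Fin d → ℝ => p x / ∏ i, pm i (x i) :=
    hp.div (Finset.measurable_prod _ fun i _ => (hpm i).comp (measurable_pi_apply i))
  obtain ⟨hcop, hcube, hratio⟩ := RatioCopula.copula_of_density hrm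
    (RatioCopula.eq_withDensity_independentLaw hp hμ hpm hμm)
  have hlat := RatioCopula.latentLaw_of_copula hcube
  have hr₀ : Measurable fun z => RatioCopula.copulaDensity μ (RatioCopula.gaussianCDFs z) :=
    RatioCopula.measurable_copulaDensity.comp RatioCopula.measurable_gaussianCDFs
  have hind := RatioCopula.map_transform_independentLaw (μ := μ)
  obtain ⟨θ₀, hθ₀, hθ₀c⟩ := hwell
  have hθ₀g : ∀ᵐ z ∂(RatioCopula.gaussianLaw d),
      c θ₀ z = RatioCopula.copulaDensity μ (RatioCopula.gaussianCDFs z) :=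
    RatioCopula.gaussianLaw_absolutelyContinuous_volume.ae_le hθ₀c
  have hiff := fun θs (hθs : θs ∈ Θ) => RatioCopula.isMinOn_logisticLoss_iff hν hr₀ hlat hind hc
    ⟨θ₀, hθ₀, hθ₀g⟩ hθs
  refine ⟨⟨hcop, ⟨θ₀, hθ₀, (hiff θ₀ hθ₀).2 hθ₀g⟩, fun θs hθs => ?_, hratio, ?_,
    fun θ₁ h₁ θ₂ h₂ hm₁ hm₂ => ?_⟩, ?_⟩
  -- Almost every latent point is carried back to almost every data point, as `gaussianLaw d` is the
  -- image of the product of the marginals.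
  · rw [hiff θs hθs, ← hind, ae_map_iff RatioCopula.measurable_transform.aemeasurable
      (measurableSet_eq_fun (hc θs hθs) hr₀)]
    refine eventually_congr ?_
    filter_upwards [RatioCopula.ae_gaussianCDFs_transform (μ := μ)] with x hx
    rw [hx]
  · filter_upwards [RatioCopula.latentDensity_of_withDensity hr₀ hlat] with z hz
    rw [hz, mul_div_cancel_right₀ _ (RatioCopula.gaussianDensity_pos z).ne']
    rfl
  · filter_upwards [RatioCopula.volume_absolutelyContinuous_gaussianLaw.ae_le
      ((hiff θ₁ h₁).1 hm₁), RatioCopula.volume_absolutelyContinuous_gaussianLaw.ae_le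
      ((hiff θ₂ h₂).1 hm₂)] with z e₁ e₂
    rw [e₁, e₂]
  · intro θs hθs hmin Ω _ P _ X Y hX hY hindep N M hN hNM θhat hθhat hest hunif hid
    have hθsc := (hiff θs hθs).1 hmin
    -- A minimiser agrees with the truth almost everywhere, so its own ratio serves as the latent
    -- density.
    have hlat' : RatioCopula.latentLaw μ =
        (RatioCopula.gaussianLaw d).withDensity fun z => (c θs z : ℝ≥0∞) :=
      hlat.trans (withDensity_congr_ae (hθsc.mono fun z hz => by simp only [hz]))
    have hcons : TendstoInMeasure P θhat atTop (fun _ => θs) := by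
      refine RatioCopula.tendstoInMeasure_of_gap hθs (fun ε hε => ?_) hest hunif
      rw [RatioCopula.logisticLoss_congr_ae hr₀ hlat hind (hc θs hθs) hr₀ hθsc]
      exact RatioCopula.exists_gap_of_identifiedAt hν hr₀ hlat hind hc hθsc hid hε
    exact ⟨hcons, RatioCopula.asymptotic_normality hν hc hθs hlat' hind hX hY hindep hN hNM hθhat
      hest hcons⟩
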